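/- **Model.** An instance of Online Stochastic Matching is a finite bipartite type graph $G=(I,J,E)$ with online vertex types $I$, offline vertices $J$ and arrival rates $\lambda_i>0$ $(i\in I)$; $J_i$ is the neighbourhood of $i$. Online vertices of type $i$ arrive during $[0,1]$ according to a Poisson process of rate $\lambda_i$, independently for different types. When an online vertex arrives, its type is revealed and it must be matched immediately and irrevocably to an unmatched offline neighbour of its type, or left unmatched. An algorithm is $\Gamma$-competitive if on every instance the expected size of its matching is at least $\Gamma\cdot\mathbb{E}[\mathrm{OPT}]$, where $\mathrm{OPT}$ is the size of a maximum matching of the realized bipartite graph. **Natural LP.** Maximize $\sum_{(i,j)\in E}x_{ij}$ subject to $x\ge 0$, $\sum_{j\in J_i}x_{ij}\le\lambda_i$ for all $i\in I$, and $\sum_{i\in S}x_{ij}\le 1-\exp(-\sum_{i\in S}\lambda_i)$ for all $j\in J$ and all sets $S$ of neighbours of $j$. **Algorithm.** Let $0<\theta\le\frac12$, $a=1-\ln(1-\theta)$, $b=\frac1\theta$, $p(\rho)=\min\{\rho/\theta,1\}$ and $$\alpha(t)=1-\tfrac{b}{b-a}e^{-a(1-t)}+\tfrac{a}{b-a}e^{-b(1-t)},\qquad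 \beta(t)=\tfrac{1}{b-a}\bigl(e^{-a(1-t)}-e^{-b(1-t)}\bigr).$$ Given a reference solution $x$, if $U\subseteq J$ is the set of unmatched offline vertices at time $t$, put $\rho_i=\frac1{\lambda_i}\sum_{j\in J_i\cap U}x_{ij}$ and $$\Phi(t,U)=\alpha(t)\sum_{i\in I}\lambda_i\rho_i+\beta(t)\sum_{i\in I}\lambda_i\,p(\rho_i).$$ *Regularized Greedy* is the deterministic algorithm that matches an online vertex of type $i$ arriving at time $t$, whenever it has an unmatched neighbour, to the $j\in J_i\cap U$ that minimizes the decrease $\Phi(t,U)-\Phi(t,U\setminus\{j\})$ of the potential (the first such $j$ in a fixed order of $J$ in case of ties). **Theorem.** 1. For every $0<\theta\le\frac12$, Regularized Greedy with any optimal solution $x$ of the Natural LP is $(\alpha(0)+\beta(0))$-competitive. 2. For $\theta=\frac{17}{40}$ it is $0.707$-competitive, and $1-\frac1e<0.707$. 3. For $\theta=\frac{17}{40}$ it runs in polynomial time on a real random-access machine (unit-cost $+,-,\times,/,\exp,\ln$ and comparisons on real numbers, rational constants; index registers that can only be set to zero, incremented, copied, tested for equality and used as loop bounds): one program computes, for every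 instance and every reference solution $x$, each decision of the algorithm in at most $C(|I|+|J|+1)^d$ steps, with constants $C,d$; and one program computes from $G$ and $(\lambda_i)$, in at most $C'(|I|+|J|+1)^{d'}$ steps, a feasible solution of the Natural LP of value at least $0.999$ times the optimum, with which the ratio between the expected size of the matching of Regularized Greedy and $\mathbb{E}[\mathrm{OPT}]$ is still at least $0.707$. -/

import Mathlib

open MeasureTheory ProbabilityTheory

noncomputable section

namespace OnlineStochasticMatching

open scoped Classical

/-! ### The model -/

/-- An instance of Online Stochastic Matching: a bipartite type graph with online vertex types
`Fin n` and offline vertices `Fin m`, and an arrival rate `rate i > 0` for every online type. -/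
structure TypeGraph where
  n : ℕ
  m : ℕ
  adj : Fin n → Fin m → Prop
  rate : Fin n → ℝ
  rate_pos : ∀ i, 0 < rate i

namespace TypeGraph

/-- A sample point assigns to `(i, k)` the waiting time between the `(k-1)`-st and the `k`-th
arrival of type `i` (counting from `k = 0`, where it is the time of the first arrival). -/
abbrev Sample (G : TypeGraph) : Type := Fin G.n × ℕ → ℝ

/-- Independent Poisson processes, one for each online type `i`, of rate `rate i`: all the waiting
times are independent and those of type `i` are exponential with rate `rate i`. -/
def law (G : TypeGraph) : Measure G.Sample :=
  Measure.infinitePi (fun p : Fin G.n × ℕ => expMeasure (G.rate p.1))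

instance (G : TypeGraph) : IsProbabilityMeasure G.law := by
  have h : ∀ p : Fin G.n × ℕ, IsProbabilityMeasure (expMeasure (G.rate p.1)) :=
    fun p => isProbabilityMeasure_expMeasure (G.rate_pos p.1)
  unfold law
  infer_instance

/-- The time of the `k`-th arrival of type `i`, where `p = (i, k)` and `k` counts from `0`. -/
def arrivalTime (G : TypeGraph) (ω : G.Sample) (p : Fin G.n × ℕ) : ℝ :=
  ∑ l ∈ Finset.range (p.2 + 1), ω (p.1, l)

/-- The online vertices, i.e. the arrivals in the time horizon `[0, 1]`. -/
def arrivals (G : TypeGraph) (ω : G.Sample) : Set (Fin G.n × ℕ) :=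
  {p | G.arrivalTime ω p ∈ Set.Icc (0 : ℝ) 1}

/-- The online vertices listed in the order of arrival. (Almost surely there are finitely many of
them and their arrival times are distinct; the two conventions used otherwise, the empty list and
a lexicographic order, only concern an event of probability zero.) -/
def arrivalList (G : TypeGraph) (ω : G.Sample) : List (Fin G.n × ℕ) :=
  if h : (G.arrivals ω).Finite then
    ((h.toFinset.image fun p => toLex (G.arrivalTime ω p, toLex p)).sort).map
      fun q => ofLex (ofLex q).2
  else []

/-- `M` is a matching of the realized bipartite graph: each pair in it joins an online vertex with
an offline neighbour of its type, and no vertex is used twice. -/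
def IsMatching (G : TypeGraph) (ω : G.Sample) (M : Finset ((Fin G.n × ℕ) × Fin G.m)) : Prop :=
  (∀ e ∈ M, e.1 ∈ G.arrivals ω ∧ G.adj e.1.1 e.2) ∧
  Set.InjOn Prod.fst (M : Set ((Fin G.n × ℕ) × Fin G.m)) ∧
  Set.InjOn Prod.snd (M : Set ((Fin G.n × ℕ) × Fin G.m))

/-- The size of a maximum matching in hindsight. (All sizes are at most `m`.) -/
def optSize (G : TypeGraph) (ω : G.Sample) : ℕ :=
  sSup {k | ∃ M, G.IsMatching ω M ∧ M.card = k}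

/-- A deterministic online algorithm of the kind considered here: given the time `t`, the set `U`
of unmatched offline vertices and the type `i` of the vertex that arrives at time `t`, it selects
an offline vertex to match the arrival to, or none. -/
abbrev Policy (G : TypeGraph) : Type := ℝ → Finset (Fin G.m) → Fin G.n → Option (Fin G.m)

/-- The offline vertices left unmatched by `M`. -/
def unmatched (G : TypeGraph) (M : Finset ((Fin G.n × ℕ) × Fin G.m)) : Finset (Fin G.m) :=
  Finset.univ \ M.image Prod.snd

/-- The irrevocable decision of the algorithm on the arrival `p` when its current matching
is `M`. -/
def step (G : TypeGraph) (alg : G.Policy) (ω : G.Sample)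
    (M : Finset ((Fin G.n × ℕ) × Fin G.m)) (p : Fin G.n × ℕ) :
    Finset ((Fin G.n × ℕ) × Fin G.m) :=
  match alg (G.arrivalTime ω p) (G.unmatched M) p.1 with
  | none => M
  | some j => insert (p, j) M

/-- The final matching of the online algorithm. -/
def algMatching (G : TypeGraph) (alg : G.Policy) (ω : G.Sample) :
    Finset ((Fin G.n × ℕ) × Fin G.m) :=
  (G.arrivalList ω).foldl (G.step alg ω) ∅

/-- The inequality `Γ · E[OPT] ≤ E[ALG]` on the instance `G`, together with the assertion that both
expectations are meaningful. -/
def HasRatio (G : TypeGraph) (alg : G.Policy) (Γ : ℝ) : Prop :=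
  Integrable (fun ω => (G.optSize ω : ℝ)) G.law ∧
  Integrable (fun ω => ((G.algMatching alg ω).card : ℝ)) G.law ∧
  Γ * ∫ ω, (G.optSize ω : ℝ) ∂G.law ≤ ∫ ω, ((G.algMatching alg ω).card : ℝ) ∂G.law

/-! ### The Natural LP -/

/-- The neighbourhood `J_i` of the online type `i`. -/
def nbr (G : TypeGraph) (i : Fin G.n) : Finset (Fin G.m) := {j | G.adj i j}

/-- Feasibility for the Natural LP. Only the values `x i j` on edges matter. -/
structure IsLPFeasible (G : TypeGraph) (x : Fin G.n → Fin G.m → ℝ) : Prop where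
  nonneg : ∀ i j, G.adj i j → 0 ≤ x i j
  online : ∀ i, ∑ j ∈ G.nbr i, x i j ≤ G.rate i
  offline : ∀ j, ∀ S : Finset (Fin G.n), (∀ i ∈ S, G.adj i j) →
    ∑ i ∈ S, x i j ≤ 1 - Real.exp (-∑ i ∈ S, G.rate i)

/-- The objective of the Natural LP. -/
def lpValue (G : TypeGraph) (x : Fin G.n → Fin G.m → ℝ) : ℝ :=
  ∑ i, ∑ j ∈ G.nbr i, x i j

/-- `x` is an optimal solution of the Natural LP. -/
def IsLPOptimal (G : TypeGraph) (x : Fin G.n → Fin G.m → ℝ) : Prop :=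
  G.IsLPFeasible x ∧ ∀ x', G.IsLPFeasible x' → G.lpValue x' ≤ G.lpValue x

end TypeGraph

/-! ### The potential function and Regularized Greedy -/

/-- The exponent `a = 1 - ln (1 - θ)`; the other exponent is `b = 1 / θ`. -/
def expA (θ : ℝ) : ℝ := 1 - Real.log (1 - θ)

/-- `α(t) = 1 - b/(b-a) e^{-a(1-t)} + a/(b-a) e^{-b(1-t)}`. -/
def alpha (θ t : ℝ) : ℝ :=
  1 - θ⁻¹ / (θ⁻¹ - expA θ) * Real.exp (-(expA θ * (1 - t)))
    + expA θ / (θ⁻¹ - expA θ) * Real.exp (-(θ⁻¹ * (1 - t)))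

/-- `β(t) = 1/(b-a) (e^{-a(1-t)} - e^{-b(1-t)})`. -/
def beta (θ t : ℝ) : ℝ :=
  1 / (θ⁻¹ - expA θ) *
    (Real.exp (-(expA θ * (1 - t))) - Real.exp (-(θ⁻¹ * (1 - t))))

/-- `p(ρ) = min {ρ / θ, 1}`. -/
def capped (θ ρ : ℝ) : ℝ := min (ρ / θ) 1

namespace TypeGraph

/-- The normalized unmatched portion `ρ_i = x_i / λ_i` of the fractional matching of type `i`,
when `U` is the set of unmatched offline vertices. -/
def rho (G : TypeGraph) (x : Fin G.n → Fin G.m → ℝ) (U : Finset (Fin G.m)) (i : Fin G.n) : ℝ :=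
  (∑ j ∈ G.nbr i ∩ U, x i j) / G.rate i

/-- The potential `Φ(t) = α(t) X + β(t) Y` with `X = ∑ λ_i ρ_i` (the unmatched portion of the
fractional matching) and `Y = ∑ λ_i p(ρ_i)`, when `U` is the set of unmatched offline vertices. -/
def potential (G : TypeGraph) (θ : ℝ) (x : Fin G.n → Fin G.m → ℝ) (t : ℝ)
    (U : Finset (Fin G.m)) : ℝ :=
  alpha θ t * ∑ i, G.rate i * G.rho x U i +
    beta θ t * ∑ i, G.rate i * capped θ (G.rho x U i)

/-- The decrease of the potential if the unmatched offline vertex `j` gets matched at time `t`. -/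
def decrease (G : TypeGraph) (θ : ℝ) (x : Fin G.n → Fin G.m → ℝ) (t : ℝ)
    (U : Finset (Fin G.m)) (j : Fin G.m) : ℝ :=
  G.potential θ x t U - G.potential θ x t (U.erase j)

/-- The unmatched neighbours of type `i` for which the potential decreases the least. -/
def bestNeighbours (G : TypeGraph) (θ : ℝ) (x : Fin G.n → Fin G.m → ℝ) (t : ℝ)
    (U : Finset (Fin G.m)) (i : Fin G.n) : Finset (Fin G.m) :=
  {j ∈ G.nbr i ∩ U | ∀ k ∈ G.nbr i ∩ U, G.decrease θ x t U j ≤ G.decrease θ x t U k}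

/-- Regularized Greedy with reference solution `x`: an arrival is matched to the first unmatched
neighbour for which the potential decreases the least, if it has an unmatched neighbour. -/
def regGreedy (G : TypeGraph) (θ : ℝ) (x : Fin G.n → Fin G.m → ℝ) : G.Policy := fun t U i =>
  if h : (G.bestNeighbours θ x t U i).Nonempty then some ((G.bestNeighbours θ x t U i).min' h)
  else none

end TypeGraph

/-- Regularized Greedy (run with an optimal solution of the Natural LP) is `Γ`-competitive: on all
type graphs, for all arrival rates and whichever optimal solution is used. -/
def RegGreedyCompetitive (θ Γ : ℝ) : Prop :=
  ∀ (G : TypeGraph) (x : Fin G.n → Fin G.m → ℝ), G.IsLPOptimal x →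
    G.HasRatio (G.regGreedy θ x) Γ

/-! ### A real random-access machine with a step count -/

/-- The memory of the machine: natural-number registers, which serve as indices and loop bounds,
and countably many two-dimensional arrays of real numbers. -/
structure RamState where
  reg : ℕ → ℕ
  mem : ℕ → ℕ → ℕ → ℝ

/-- Arithmetic expressions over the real numbers, with rational constants. `cell A r s` is the entry of the array `A` whose
indices are the contents of the registers `r` and `s`. -/
inductive RamExpr where
  | const (c : ℚ)
  | cell (A r s : ℕ)
  | add (e f : RamExpr)
  | sub (e f : RamExpr)
  | mul (e f : RamExpr)
  | div (e f : RamExpr)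
  | exp (e : RamExpr)
  | log (e : RamExpr)

namespace RamExpr

/-- The value of an expression. -/
def eval (σ : RamState) : RamExpr → ℝ
  | const c => (c : ℝ)
  | cell A r s => σ.mem A (σ.reg r) (σ.reg s)
  | add e f => e.eval σ + f.eval σ
  | sub e f => e.eval σ - f.eval σ
  | mul e f => e.eval σ * f.eval σ
  | div e f => e.eval σ / f.eval σ
  | exp e => Real.exp (e.eval σ)
  | log e => Real.log (e.eval σ)

/-- The number of elementary operations in the evaluation of an expression. -/
def cost : RamExpr → ℕ
  | const _ => 1
  | cell _ _ _ => 1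
  | add e f => e.cost + f.cost + 1
  | sub e f => e.cost + f.cost + 1
  | mul e f => e.cost + f.cost + 1
  | div e f => e.cost + f.cost + 1
  | exp e => e.cost + 1
  | log e => e.cost + 1

end RamExpr

/-- Programs. Registers can only be set to zero, incremented and copied; `loop r c` executes `c`
as many times as the content of register `r` says at the start of the loop. -/
inductive RamProg where
  | zero (r : ℕ)
  | incr (r : ℕ)
  | copy (r s : ℕ)
  | store (A r s : ℕ) (e : RamExpr)
  | seq (c d : RamProg)
  | ifLe (e f : RamExpr) (c d : RamProg)
  | ifEq (r s : ℕ) (c d : RamProg)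
  | loop (r : ℕ) (c : RamProg)

namespace RamProg

/-- Execution of a program: the final state together with the number of steps. -/
def run : RamProg → RamState → RamState × ℕ
  | zero r, σ => (⟨Function.update σ.reg r 0, σ.mem⟩, 1)
  | incr r, σ => (⟨Function.update σ.reg r (σ.reg r + 1), σ.mem⟩, 1)
  | copy r s, σ => (⟨Function.update σ.reg r (σ.reg s), σ.mem⟩, 1)
  | store A r s e, σ =>
      (⟨σ.reg, fun B u v =>
        if B = A ∧ u = σ.reg r ∧ v = σ.reg s then e.eval σ else σ.mem B u v⟩, e.cost + 1)
  | seq c d, σ =>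
      let τ := c.run σ
      let υ := d.run τ.1
      (υ.1, τ.2 + υ.2)
  | ifLe e f c d, σ =>
      let τ := if e.eval σ ≤ f.eval σ then c.run σ else d.run σ
      (τ.1, τ.2 + e.cost + f.cost + 1)
  | ifEq r s c d, σ =>
      let τ := if σ.reg r = σ.reg s then c.run σ else d.run σ
      (τ.1, τ.2 + 1)
  | loop r c, σ =>
      (fun τ : RamState × ℕ =>
        let υ := c.run τ.1
        (υ.1, τ.2 + υ.2 + 1))^[σ.reg r] (σ, 1)

/-- The final state of an execution. -/
def output (c : RamProg) (σ : RamState) : RamState := (c.run σ).1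

/-- The number of steps of an execution. -/
def steps (c : RamProg) (σ : RamState) : ℕ := (c.run σ).2

end RamProg

namespace TypeGraph

/-- A vector as column `0` of an array, padded by zeros. -/
def vecCells {k : ℕ} (v : Fin k → ℝ) : ℕ → ℕ → ℝ := fun u w =>
  if h : u < k ∧ w = 0 then v ⟨u, h.1⟩ else 0

/-- A matrix as an array, padded by zeros. -/
def matCells {k l : ℕ} (A : Fin k → Fin l → ℝ) : ℕ → ℕ → ℝ := fun u w =>
  if h : u < k ∧ w < l then A ⟨u, h.1⟩ ⟨w, h.2⟩ else 0

/-- The input of the preprocessing: `n` and `m` in the registers `0` and `1`, the adjacency matrix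
in the array `0`, the arrival rates in the array `1`; all else is zero. -/
def encode (G : TypeGraph) : RamState where
  reg := fun r => if r = 0 then G.n else if r = 1 then G.m else 0
  mem := fun A =>
    if A = 0 then matCells (fun i j => if G.adj i j then 1 else 0)
    else if A = 1 then vecCells G.rate
    else fun _ _ => 0

/-- The input of one online decision: in addition to the instance, the type `i` of the arrival in
the register `2`, the reference solution in the array `2`, the indicator of the set of unmatched
offline vertices in the array `3`, and the time in the array `4`. -/
def encodeArrival (G : TypeGraph) (x : Fin G.n → Fin G.m → ℝ) (t : ℝ) (U : Finset (Fin G.m))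
    (i : Fin G.n) : RamState where
  reg := fun r => if r = 2 then i else G.encode.reg r
  mem := fun A =>
    if A = 2 then matCells (fun i j => if G.adj i j then x i j else 0)
    else if A = 3 then vecCells (fun j => if j ∈ U then 1 else 0)
    else if A = 4 then vecCells (fun _ : Fin 1 => t)
    else G.encode.mem A

/-- The solution that the preprocessing leaves in the array `2`. -/
def readSolution (G : TypeGraph) (σ : RamState) : Fin G.n → Fin G.m → ℝ := fun i j => σ.mem 2 i j

/-- The code of a decision: `0` for none and `j + 1` for the offline vertex `j`. -/
def decisionCode (G : TypeGraph) : Option (Fin G.m) → ℕ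
  | none => 0
  | some j => (j : ℕ) + 1

end TypeGraph

/-- On every instance, whatever the reference solution, and for every possible arrival, a fixed
program computes the decision of Regularized Greedy (as the content of register `3`) in a number
of steps that is polynomial in the number of vertices of the type graph. -/
def PolyTimeDecisions (θ : ℝ) : Prop :=
  ∃ (c : RamProg) (C d : ℕ), ∀ (G : TypeGraph) (x : Fin G.n → Fin G.m → ℝ) (t : ℝ)
    (U : Finset (Fin G.m)) (i : Fin G.n),
    (c.output (G.encodeArrival x t U i)).reg 3 = G.decisionCode (G.regGreedy θ x t U i) ∧
    c.steps (G.encodeArrival x t U i) ≤ C * (G.n + G.m + 1) ^ d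

/-- A fixed program computes on every instance, in a number of steps that is polynomial in the
number of vertices of the type graph, a feasible solution of the Natural LP whose value is at least
`q` times the optimum and with which Regularized Greedy attains the ratio `Γ`. -/
def PolyTimePreprocessing (θ q Γ : ℝ) : Prop :=
  ∃ (c : RamProg) (C d : ℕ), ∀ G : TypeGraph,
    c.steps G.encode ≤ C * (G.n + G.m + 1) ^ d ∧
    G.IsLPFeasible (G.readSolution (c.output G.encode)) ∧
    (∀ x', G.IsLPFeasible x' →
      q * G.lpValue x' ≤ G.lpValue (G.readSolution (c.output G.encode))) ∧
    G.HasRatio (G.regGreedy θ (G.readSolution (c.output G.encode))) Γ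

end OnlineStochasticMatching

end

/-!
The ratio rests on the potential `Φ`, which is linear in `α` and `β`. The size of the matching plus
the potential, `totalValue`, has nonnegative drift: its expectation at time `1`, where `Φ` vanishes,
is at least its value `Φ(0, J)` at the beginning, which is at least `α(0) + β(0)` times the value of
the reference solution. The expected offline optimum is the value of a feasible solution of the
Natural LP, namely of the expected numbers of matched pairs (`isLPFeasible_offlineSolution`), and is
thus at most the optimum of the LP.

*The drift.* Greedy loses at most as much potential as the random choice that matches an arrival of
type `i` to `j` with probability `x i j * p (ρ i) / (λ i * ρ i)` (`le_rate_mul_jump`). As `α` and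
`β` solve a linear system of differential equations, what remains to be shown is free of `t`, namely
`a ∑ λ (b ρ - 1)⁺ ≤ ∑ w j (b - z j)`, where `w j` is the total rate of matches to `j` and `z j` the
loss of `∑ λ p(ρ)` caused by such a match (`weighted_loss_le`). The offline vertices are divided
according to `w j ≤ a` or not. If `w j ≤ a`, the capacity constraints enter through the bound
`∑ (b x i j - (b - 1) λ i)⁺ ≤ b - a (b - 1)` (`sum_excess_le`, from the tangent to `exp (-Λ)` at
`Λ = a - 1`); if `w j ≥ a`, it is enough that the value `∑ x i j` of `j` is at most `1`. For either
division, the resulting lower bounds split into parts for the types, and the part of the type `i` is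
at least `λ i (b ρ i - 1)⁺` (`sum_split_ge`).

*From drift to expectation.* A sample point consists of independent exponential waiting times. Up to
the moment of an arrival, the algorithm does not see its waiting time, so resampling this waiting
time shows that the expected jump at the arrival is the expected integral of `λ i` times the jump
over the time during which the arrival is awaited (`lintegral_arrival_eq_compensator`). Summation
over all arrivals of a type gives the integral over `[0, 1]` (`lintegral_tsum_jump`), and the
fundamental theorem of calculus between the arrivals (`runState_path`) turns nonnegative drift into
a statement on expectations (`le_integral_of_drift_nonneg`).

*Decisions.* A neighbour with the smallest decrease of the potential is one with the largest
remaining potential, so a single pass over the offline vertices that records the first maximizer is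
enough (`decisionProg_spec`).

*Preprocessing.* The exponentially many constraints of an offline vertex say that `∑ x` over a set
of rate `Λ` is at most `1 - exp (-Λ)`. Replacing this concave function by a piecewise linear one,
that is by a combination of `K` layers `min Λ ((k + 1) h)`, loses only a constant factor close to
`1` (`layered_le`, `mul_le_layered`) and turns the problem into a packing of paths with three edges:
from a source of capacity `λ i` along an edge to a layer of `j`, and on to a sink
(`isLPFeasible_of_flow`). Conversely, every fractional cut in this network bounds the Natural LP: a
layer-cake argument over the level sets of the prices reduces weak duality to the constraints of
sets (`mul_sum_le_sum_layers`, `isDualBound_layerCap`). Hence multiplicative weights find a nearly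
optimal packing: each round saturates the shortest path for prices that are exponential in the
congestion, and a number of rounds proportional to the square of the number of resources suffices
(`FlowInvariant.push`, `FlowInvariant.mul_le`). No bound on the arrival rates enters. With constant
parameters the loss is below `0.001` (`exists_parameters`), and for `θ = 17/40` the ratio
`α(0) + β(0)` exceeds `0.707` by enough to absorb it (`ratio_le`).
-/

noncomputable section

namespace OnlineStochasticMatching

open scoped Classical ENNReal

/-! ### Exponential waiting times and the compensator of an arrival -/

theorem lintegral_expMeasure {r : ℝ} (h : ℝ → ℝ≥0∞) (hh : Measurable h) :
    ∫⁻ w, h w ∂expMeasure r =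
      ∫⁻ s in Set.Ioi 0, ENNReal.ofReal (r * Real.exp (-(r * s))) * h s := by
  have e : expMeasure r = volume.withDensity (exponentialPDF r) := rfl
  rw [e, lintegral_withDensity_eq_lintegral_mul _ (by unfold exponentialPDF; fun_prop) hh,
    setLIntegral_congr Ioi_ae_eq_Ici, ← lintegral_indicator measurableSet_Ici]
  refine lintegral_congr fun s => ?_
  by_cases hs : 0 ≤ s
  · simp [hs, exponentialPDF_of_nonneg]
  · simp [hs, exponentialPDF_of_neg (not_le.mp hs)]

theorem expMeasure_Ioi {r : ℝ} (hr : 0 < r) {s : ℝ} (hs : 0 ≤ s) :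
    expMeasure r (Set.Ioi s) = ENNReal.ofReal (Real.exp (-(r * s))) := by
  have := isProbabilityMeasure_expMeasure hr
  have h1 : expMeasure r (Set.Iic s) = ENNReal.ofReal (1 - Real.exp (-(r * s))) := by
    have := cdf_expMeasure_eq hr s
    rw [if_pos hs, cdf_eq_real, Measure.real] at this
    rw [← this, ENNReal.ofReal_toReal (measure_ne_top _ _)]
  rw [← Set.compl_Iic, prob_compl_eq_one_sub measurableSet_Iic, h1, ← ENNReal.ofReal_one,
    ← ENNReal.ofReal_sub _ (by simp; positivity)]
  congr 1; ring

theorem expMeasure_singleton (r s : ℝ) : expMeasure r {s} = 0 := by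
  have e : expMeasure r = volume.withDensity (exponentialPDF r) := rfl
  rw [e]; exact withDensity_absolutelyContinuous _ _ (by simp)

theorem expMeasure_Ici {r : ℝ} (hr : 0 < r) {s : ℝ} (hs : 0 ≤ s) :
    expMeasure r (Set.Ici s) = ENNReal.ofReal (Real.exp (-(r * s))) := by
  rw [← expMeasure_Ioi hr hs, ← Set.Ioi_union_left, measure_union (by simp) (by simp),
    expMeasure_singleton, add_zero]

/-- An exponential waiting time `w` has constant hazard rate: the expectation of `h w` is `r` times
the expected integral of `h` over the time spent waiting. -/
theorem lintegral_expMeasure_eq_compensator {r : ℝ} (hr : 0 < r) (h : ℝ → ℝ≥0∞)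
    (hh : Measurable h) :
    ∫⁻ w, h w ∂expMeasure r =
      ENNReal.ofReal r * ∫⁻ w, (∫⁻ s, (Set.Ioc 0 w).indicator h s) ∂expMeasure r := by
  have := isProbabilityMeasure_expMeasure hr
  have hm : MeasurableSet {q : ℝ × ℝ | 0 < q.2 ∧ q.2 ≤ q.1} :=
    (measurableSet_lt measurable_const measurable_snd).inter
      (measurableSet_le measurable_snd measurable_fst)
  rw [lintegral_lintegral_swap, lintegral_expMeasure h hh, ← lintegral_indicator measurableSet_Ioi,
    ← lintegral_const_mul' _ _ ENNReal.ofReal_ne_top]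
  · refine lintegral_congr fun s => ?_
    by_cases hs : 0 < s
    · have : ∀ w, (Set.Ioc 0 w).indicator h s = (Set.Ici s).indicator (fun _ => h s) w := by
        intro w; simp [Set.indicator, hs]
      simp only [this]
      rw [lintegral_indicator_const measurableSet_Ici, expMeasure_Ici hr hs.le,
        Set.indicator_of_mem (by simpa using hs), ENNReal.ofReal_mul hr.le]
      ring
    · have : ∀ w, (Set.Ioc 0 w).indicator h s = 0 := by
        intro w; simp [Set.indicator, hs]
      simp [hs]
  · have : (Function.uncurry fun w s => (Set.Ioc 0 w).indicator h s)
        = {q : ℝ × ℝ | 0 < q.2 ∧ q.2 ≤ q.1}.indicator (fun q => h q.2) := by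
      ext ⟨w, s⟩; simp [Set.indicator]
    rw [this]
    exact ((hh.comp measurable_snd).indicator hm).aemeasurable

namespace TypeGraph
variable (G : TypeGraph)

/-- Resampling one waiting time preserves the law of the whole family. -/
theorem measurePreserving_update (p : Fin G.n × ℕ) :
    MeasurePreserving (fun q : G.Sample × ℝ => Function.update q.1 p q.2)
      (G.law.prod (expMeasure (G.rate p.1))) G.law := by
  have hI : ∀ p : Fin G.n × ℕ, IsProbabilityMeasure (expMeasure (G.rate p.1)) :=
    fun p => isProbabilityMeasure_expMeasure (G.rate_pos p.1)
  have hm : Measurable (fun q : G.Sample × ℝ => Function.update q.1 p q.2) := by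
    rw [measurable_pi_iff]
    intro q
    by_cases h : q = p
    · subst h; simpa using measurable_snd
    · simp only [Function.update_of_ne h]
      exact (measurable_pi_apply q).comp measurable_fst
  refine ⟨hm, ?_⟩
  refine Measure.eq_infinitePi _ fun s t ht => ?_
  rw [Measure.map_apply hm (MeasurableSet.pi s.countable_toSet fun i _ => ht i)]
  have e : (fun q : G.Sample × ℝ => Function.update q.1 p q.2) ⁻¹' (Set.pi s t)
      = (Set.pi (s.erase p) t) ×ˢ (if p ∈ s then t p else Set.univ) := by
    ext ⟨ω, w⟩
    simp only [Set.mem_preimage, Set.mem_pi, Set.mem_prod]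
    constructor
    · intro h
      refine ⟨fun i hi => ?_, ?_⟩
      · have hi' := Finset.mem_erase.mp hi
        simpa [Function.update_of_ne hi'.1] using h i hi'.2
      · split_ifs with hp
        · simpa using h p hp
        · trivial
    · rintro ⟨h1, h2⟩ i hi
      by_cases hip : i = p
      · subst hip
        have : i ∈ s := hi
        simpa [this] using h2
      · simpa [Function.update_of_ne hip] using h1 i (by simpa [hip] using hi)
  rw [e, Measure.prod_prod]
  unfold law
  rw [Measure.infinitePi_pi _ (fun i _ => ht i)]
  by_cases hp : p ∈ s
  · rw [if_pos hp, Finset.prod_erase_mul s _ hp]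
  · rw [if_neg hp, measure_univ, mul_one, Finset.erase_eq_of_notMem hp]

theorem lintegral_law_update (p : Fin G.n × ℕ) {f : G.Sample → ℝ≥0∞} (hf : Measurable f) :
    ∫⁻ ω, f ω ∂G.law =
      ∫⁻ ω, ∫⁻ w, f (Function.update ω p w) ∂expMeasure (G.rate p.1) ∂G.law := by
  have := isProbabilityMeasure_expMeasure (G.rate_pos p.1)
  have h := G.measurePreserving_update p
  rw [← h.lintegral_comp hf, lintegral_prod (fun q => f (Function.update q.1 p q.2))
    (hf.comp h.measurable).aemeasurable]

/-- The time of the arrival before the `k`-th one of type `i`, or `0` if `k = 0`. -/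
def prevTime (ω : G.Sample) (p : Fin G.n × ℕ) : ℝ := ∑ l ∈ Finset.range p.2, ω (p.1, l)

theorem arrivalTime_eq (ω : G.Sample) (p : Fin G.n × ℕ) :
    G.arrivalTime ω p = G.prevTime ω p + ω p := by
  simp [arrivalTime, prevTime, Finset.sum_range_succ]

theorem prevTime_update (ω : G.Sample) (p : Fin G.n × ℕ) (w : ℝ) :
    G.prevTime (Function.update ω p w) p = G.prevTime ω p := by
  refine Finset.sum_congr rfl fun l hl => ?_
  rw [Function.update_of_ne]
  intro h
  have : l = p.2 := congrArg Prod.snd h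
  have := Finset.mem_range.mp hl
  omega

theorem measurable_arrivalTime (p : Fin G.n × ℕ) : Measurable fun ω => G.arrivalTime ω p := by
  unfold arrivalTime; fun_prop

theorem measurable_prevTime (p : Fin G.n × ℕ) : Measurable fun ω => G.prevTime ω p := by
  unfold prevTime; fun_prop

/-- The arrival `p` is compensated by its rate times the time during which it is awaited. The
integrand may depend on the rest of the sample point, but not on the waiting time of `p` itself, so
that this is the statement about one exponential variable, given the other waiting times. -/
theorem lintegral_arrival_eq_compensator (p : Fin G.n × ℕ) (f : ℝ → G.Sample → ℝ≥0∞)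
    (hf : Measurable (Function.uncurry f))
    (hinv : ∀ t ω w, f t (Function.update ω p w) = f t ω) :
    ∫⁻ ω, (if G.arrivalTime ω p ∈ Set.Icc (0 : ℝ) 1 then f (G.arrivalTime ω p) ω else 0) ∂G.law =
      ENNReal.ofReal (G.rate p.1) * ∫⁻ ω, (∫⁻ t in Set.Icc (0 : ℝ) 1,
        (if G.prevTime ω p < t ∧ t ≤ G.arrivalTime ω p then f t ω else 0)) ∂G.law := by
  have hT := G.measurable_arrivalTime p
  have hP := G.measurable_prevTime p
  have m1 : Measurable fun ω => if G.arrivalTime ω p ∈ Set.Icc (0 : ℝ) 1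
      then f (G.arrivalTime ω p) ω else 0 := by
    refine Measurable.ite (hT measurableSet_Icc) ?_ measurable_const
    exact hf.comp (hT.prodMk measurable_id)
  have m2 : Measurable fun ω => ∫⁻ t in Set.Icc (0 : ℝ) 1,
        (if G.prevTime ω p < t ∧ t ≤ G.arrivalTime ω p then f t ω else 0) := by
    refine Measurable.lintegral_prod_right' (f := fun q : G.Sample × ℝ =>
      if G.prevTime q.1 p < q.2 ∧ q.2 ≤ G.arrivalTime q.1 p then f q.2 q.1 else 0) ?_
    refine Measurable.ite ?_ (hf.comp measurable_swap) measurable_const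
    exact (measurableSet_lt (hP.comp measurable_fst) measurable_snd).inter
      (measurableSet_le measurable_snd (hT.comp measurable_fst))
  rw [G.lintegral_law_update p m1, G.lintegral_law_update p m2,
    ← lintegral_const_mul' _ _ ENNReal.ofReal_ne_top]
  refine lintegral_congr fun ω => ?_
  simp only [hinv, arrivalTime_eq, prevTime_update, Function.update_self]
  generalize G.prevTime ω p = r
  have hfω : Measurable fun t => f t ω := hf.comp (measurable_id.prodMk measurable_const)
  rw [lintegral_expMeasure_eq_compensator (G.rate_pos p.1)
    (fun w => if r + w ∈ Set.Icc (0 : ℝ) 1 then f (r + w) ω else 0)]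
  · congr 1
    refine lintegral_congr fun w => ?_
    rw [← lintegral_indicator measurableSet_Icc]
    refine Eq.trans ?_ (lintegral_add_left_eq_self _ r)
    refine lintegral_congr fun s => ?_
    simp only [Set.indicator, Set.mem_Ioc, lt_add_iff_pos_right, add_le_add_iff_left]
    split_ifs <;> simp_all
  · refine Measurable.ite ?_ (hfω.comp (measurable_const_add r)) measurable_const
    exact (measurable_const_add r) measurableSet_Icc

end TypeGraph

/-! ### Almost sure properties of the arrivals -/

/-- A function that is measurable once a countably valued measurable choice `S` is fixed. -/
theorem measurable_of_countable_fibers {α β γ : Type*} [MeasurableSpace α] [MeasurableSpace γ]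
    [Countable β] {S : α → β} (hS : ∀ b, MeasurableSet {a | S a = b}) {F : β → α → γ}
    (hF : ∀ b, Measurable (F b)) : Measurable fun a => F (S a) a := by
  intro s hs
  have : (fun a => F (S a) a) ⁻¹' s = ⋃ b, {a | S a = b} ∩ F b ⁻¹' s := by
    ext a; simp
  rw [this]
  exact MeasurableSet.iUnion fun b => (hS b).inter (hF b hs)

namespace TypeGraph
variable (G : TypeGraph)

theorem ae_pos : ∀ᵐ ω ∂G.law, ∀ p, 0 < ω p := by
  have hI : ∀ p : Fin G.n × ℕ, IsProbabilityMeasure (expMeasure (G.rate p.1)) :=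
    fun p => isProbabilityMeasure_expMeasure (G.rate_pos p.1)
  rw [ae_all_iff]
  intro p
  have h : MeasurePreserving (fun ω : G.Sample => ω p) G.law (expMeasure (G.rate p.1)) :=
    measurePreserving_eval_infinitePi (fun p : Fin G.n × ℕ => expMeasure (G.rate p.1)) p
  refine h.quasiMeasurePreserving.ae (p := fun x => 0 < x) ?_
  rw [ae_iff]
  have e : expMeasure (G.rate p.1) = volume.withDensity (exponentialPDF (G.rate p.1)) := rfl
  have e2 : {a : ℝ | ¬ 0 < a} = Set.Iic 0 := by ext; simp
  rw [e2, e, withDensity_apply _ measurableSet_Iic, setLIntegral_congr Iio_ae_eq_Iic.symm]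
  exact lintegral_exponentialPDF_of_nonpos le_rfl

variable {G}

theorem prevTime_succ (ω : G.Sample) (i : Fin G.n) (k : ℕ) :
    G.prevTime ω (i, k + 1) = G.arrivalTime ω (i, k) := rfl

theorem prevTime_zero (ω : G.Sample) (i : Fin G.n) : G.prevTime ω (i, 0) = 0 := by
  simp [prevTime]

theorem arrivalTime_strictMono {ω : G.Sample} (h : ∀ p, 0 < ω p) (i : Fin G.n) :
    StrictMono fun k => G.arrivalTime ω (i, k) := by
  refine strictMono_nat_of_lt_succ fun k => ?_
  simp only [G.arrivalTime_eq ω (i, k + 1), prevTime_succ]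
  linarith [h (i, k + 1)]

theorem prevTime_nonneg {ω : G.Sample} (h : ∀ p, 0 < ω p) (p : Fin G.n × ℕ) :
    0 ≤ G.prevTime ω p := Finset.sum_nonneg fun _ _ => (h _).le

theorem arrivalTime_pos {ω : G.Sample} (h : ∀ p, 0 < ω p) (p : Fin G.n × ℕ) :
    0 < G.arrivalTime ω p := by
  rw [arrivalTime_eq]; linarith [prevTime_nonneg h p, h p]

/-- The waiting intervals `(prevTime, arrivalTime]` of the arrivals of one type are disjoint.
Together with `exists_waiting`, exactly one arrival of each type is awaited at a time. -/
theorem waiting_unique {ω : G.Sample} (h : ∀ p, 0 < ω p) {i : Fin G.n} {k l : ℕ} {t : ℝ}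
    (hk : G.prevTime ω (i, k) < t ∧ t ≤ G.arrivalTime ω (i, k))
    (hl : G.prevTime ω (i, l) < t ∧ t ≤ G.arrivalTime ω (i, l)) : k = l := by
  have key : ∀ k l : ℕ, k < l → t ≤ G.arrivalTime ω (i, k) → G.prevTime ω (i, l) < t → False := by
    intro k l hkl h1 h2
    obtain ⟨l, rfl⟩ := Nat.exists_eq_succ_of_ne_zero (by omega : l ≠ 0)
    rw [Nat.succ_eq_add_one, prevTime_succ] at h2
    have : G.arrivalTime ω (i, k) ≤ G.arrivalTime ω (i, l) :=
      (arrivalTime_strictMono h i).monotone (by omega : k ≤ l)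
    linarith
  rcases lt_trichotomy k l with h' | h' | h'
  · exact (key k l h' hk.2 hl.1).elim
  · exact h'
  · exact (key l k h' hl.2 hk.1).elim

theorem tsum_waiting_le_one {ω : G.Sample} (h : ∀ p, 0 < ω p) (i : Fin G.n) (t : ℝ) :
    ∑' k, (if G.prevTime ω (i, k) < t ∧ t ≤ G.arrivalTime ω (i, k) then (1 : ℝ≥0∞) else 0) ≤ 1 := by
  by_cases hk : ∃ k, G.prevTime ω (i, k) < t ∧ t ≤ G.arrivalTime ω (i, k)
  · obtain ⟨k, hk⟩ := hk
    rw [tsum_eq_single k]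
    · simp [hk]
    · intro l hl
      rw [if_neg fun h' => hl (waiting_unique h h' hk)]
  · push Not at hk
    rw [ENNReal.tsum_eq_zero.mpr]
    · simp
    · intro k
      rw [if_neg]
      exact fun h' => absurd h'.2 (not_le.mpr (hk k h'.1))

theorem exists_waiting {ω : G.Sample} (hfin : (G.arrivals ω).Finite)
    (h : ∀ p, 0 < ω p) (i : Fin G.n) {t : ℝ} (ht0 : 0 < t) (ht1 : t ≤ 1) :
    ∃ k, G.prevTime ω (i, k) < t ∧ t ≤ G.arrivalTime ω (i, k) := by
  have hex : ∃ k, t ≤ G.arrivalTime ω (i, k) := by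
    by_contra hcon
    push Not at hcon
    refine Set.infinite_of_injective_forall_mem (f := fun k : ℕ => ((i, k) : Fin G.n × ℕ))
      (fun a b hab => by simpa using hab) (fun k => ?_) hfin
    exact ⟨(arrivalTime_pos h _).le, (hcon k).le.trans ht1⟩
  refine ⟨Nat.find hex, ?_, Nat.find_spec hex⟩
  rcases hc : Nat.find hex with _ | k
  · rw [prevTime_zero]; exact ht0
  · rw [prevTime_succ]
    exact not_le.mp (Nat.find_min hex (m := k) (by omega))

variable (G)

/-- The expected number of arrivals of type `i` is at most `λ i`, since the waiting intervals are
disjoint. -/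
theorem tsum_prob_arrival_le (i : Fin G.n) :
    ∑' k, ∫⁻ ω, (if G.arrivalTime ω (i, k) ∈ Set.Icc (0 : ℝ) 1 then (1 : ℝ≥0∞) else 0) ∂G.law ≤
      ENNReal.ofReal (G.rate i) := by
  have hm : ∀ k, Measurable fun q : G.Sample × ℝ =>
      if G.prevTime q.1 (i, k) < q.2 ∧ q.2 ≤ G.arrivalTime q.1 (i, k) then (1 : ℝ≥0∞) else 0 :=
    fun k => Measurable.ite ((measurableSet_lt ((G.measurable_prevTime _).comp measurable_fst)
      measurable_snd).inter (measurableSet_le measurable_snd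
        ((G.measurable_arrivalTime _).comp measurable_fst))) measurable_const measurable_const
  have h1 : ∀ k, _ = _ := fun k => G.lintegral_arrival_eq_compensator (i, k) (fun _ _ => 1)
    measurable_const (fun _ _ _ => rfl)
  simp only [h1]
  rw [ENNReal.tsum_mul_left, ← lintegral_tsum fun k => (hm k).lintegral_prod_right'.aemeasurable]
  calc _ ≤ ENNReal.ofReal (G.rate i) * ∫⁻ ω, 1 ∂G.law := by
        refine mul_le_mul_right (lintegral_mono_ae ?_) _
        filter_upwards [G.ae_pos] with ω hω
        have hmω : ∀ k, AEMeasurable (fun t : ℝ => if G.prevTime ω (i, k) < t ∧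
            t ≤ G.arrivalTime ω (i, k) then (1 : ℝ≥0∞) else 0)
            (volume.restrict (Set.Icc (0 : ℝ) 1)) :=
          fun k => ((hm k).comp (measurable_prodMk_left (x := ω))).aemeasurable
        rw [← lintegral_tsum hmω]
        calc _ ≤ ∫⁻ t in Set.Icc (0 : ℝ) 1, 1 := lintegral_mono fun t => tsum_waiting_le_one hω i t
          _ = 1 := by simp
    _ = _ := by simp

theorem measurableSet_mem_arrivals (p : Fin G.n × ℕ) : MeasurableSet {ω | p ∈ G.arrivals ω} :=
  G.measurable_arrivalTime p measurableSet_Icc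

theorem ae_finite_arrivals : ∀ᵐ ω ∂G.law, (G.arrivals ω).Finite := by
  -- The Borel–Cantelli lemma, applied to the arrivals of each type.
  have h : ∀ i, ∀ᵐ ω ∂G.law, {k | (i, k) ∈ G.arrivals ω}.Finite := by
    intro i
    have := measure_setOfPred_frequently_eq_zero (μ := G.law)
      (p := fun k ω => (i, k) ∈ G.arrivals ω) ?_
    · rw [ae_iff]
      convert! this using 3
      ext ω
      exact Nat.frequently_atTop_iff_infinite.symm
    · refine ne_top_of_le_ne_top ENNReal.ofReal_ne_top (le_trans (le_of_eq ?_)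
        (G.tsum_prob_arrival_le i))
      refine tsum_congr fun k => ?_
      rw [← lintegral_indicator_one (G.measurableSet_mem_arrivals _)]
      exact lintegral_congr fun ω => by simp [Set.indicator, arrivals]
  filter_upwards [ae_all_iff.mpr h] with ω hω
  refine (Set.finite_iUnion fun i => (hω i).image fun k => ((i, k) : Fin G.n × ℕ)).subset ?_
  rintro ⟨i, k⟩ hp
  exact Set.mem_iUnion.mpr ⟨i, k, hp, rfl⟩

theorem ae_injective_arrivalTime : ∀ᵐ ω ∂G.law, Function.Injective (G.arrivalTime ω) := by
  have h : ∀ p q : Fin G.n × ℕ, p.1 ≠ q.1 →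
      ∀ᵐ ω ∂G.law, G.arrivalTime ω p ≠ G.arrivalTime ω q := by
    intro p q hpq
    have hm : MeasurableSet {ω | G.arrivalTime ω p = G.arrivalTime ω q} :=
      measurableSet_eq_fun (G.measurable_arrivalTime p) (G.measurable_arrivalTime q)
    rw [ae_iff]
    simp only [not_not]
    -- Given all other waiting times, a tie pins the waiting time of `p` to a single value.
    rw [← lintegral_indicator_one hm, G.lintegral_law_update p (measurable_one.indicator hm)]
    refine (lintegral_congr fun ω => ?_).trans lintegral_zero
    have hq : ∀ w, G.arrivalTime (Function.update ω p w) q = G.arrivalTime ω q := by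
      intro w
      refine Finset.sum_congr rfl fun l _ => Function.update_of_ne (fun h => hpq ?_) _ _
      exact (congrArg Prod.fst h).symm
    have : ∀ w, Set.indicator {ω | G.arrivalTime ω p = G.arrivalTime ω q} (1 : G.Sample → ℝ≥0∞)
        (Function.update ω p w) =
        Set.indicator {G.arrivalTime ω q - G.prevTime ω p} 1 w := by
      intro w
      simp only [Set.indicator, Set.mem_ofPred_eq, hq, G.arrivalTime_eq _ p, prevTime_update,
        Function.update_self, Set.mem_singleton_iff, eq_sub_iff_add_eq', Pi.one_apply]
    simp only [this]
    rw [lintegral_indicator_one (measurableSet_singleton _)]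
    exact expMeasure_singleton _ _
  have h' : ∀ᵐ ω ∂G.law, ∀ p q : Fin G.n × ℕ, p.1 ≠ q.1 →
      G.arrivalTime ω p ≠ G.arrivalTime ω q := by
    simp only [ae_all_iff]
    exact fun p q hpq => h p q hpq
  filter_upwards [h', G.ae_pos] with ω hω hpos p q hpq
  by_contra hne
  by_cases h1 : p.1 = q.1
  · obtain ⟨i, k⟩ := p
    obtain ⟨j, l⟩ := q
    obtain rfl : i = j := h1
    exact hne (by rw [(arrivalTime_strictMono hpos i).injective hpq])
  · exact hω p q h1 hpq

/-! ### The list of arrivals -/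

variable {G}

theorem mem_arrivalList {ω : G.Sample} (h : (G.arrivals ω).Finite) (p : Fin G.n × ℕ) :
    p ∈ G.arrivalList ω ↔ p ∈ G.arrivals ω := by
  unfold arrivalList
  rw [dif_pos h]
  simp only [List.mem_map, Finset.mem_sort, Finset.mem_image, Set.Finite.mem_toFinset]
  constructor
  · rintro ⟨q, ⟨p', hp', rfl⟩, rfl⟩; exact hp'
  · intro hp; exact ⟨_, ⟨p, hp, rfl⟩, rfl⟩

theorem nodup_arrivalList (ω : G.Sample) : (G.arrivalList ω).Nodup := by
  unfold arrivalList
  split_ifs with h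
  · refine List.Nodup.map_on ?_ (Finset.sort_nodup _ _)
    simp only [Finset.mem_sort, Finset.mem_image, Set.Finite.mem_toFinset]
    rintro _ ⟨p, _, rfl⟩ _ ⟨q, _, rfl⟩ hpq
    simp only [ofLex_toLex] at hpq
    rw [hpq]
  · exact List.nodup_nil

/-- The key by which arrivals are sorted. -/
def arrivalKey (ω : G.Sample) (p : Fin G.n × ℕ) : ℝ ×ₗ (Fin G.n ×ₗ ℕ) :=
  toLex (G.arrivalTime ω p, toLex p)

theorem arrivalKey_injective (ω : G.Sample) : Function.Injective (arrivalKey ω) := by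
  intro p q h
  have := congrArg (fun q => ofLex (ofLex q).2) h
  exact this

theorem pairwise_arrivalList (ω : G.Sample) :
    (G.arrivalList ω).Pairwise fun p q => arrivalKey ω p ≤ arrivalKey ω q := by
  unfold arrivalList
  split_ifs with h
  · rw [List.pairwise_map]
    refine (Finset.pairwise_sort _ _).imp_of_mem ?_
    simp only [Finset.mem_sort, Finset.mem_image, Set.Finite.mem_toFinset]
    rintro _ _ ⟨p, _, rfl⟩ ⟨q, _, rfl⟩ hpq
    exact hpq
  · exact List.Pairwise.nil

/-- The list of arrivals is characterized by its members, the absence of repetitions, and its order,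
which are measurable conditions on the sample point. -/
theorem arrivalList_eq_iff {ω : G.Sample} (h : (G.arrivals ω).Finite) (L : List (Fin G.n × ℕ)) :
    G.arrivalList ω = L ↔ (∀ p, p ∈ L ↔ p ∈ G.arrivals ω) ∧ L.Nodup ∧
      L.Pairwise fun p q => arrivalKey ω p ≤ arrivalKey ω q := by
  constructor
  · rintro rfl
    exact ⟨mem_arrivalList h, nodup_arrivalList ω, pairwise_arrivalList ω⟩
  · rintro ⟨h1, h2, h3⟩
    refine List.Perm.eq_of_pairwise (le := fun p q => arrivalKey ω p ≤ arrivalKey ω q)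
      (fun p q _ _ hpq hqp => arrivalKey_injective ω (le_antisymm hpq hqp))
      (pairwise_arrivalList ω) h3 ?_
    rw [List.perm_ext_iff_of_nodup (nodup_arrivalList ω) h2]
    intro p
    rw [h1, mem_arrivalList h]

theorem measurableSet_arrivalKey_le (p q : Fin G.n × ℕ) :
    MeasurableSet {ω : G.Sample | arrivalKey ω p ≤ arrivalKey ω q} := by
  have : {ω : G.Sample | arrivalKey ω p ≤ arrivalKey ω q} =
      {ω | G.arrivalTime ω p < G.arrivalTime ω q} ∪
      ({ω | G.arrivalTime ω p = G.arrivalTime ω q} ∩ {_ω | toLex p ≤ toLex q}) := by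
    ext ω
    simp [arrivalKey, Prod.Lex.toLex_le_toLex]
  rw [this]
  exact (measurableSet_lt (G.measurable_arrivalTime p) (G.measurable_arrivalTime q)).union
    ((measurableSet_eq_fun (G.measurable_arrivalTime p) (G.measurable_arrivalTime q)).inter
      (MeasurableSet.const _))

theorem measurableSet_finite_arrivals : MeasurableSet {ω : G.Sample | (G.arrivals ω).Finite} := by
  have : {ω : G.Sample | (G.arrivals ω).Finite} =
      ⋃ s : Finset (Fin G.n × ℕ), ⋂ p, {ω | p ∈ s ↔ p ∈ G.arrivals ω} := by
    ext ω
    simp only [Set.mem_ofPred_eq, Set.mem_iUnion, Set.mem_iInter]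
    constructor
    · intro h; exact ⟨h.toFinset, fun p => by simp⟩
    · rintro ⟨s, hs⟩
      exact s.finite_toSet.subset fun p hp => (hs p).mpr hp
  rw [this]
  refine MeasurableSet.iUnion fun s => MeasurableSet.iInter fun p => ?_
  by_cases hp : p ∈ s
  · simpa [hp] using G.measurableSet_mem_arrivals p
  · simp only [hp, false_iff]
    exact (G.measurableSet_mem_arrivals p).compl

theorem measurableSet_arrivalList_eq (L : List (Fin G.n × ℕ)) :
    MeasurableSet {ω | G.arrivalList ω = L} := by
  have hp : ∀ L : List (Fin G.n × ℕ), MeasurableSet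
      {ω : G.Sample | L.Pairwise fun p q => arrivalKey ω p ≤ arrivalKey ω q} := by
    intro L
    induction L with
    | nil => simp
    | cons p L ih =>
      simp only [List.pairwise_cons]
      refine MeasurableSet.inter ?_ ih
      have : {ω : G.Sample | ∀ q ∈ L, arrivalKey ω p ≤ arrivalKey ω q} =
          ⋂ q ∈ L, {ω | arrivalKey ω p ≤ arrivalKey ω q} := by ext; simp
      refine (congrArg MeasurableSet this).mpr ?_
      exact MeasurableSet.biInter (Set.to_countable {q | q ∈ L})
        fun q _ => measurableSet_arrivalKey_le p q
  have hmem : MeasurableSet {ω : G.Sample | ∀ p, p ∈ L ↔ p ∈ G.arrivals ω} := by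
    simp only [Set.ofPred_forall]
    refine MeasurableSet.iInter fun p => ?_
    by_cases hp : p ∈ L
    · simpa [hp] using G.measurableSet_mem_arrivals p
    · simp only [hp, false_iff]
      exact (G.measurableSet_mem_arrivals p).compl
  have : {ω : G.Sample | G.arrivalList ω = L} =
      ({ω | (G.arrivals ω).Finite} ∩ {ω | (∀ p, p ∈ L ↔ p ∈ G.arrivals ω) ∧ L.Nodup ∧
        L.Pairwise fun p q => arrivalKey ω p ≤ arrivalKey ω q}) ∪
      ({ω | (G.arrivals ω).Finite}ᶜ ∩ {_ω | [] = L}) := by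
    ext ω
    by_cases h : (G.arrivals ω).Finite
    · simp [h, arrivalList_eq_iff h]
    · simp [h, arrivalList]
  rw [this]
  exact (measurableSet_finite_arrivals.inter (hmem.inter ((MeasurableSet.const _).inter
    (hp L)))).union (measurableSet_finite_arrivals.compl.inter (MeasurableSet.const _))

end TypeGraph

namespace TypeGraph
variable {G : TypeGraph}

/-! ### The state of an algorithm -/

/-- The set of unmatched offline vertices after an arrival of type `i` at time `t`, if it was `U`
before. -/
def nextState (alg : G.Policy) (t : ℝ) (U : Finset (Fin G.m)) (i : Fin G.n) : Finset (Fin G.m) :=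
  match alg t U i with
  | none => U
  | some j => U.erase j

/-- The set of unmatched offline vertices after the arrivals in `L`, if it was `U` before. -/
def runState (alg : G.Policy) (T : Fin G.n × ℕ → ℝ) (L : List (Fin G.n × ℕ))
    (U : Finset (Fin G.m)) : Finset (Fin G.m) :=
  L.foldl (fun U p => nextState alg (T p) U p.1) U

/-- The set of offline vertices that are unmatched immediately before time `t`. -/
def stateBefore (alg : G.Policy) (ω : G.Sample) (t : ℝ) : Finset (Fin G.m) :=
  runState alg (G.arrivalTime ω) ((G.arrivalList ω).filter fun p => G.arrivalTime ω p < t)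
    Finset.univ

/-! ### The size of the matching -/

/-- Processing a list of distinct online vertices keeps the number of matched pairs and the number
of unmatched offline vertices complementary, and changes the unmatched set as `runState` does. -/
theorem foldl_step_spec (alg : G.Policy) (halg : ∀ t U i j, alg t U i = some j → j ∈ U)
    (ω : G.Sample) (L : List (Fin G.n × ℕ)) (hL : L.Nodup)
    (M : Finset ((Fin G.n × ℕ) × Fin G.m)) (hM : ∀ e ∈ M, e.1 ∉ L)
    (hcard : M.card + (G.unmatched M).card = G.m) :
    (L.foldl (G.step alg ω) M).card + (G.unmatched (L.foldl (G.step alg ω) M)).card = G.m ∧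
    G.unmatched (L.foldl (G.step alg ω) M) =
      runState alg (G.arrivalTime ω) L (G.unmatched M) := by
  induction L generalizing M with
  | nil => exact ⟨hcard, rfl⟩
  | cons p L ih =>
    rw [List.nodup_cons] at hL
    have hun : G.unmatched (G.step alg ω M p) =
        nextState alg (G.arrivalTime ω p) (G.unmatched M) p.1 := by
      unfold step nextState
      rcases alg (G.arrivalTime ω p) (G.unmatched M) p.1 with _ | j
      · rfl
      · ext k; simp [unmatched, not_or]
    have hc : (G.step alg ω M p).card + (G.unmatched (G.step alg ω M p)).card = G.m := by
      rw [hun]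
      unfold step nextState
      rcases h : alg (G.arrivalTime ω p) (G.unmatched M) p.1 with _ | j
      · exact hcard
      · have hj := halg _ _ _ _ h
        have hp : (p, j) ∉ M := fun h' => hM _ h' (by simp)
        simp only
        rw [Finset.card_insert_of_notMem hp]
        have := Finset.card_erase_add_one hj
        omega
    have hM' : ∀ e ∈ G.step alg ω M p, e.1 ∉ L := by
      unfold step
      rcases alg (G.arrivalTime ω p) (G.unmatched M) p.1 with _ | j
      · exact fun e he h => hM e he (by simp [h])
      · intro e he
        rcases Finset.mem_insert.mp he with rfl | he
        · exact hL.1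
        · exact fun h => hM e he (by simp [h])
    have := ih hL.2 _ hM' hc
    refine ⟨this.1, this.2.trans ?_⟩
    rw [hun]; rfl

theorem card_algMatching (alg : G.Policy) (halg : ∀ t U i j, alg t U i = some j → j ∈ U)
    (ω : G.Sample) : (G.algMatching alg ω).card +
      (runState alg (G.arrivalTime ω) (G.arrivalList ω) Finset.univ).card = G.m := by
  have h := foldl_step_spec alg halg ω (G.arrivalList ω) (nodup_arrivalList ω) ∅ (by simp)
    (by simp [unmatched])
  have h0 : G.unmatched ∅ = Finset.univ := by simp [unmatched]
  rw [h0] at h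
  rw [← h.2]
  exact h.1

/-! ### Non-anticipation -/

theorem arrivalTime_update_of_ne (ω : G.Sample) (p q : Fin G.n × ℕ) (w : ℝ)
    (h : q.1 = p.1 → q.2 < p.2) :
    G.arrivalTime (Function.update ω p w) q = G.arrivalTime ω q := by
  refine Finset.sum_congr rfl fun l hl => Function.update_of_ne (fun h' => ?_) _ _
  have h1 : q.1 = p.1 := by simpa using congrArg Prod.fst h'
  have h2 : l = p.2 := by simpa using congrArg Prod.snd h'
  have := h h1
  have := Finset.mem_range.mp hl
  omega

theorem arrivalTime_le_of_eq {ω : G.Sample} (hω : ∀ p, 0 < ω p) {p q : Fin G.n × ℕ}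
    (h1 : q.1 = p.1) (h2 : p.2 ≤ q.2) : G.arrivalTime ω p ≤ G.arrivalTime ω q := by
  obtain ⟨i, k⟩ := p
  obtain ⟨j, l⟩ := q
  obtain rfl : j = i := h1
  exact (arrivalTime_strictMono hω j).monotone h2

/-- The state of the algorithm up to the time of an arrival does not depend on the waiting time for
this arrival. -/
theorem stateBefore_update (alg : G.Policy) {ω : G.Sample} (hω : ∀ p, 0 < ω p)
    (hfin : (G.arrivals ω).Finite) (p : Fin G.n × ℕ) {t : ℝ} (ht1 : t ≤ 1)
    (htp : t ≤ G.arrivalTime ω p) :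
    stateBefore alg (Function.update ω p 1) t = stateBefore alg ω t := by
  -- With the waiting time `1`, the arrival `p` and its successors of the same type happen after
  -- time `1 ≥ t`, so they do not influence the state before `t` either.
  set ω' := Function.update ω p 1 with hω'
  have hpos' : ∀ q, 0 < ω' q := by
    intro q
    by_cases h : q = p
    · subst h; simp [hω']
    · simpa [hω', Function.update_of_ne h] using hω q
  have h1 : 1 ≤ G.arrivalTime ω' p := by
    rw [arrivalTime_eq]
    have := prevTime_nonneg hpos' p
    have : ω' p = 1 := by simp [hω']
    linarith
  have hfin' : (G.arrivals ω').Finite := by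
    refine (hfin.union (Set.finite_singleton p)).subset fun q hq => ?_
    by_cases h : q.1 = p.1 → q.2 < p.2
    · left
      have := arrivalTime_update_of_ne ω p q 1 h
      unfold arrivals at hq ⊢
      rw [Set.mem_ofPred_eq] at hq ⊢
      rwa [← this]
    · right
      push Not at h
      by_contra hne
      have hlt : p.2 < q.2 := lt_of_le_of_ne h.2 fun h' => hne (Prod.ext h.1 h'.symm)
      have : G.arrivalTime ω' p < G.arrivalTime ω' q := by
        obtain ⟨i, k⟩ := p
        obtain ⟨j, l⟩ := q
        obtain rfl : j = i := h.1
        exact arrivalTime_strictMono hpos' j hlt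
      exact absurd hq.2 (by simp only [not_le]; linarith)
  have hsame : ∀ q, (G.arrivalTime ω q < t ∨ G.arrivalTime ω' q < t) →
      G.arrivalTime ω' q = G.arrivalTime ω q := by
    intro q hq
    refine arrivalTime_update_of_ne ω p q 1 fun h => ?_
    by_contra hle
    push Not at hle
    have := arrivalTime_le_of_eq hω h hle
    have := arrivalTime_le_of_eq hpos' h hle
    rcases hq with hq | hq <;> linarith
  have hlist : (G.arrivalList ω').filter (fun p => G.arrivalTime ω' p < t) =
      (G.arrivalList ω).filter fun p => G.arrivalTime ω p < t := by
    refine List.Perm.eq_of_pairwise (le := fun p q => arrivalKey ω p ≤ arrivalKey ω q)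
      (fun p q _ _ hpq hqp => arrivalKey_injective ω (le_antisymm hpq hqp)) ?_
      ((pairwise_arrivalList ω).filter _) ?_
    · refine ((pairwise_arrivalList ω').filter _).imp_of_mem fun {q r} hq hr hqr => ?_
      have hq' := hsame q (Or.inr (by simpa using (List.mem_filter.mp hq).2))
      have hr' := hsame r (Or.inr (by simpa using (List.mem_filter.mp hr).2))
      unfold arrivalKey at hqr ⊢
      rwa [hq', hr'] at hqr
    · rw [List.perm_ext_iff_of_nodup ((nodup_arrivalList ω').filter _)
        ((nodup_arrivalList ω).filter _)]
      intro q
      simp only [List.mem_filter, mem_arrivalList hfin, mem_arrivalList hfin', decide_eq_true_eq]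
      unfold arrivals
      simp only [Set.mem_ofPred_eq]
      constructor
      · rintro ⟨h, hq⟩
        rw [hsame q (Or.inr hq)] at h hq
        exact ⟨h, hq⟩
      · rintro ⟨h, hq⟩
        rw [← hsame q (Or.inl hq)] at h hq
        exact ⟨h, hq⟩
  unfold stateBefore
  rw [hlist]
  unfold runState
  refine List.foldl_ext _ _ _ fun U q hq => ?_
  rw [hsame q (Or.inl (by simpa using (List.mem_filter.mp hq).2))]

/-! ### Measurability -/

/-- A policy whose decisions depend measurably on time. -/
def MeasurablePolicy (alg : G.Policy) : Prop :=
  ∀ U i o, MeasurableSet {t | alg t U i = o}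

theorem measurableSet_nextState {alg : G.Policy} (hm : MeasurablePolicy alg) (U V i) :
    MeasurableSet {t | nextState alg t U i = V} := by
  have : {t | nextState alg t U i = V} = ⋃ o : Option (Fin G.m), {t | alg t U i = o} ∩
      {_t | (match o with | none => U | some j => U.erase j) = V} := by
    ext t; simp [nextState]
  rw [this]
  exact MeasurableSet.iUnion fun o => (hm U i o).inter (MeasurableSet.const _)

theorem measurableSet_runState {alg : G.Policy} (hm : MeasurablePolicy alg)
    {α : Type*} [MeasurableSpace α] {T : α → Fin G.n × ℕ → ℝ}
    (hT : ∀ p, Measurable fun x => T x p) {t : α → ℝ} (ht : Measurable t)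
    (L : List (Fin G.n × ℕ)) (U V : Finset (Fin G.m)) :
    MeasurableSet {x | runState alg (T x) (L.filter fun p => T x p < t x) U = V} := by
  induction L generalizing U with
  | nil => simp [runState]
  | cons p L ih =>
    have : {x | runState alg (T x) ((p :: L).filter fun p => T x p < t x) U = V} =
        ({x | T x p < t x} ∩ ⋃ W, ({x | nextState alg (T x p) U p.1 = W} ∩
          {x | runState alg (T x) (L.filter fun p => T x p < t x) W = V})) ∪
        ({x | T x p < t x}ᶜ ∩
          {x | runState alg (T x) (L.filter fun p => T x p < t x) U = V}) := by
      ext x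
      by_cases h : T x p < t x
      · simp [h, runState]
      · simp [h]
    rw [this]
    have h1 := measurableSet_lt (hT p) ht
    exact (h1.inter (MeasurableSet.iUnion fun W =>
      ((hT p) (measurableSet_nextState hm U W p.1)).inter (ih W))).union (h1.compl.inter (ih U))

theorem measurableSet_stateBefore {alg : G.Policy} (hm : MeasurablePolicy alg)
    {α : Type*} [MeasurableSpace α] {X : α → G.Sample} (hX : Measurable X) {t : α → ℝ}
    (ht : Measurable t) (V : Finset (Fin G.m)) :
    MeasurableSet {x | stateBefore alg (X x) (t x) = V} := by
  have : {x | stateBefore alg (X x) (t x) = V} = ⋃ L, {x | G.arrivalList (X x) = L} ∩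
      {x | runState alg (G.arrivalTime (X x)) (L.filter fun p => G.arrivalTime (X x) p < t x)
        Finset.univ = V} := by
    ext x; simp [stateBefore]
  rw [this]
  exact MeasurableSet.iUnion fun L => (hX (measurableSet_arrivalList_eq L)).inter
    (measurableSet_runState hm (fun p => (G.measurable_arrivalTime p).comp hX) ht L _ V)

theorem measurableSet_finalState {alg : G.Policy} (hm : MeasurablePolicy alg)
    (V : Finset (Fin G.m)) :
    MeasurableSet {ω | runState alg (G.arrivalTime ω) (G.arrivalList ω) Finset.univ = V} := by
  have h0 : ∀ L : List (Fin G.n × ℕ), MeasurableSet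
      {ω | runState alg (G.arrivalTime ω) L Finset.univ = V} := by
    intro L
    generalize (Finset.univ : Finset (Fin G.m)) = U
    induction L generalizing U with
    | nil => simp [runState]
    | cons p L ih =>
      have : {ω | runState alg (G.arrivalTime ω) (p :: L) U = V} =
          ⋃ W, ({ω | nextState alg (G.arrivalTime ω p) U p.1 = W} ∩
            {ω | runState alg (G.arrivalTime ω) L W = V}) := by
        ext ω
        simp [runState]
      rw [this]
      exact MeasurableSet.iUnion fun W =>
        ((G.measurable_arrivalTime p) (measurableSet_nextState hm U W p.1)).inter (ih W)
  have : {ω | runState alg (G.arrivalTime ω) (G.arrivalList ω) Finset.univ = V} =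
      ⋃ L, {ω | G.arrivalList ω = L} ∩
        {ω | runState alg (G.arrivalTime ω) L Finset.univ = V} := by
    ext ω; simp
  rw [this]
  exact MeasurableSet.iUnion fun L => (measurableSet_arrivalList_eq L).inter (h0 L)

/-! ### The change of a time-dependent function of the state along a sample path -/

/-- The fundamental theorem of calculus between the arrivals: along a sample path, `H` at the final
state is the initial value plus the jumps at the arrivals plus the integral of the time derivative.
The arrivals have to be at distinct times, because the state before an arrival counts only the
arrivals at strictly smaller times. -/
theorem runState_path (alg : G.Policy) (T : Fin G.n × ℕ → ℝ)
    {H H' : ℝ → Finset (Fin G.m) → ℝ} (hH : ∀ U t, HasDerivAt (fun t => H t U) (H' t U) t)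
    (hH' : ∀ U, Continuous fun t => H' t U) (L : List (Fin G.n × ℕ))
    (hL : L.Pairwise fun p q => T p < T q) (s : ℝ) (hs : s ≤ 1) (hsL : ∀ p ∈ L, s ≤ T p)
    (hL1 : ∀ p ∈ L, T p ≤ 1) (U : Finset (Fin G.m)) :
    IntervalIntegrable (fun t => H' t (runState alg T (L.filter fun p => T p < t) U))
      volume s 1 ∧
    H 1 (runState alg T L U) = H s U +
      (L.map fun p => H (T p) (nextState alg (T p) (runState alg T (L.filter fun q => T q < T p) U)
        p.1) - H (T p) (runState alg T (L.filter fun q => T q < T p) U)).sum +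
      ∫ t in s..1, H' t (runState alg T (L.filter fun p => T p < t) U) := by
  induction L generalizing s U with
  | nil =>
    refine ⟨(hH' U).intervalIntegrable _ _, ?_⟩
    simp only [runState, List.filter_nil, List.foldl_nil, List.map_nil, List.sum_nil, add_zero]
    rw [intervalIntegral.integral_eq_sub_of_hasDerivAt (fun t _ => hH U t)
      ((hH' U).intervalIntegrable _ _)]
    ring
  | cons p L ih =>
    rw [List.pairwise_cons] at hL
    have hsp : s ≤ T p := hsL p (by simp)
    have hp1 : T p ≤ 1 := hL1 p (by simp)
    obtain ⟨ih1, ih2⟩ := ih hL.2 (T p) hp1 (fun q hq => (hL.1 q hq).le)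
      (fun q hq => hL1 q (by simp [hq])) (nextState alg (T p) U p.1)
    have hnil : ∀ t ≤ T p, (p :: L).filter (fun q => T q < t) = [] := by
      intro t ht
      rw [List.filter_eq_nil_iff]
      intro q hq
      rcases List.mem_cons.mp hq with rfl | hq
      · simpa using ht
      · simpa using ht.trans (hL.1 q hq).le
    have hcons : ∀ t, T p < t → runState alg T ((p :: L).filter (fun q => T q < t)) U =
        runState alg T (L.filter fun q => T q < t) (nextState alg (T p) U p.1) := by
      intro t ht
      simp [ht, runState]
    have e1 : Set.EqOn (fun t => H' t U)
        (fun t => H' t (runState alg T ((p :: L).filter fun p => T p < t) U))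
        (Set.uIoc s (T p)) := by
      intro t ht
      rw [Set.uIoc_of_le hsp] at ht
      simp [hnil t ht.2, runState]
    have e2 : Set.EqOn
        (fun t => H' t (runState alg T (L.filter fun q => T q < t) (nextState alg (T p) U p.1)))
        (fun t => H' t (runState alg T ((p :: L).filter fun p => T p < t) U))
        (Set.uIoc (T p) 1) := by
      intro t ht
      rw [Set.uIoc_of_le hp1] at ht
      simp only [hcons t ht.1]
    have i1 := ((hH' U).intervalIntegrable (μ := volume) s (T p)).congr e1
    have i2 := ih1.congr e2
    refine ⟨i1.trans i2, ?_⟩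
    rw [← intervalIntegral.integral_add_adjacent_intervals i1 i2,
      ← intervalIntegral.integral_congr_ae (Filter.Eventually.of_forall fun t ht => e1 ht),
      ← intervalIntegral.integral_congr_ae (Filter.Eventually.of_forall fun t ht => e2 ht),
      intervalIntegral.integral_eq_sub_of_hasDerivAt (fun t _ => hH U t)
        ((hH' U).intervalIntegrable _ _)]
    have e3 : runState alg T (p :: L) U = runState alg T L (nextState alg (T p) U p.1) := rfl
    rw [e3, ih2, List.map_cons, List.sum_cons, hnil (T p) le_rfl]
    have e4 : (L.map fun q => H (T q) (nextState alg (T q)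
          (runState alg T ((p :: L).filter fun r => T r < T q) U) q.1) -
        H (T q) (runState alg T ((p :: L).filter fun r => T r < T q) U)) =
        L.map fun q => H (T q) (nextState alg (T q) (runState alg T
          (L.filter fun r => T r < T q) (nextState alg (T p) U p.1)) q.1) -
        H (T q) (runState alg T (L.filter fun r => T r < T q) (nextState alg (T p) U p.1)) := by
      refine List.map_congr_left fun q hq => ?_
      rw [hcons _ (hL.1 q hq)]
    rw [e4]
    simp only [runState, List.foldl_nil]
    ring

end TypeGraph

/-! ### Expected change and drift -/

theorem ofReal_integral_le_lintegral {α : Type*} [MeasurableSpace α] {μ : Measure α} (f : α → ℝ) :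
    ENNReal.ofReal (∫ x, f x ∂μ) ≤ ∫⁻ x, ENNReal.ofReal (f x) ∂μ := by
  by_cases hf : Integrable f μ
  · rw [integral_eq_lintegral_pos_part_sub_lintegral_neg_part hf]
    refine (ENNReal.ofReal_le_ofReal (sub_le_self _ ENNReal.toReal_nonneg)).trans
      ENNReal.ofReal_toReal_le
  · simp [integral_undef hf]

namespace TypeGraph
variable {G : TypeGraph}

/-- The change of a function `H` of time and state caused by an arrival of type `i`. -/
def jump (alg : G.Policy) (H : ℝ → Finset (Fin G.m) → ℝ) (i : Fin G.n) (t : ℝ)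
    (U : Finset (Fin G.m)) : ℝ :=
  H t (nextState alg t U i) - H t U

theorem measurable_jump {alg : G.Policy} (hm : MeasurablePolicy alg)
    {H : ℝ → Finset (Fin G.m) → ℝ} (hH : ∀ U, Measurable fun t => H t U) (i : Fin G.n)
    (U : Finset (Fin G.m)) : Measurable fun t => jump alg H i t U :=
  (measurable_of_countable_fibers (S := fun t => nextState alg t U i)
    (F := fun V t => H t V) (fun V => measurableSet_nextState hm U V i) hH).sub (hH U)

theorem measurable_comp_stateBefore {alg : G.Policy} (hm : MeasurablePolicy alg)
    {α γ : Type*} [MeasurableSpace α] [MeasurableSpace γ] {X : α → G.Sample} (hX : Measurable X)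
    {t : α → ℝ} (ht : Measurable t) {F : ℝ → Finset (Fin G.m) → γ}
    (hF : ∀ U, Measurable fun t => F t U) :
    Measurable fun a => F (t a) (stateBefore alg (X a) (t a)) :=
  measurable_of_countable_fibers (S := fun a => stateBefore alg (X a) (t a))
    (F := fun U a => F (t a) U) (measurableSet_stateBefore hm hX ht) fun U => (hF U).comp ht

/-- The expected sum of the positive parts of the jumps equals the expected integral of their rates.
By `stateBefore_update` the state in which an arrival finds the algorithm does not depend on the
waiting time of this arrival, so `lintegral_arrival_eq_compensator` applies to every arrival; the
waiting intervals of one type then add up to `(0, 1]`. -/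
theorem lintegral_tsum_jump {alg : G.Policy} (hm : MeasurablePolicy alg)
    {H : ℝ → Finset (Fin G.m) → ℝ} (hH : ∀ U, Measurable fun t => H t U) :
    ∫⁻ ω, ∑' p : Fin G.n × ℕ, (if G.arrivalTime ω p ∈ Set.Icc (0 : ℝ) 1 then
        ENNReal.ofReal (jump alg H p.1 (G.arrivalTime ω p)
          (stateBefore alg ω (G.arrivalTime ω p))) else 0) ∂G.law =
      ∫⁻ ω, (∫⁻ t in Set.Icc (0 : ℝ) 1, ∑ i, ENNReal.ofReal (G.rate i) *
        ENNReal.ofReal (jump alg H i t (stateBefore alg ω t))) ∂G.law := by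
  have hj : ∀ i U, Measurable fun t => ENNReal.ofReal (jump alg H i t U) :=
    fun i U => (measurable_jump hm hH i U).ennreal_ofReal
  have hup : ∀ p : Fin G.n × ℕ, Measurable fun ω : G.Sample => Function.update ω p (1 : ℝ) := by
    intro p
    exact measurable_update_left
  -- The process seen with the waiting time of the arrival `p` replaced by `1`.
  have hf : ∀ p : Fin G.n × ℕ, Measurable (Function.uncurry fun (t : ℝ) (ω : G.Sample) =>
      ENNReal.ofReal (jump alg H p.1 t (stateBefore alg (Function.update ω p 1) t))) := fun p =>
    measurable_comp_stateBefore hm (X := fun q : ℝ × G.Sample => Function.update q.2 p 1)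
      ((hup p).comp measurable_snd) measurable_fst
      (F := fun t U => ENNReal.ofReal (jump alg H p.1 t U)) (hj p.1)
  have hS : ∀ i, Measurable (fun q : G.Sample × ℝ =>
      ENNReal.ofReal (jump alg H i q.2 (stateBefore alg q.1 q.2))) := fun i =>
    measurable_comp_stateBefore hm measurable_fst measurable_snd
      (F := fun t U => ENNReal.ofReal (jump alg H i t U)) (hj i)
  have hI : ∀ p : Fin G.n × ℕ, MeasurableSet {q : G.Sample × ℝ |
      G.prevTime q.1 p < q.2 ∧ q.2 ≤ G.arrivalTime q.1 p} := fun p =>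
    (measurableSet_lt ((G.measurable_prevTime p).comp measurable_fst) measurable_snd).inter
      (measurableSet_le measurable_snd ((G.measurable_arrivalTime p).comp measurable_fst))
  have hIS : ∀ p : Fin G.n × ℕ, Measurable (fun q : G.Sample × ℝ =>
      if G.prevTime q.1 p < q.2 ∧ q.2 ≤ G.arrivalTime q.1 p then
        ENNReal.ofReal (jump alg H p.1 q.2 (stateBefore alg q.1 q.2)) else 0) :=
    fun p => Measurable.ite (hI p) (hS p.1) measurable_const
  have hgood : ∀ᵐ ω ∂G.law, (∀ p, 0 < ω p) ∧ (G.arrivals ω).Finite := by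
    filter_upwards [G.ae_pos, G.ae_finite_arrivals] with ω h1 h2 using ⟨h1, h2⟩
  have hone : ∀ p : Fin G.n × ℕ,
      ∫⁻ ω, (if G.arrivalTime ω p ∈ Set.Icc (0 : ℝ) 1 then
        ENNReal.ofReal (jump alg H p.1 (G.arrivalTime ω p)
          (stateBefore alg ω (G.arrivalTime ω p))) else 0) ∂G.law =
      ENNReal.ofReal (G.rate p.1) * ∫⁻ ω, (∫⁻ t in Set.Icc (0 : ℝ) 1,
        (if G.prevTime ω p < t ∧ t ≤ G.arrivalTime ω p then
          ENNReal.ofReal (jump alg H p.1 t (stateBefore alg ω t)) else 0)) ∂G.law := by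
    intro p
    refine Eq.trans (lintegral_congr_ae ?_) ((G.lintegral_arrival_eq_compensator p _ (hf p)
      (fun t ω w => by rw [Function.update_idem])).trans (congrArg _ (lintegral_congr_ae ?_)))
    · filter_upwards [hgood] with ω hω
      split_ifs with h
      · rw [stateBefore_update alg hω.1 hω.2 p h.2 le_rfl]
      · rfl
    · filter_upwards [hgood] with ω hω
      refine setLIntegral_congr_fun measurableSet_Icc fun t ht => ?_
      split_ifs with h
      · rw [stateBefore_update alg hω.1 hω.2 p ht.2 h.2]
      · rfl
  have hmeas : ∀ p : Fin G.n × ℕ, Measurable fun ω => (if G.arrivalTime ω p ∈ Set.Icc (0 : ℝ) 1 then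
        ENNReal.ofReal (jump alg H p.1 (G.arrivalTime ω p)
          (stateBefore alg ω (G.arrivalTime ω p))) else 0) := fun p =>
    Measurable.ite (G.measurable_arrivalTime p measurableSet_Icc)
      ((hS p.1).comp (measurable_id.prodMk (G.measurable_arrivalTime p))) measurable_const
  rw [lintegral_tsum fun p => (hmeas p).aemeasurable]
  simp only [hone]
  rw [ENNReal.tsum_prod', tsum_fintype]
  simp only [ENNReal.tsum_mul_left]
  have hsum : ∀ i : Fin G.n, ∑' k, ∫⁻ ω, (∫⁻ t in Set.Icc (0 : ℝ) 1,
        (if G.prevTime ω (i, k) < t ∧ t ≤ G.arrivalTime ω (i, k) then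
          ENNReal.ofReal (jump alg H i t (stateBefore alg ω t)) else 0)) ∂G.law =
      ∫⁻ ω, (∫⁻ t in Set.Icc (0 : ℝ) 1,
        ENNReal.ofReal (jump alg H i t (stateBefore alg ω t))) ∂G.law := by
    intro i
    rw [← lintegral_tsum fun k => (hIS (i, k)).lintegral_prod_right'.aemeasurable]
    refine lintegral_congr_ae ?_
    filter_upwards [hgood] with ω hω
    have hmω : ∀ k, AEMeasurable (fun t : ℝ =>
        if G.prevTime ω (i, k) < t ∧ t ≤ G.arrivalTime ω (i, k) then
          ENNReal.ofReal (jump alg H i t (stateBefore alg ω t)) else 0)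
        (volume.restrict (Set.Icc (0 : ℝ) 1)) :=
      fun k => ((hIS (i, k)).comp (measurable_prodMk_left (x := ω))).aemeasurable
    rw [← lintegral_tsum hmω, setLIntegral_congr Ioc_ae_eq_Icc.symm,
      setLIntegral_congr Ioc_ae_eq_Icc.symm]
    refine setLIntegral_congr_fun measurableSet_Ioc fun t ht => ?_
    obtain ⟨k, hk⟩ := exists_waiting hω.2 hω.1 i ht.1 ht.2
    rw [tsum_eq_single k, if_pos hk]
    intro l hl
    rw [if_neg fun h' => hl (waiting_unique hω.1 h' hk)]
  have hfin : ∀ i, ENNReal.ofReal (G.rate i) ≠ ∞ := fun i => ENNReal.ofReal_ne_top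
  calc _ = ∑ i, ENNReal.ofReal (G.rate i) * ∫⁻ ω, (∫⁻ t in Set.Icc (0 : ℝ) 1,
        ENNReal.ofReal (jump alg H i t (stateBefore alg ω t))) ∂G.law := by
        exact Finset.sum_congr rfl fun i _ => by rw [← hsum i]
    _ = _ := by
        have e : ∀ ω, (∫⁻ t in Set.Icc (0 : ℝ) 1, ∑ i, ENNReal.ofReal (G.rate i) *
            ENNReal.ofReal (jump alg H i t (stateBefore alg ω t))) =
            ∑ i, ENNReal.ofReal (G.rate i) * ∫⁻ t in Set.Icc (0 : ℝ) 1,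
              ENNReal.ofReal (jump alg H i t (stateBefore alg ω t)) := by
          intro ω
          rw [lintegral_finsetSum]
          · exact Finset.sum_congr rfl fun i _ => lintegral_const_mul' _ _ (hfin i)
          · exact fun i _ => ((hS i).comp (measurable_prodMk_left (x := ω))).const_mul _
        simp only [e]
        rw [lintegral_finsetSum]
        · exact Finset.sum_congr rfl fun i _ => (lintegral_const_mul' _ _ (hfin i)).symm
        · exact fun i _ => ((hS i).lintegral_prod_right').const_mul _

/-- If a function of time and state never decreases at an arrival, and its drift is nonnegative,
then its expectation does not decrease. That the jumps are nonnegative makes `lintegral_tsum_jump`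
sufficient. -/
theorem le_integral_of_drift_nonneg {alg : G.Policy} (hm : MeasurablePolicy alg)
    {H H' : ℝ → Finset (Fin G.m) → ℝ} (hH : ∀ U t, HasDerivAt (fun t => H t U) (H' t U) t)
    (hH' : ∀ U, Continuous fun t => H' t U)
    (hjump : ∀ t ∈ Set.Icc (0 : ℝ) 1, ∀ U i, 0 ≤ jump alg H i t U)
    (hdrift : ∀ t ∈ Set.Icc (0 : ℝ) 1, ∀ U, 0 ≤ H' t U + ∑ i, G.rate i * jump alg H i t U) :
    H 0 Finset.univ ≤
      ∫ ω, H 1 (runState alg (G.arrivalTime ω) (G.arrivalList ω) Finset.univ) ∂G.law := by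
  have hHm : ∀ U, Measurable fun t => H t U := fun U =>
    (continuous_iff_continuousAt.mpr fun t => (hH U t).continuousAt).measurable
  obtain ⟨B, hB⟩ : ∃ B, ∀ U, ∀ t ∈ Set.Icc (0 : ℝ) 1, ‖H' t U‖ ≤ B := by
    have : ∀ U, ∃ B, ∀ t ∈ Set.Icc (0 : ℝ) 1, ‖H' t U‖ ≤ B := fun U =>
      isCompact_Icc.exists_bound_of_continuousOn (hH' U).continuousOn
    choose B hB using this
    refine ⟨∑ U, |B U|, fun U t ht => (hB U t ht).trans ((le_abs_self _).trans ?_)⟩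
    exact Finset.single_le_sum (f := fun U => |B U|) (fun _ _ => abs_nonneg _) (Finset.mem_univ U)
  set F : G.Sample → ℝ := fun ω =>
    H 1 (runState alg (G.arrivalTime ω) (G.arrivalList ω) Finset.univ) with hF
  set I : G.Sample → ℝ := fun ω => ∫ t in (0 : ℝ)..1, H' t (stateBefore alg ω t) with hI
  have hFm : Measurable F := measurable_of_countable_fibers
    (S := fun ω => runState alg (G.arrivalTime ω) (G.arrivalList ω) Finset.univ)
    (F := fun U _ => H 1 U) (measurableSet_finalState hm) fun _ => measurable_const
  have hFint : Integrable F G.law := by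
    refine Integrable.of_bound hFm.aestronglyMeasurable (∑ U, ‖H 1 U‖)
      (Filter.Eventually.of_forall fun ω => ?_)
    exact Finset.single_le_sum (f := fun U => ‖H 1 U‖) (fun _ _ => norm_nonneg _)
      (Finset.mem_univ _)
  have hH'm : Measurable fun q : G.Sample × ℝ => H' q.2 (stateBefore alg q.1 q.2) :=
    measurable_comp_stateBefore hm measurable_fst measurable_snd fun U => (hH' U).measurable
  have hIm : AEStronglyMeasurable I G.law := by
    have : I = fun ω => ∫ t in Set.Ioc (0 : ℝ) 1, H' t (stateBefore alg ω t) := by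
      ext ω; rw [hI]; simp only; rw [intervalIntegral.integral_of_le zero_le_one]
    rw [this]
    exact (hH'm.stronglyMeasurable.integral_prod_right).aestronglyMeasurable
  have hIint : Integrable I G.law := by
    refine Integrable.of_bound hIm B (Filter.Eventually.of_forall fun ω => ?_)
    have := intervalIntegral.norm_integral_le_of_norm_le_const (a := (0 : ℝ)) (b := 1) (C := B)
      (f := fun t => H' t (stateBefore alg ω t)) fun t ht => hB _ t (by
        rw [Set.uIoc_of_le zero_le_one] at ht; exact ⟨ht.1.le, ht.2⟩)
    simpa using this
  -- Along a sample path, the total change minus the integral of the time derivative is the sum of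
  -- the jumps.
  have hpath : ∀ᵐ ω ∂G.law, 0 ≤ F ω - H 0 Finset.univ - I ω ∧
      ENNReal.ofReal (F ω - H 0 Finset.univ - I ω) =
      ∑' p : Fin G.n × ℕ, (if G.arrivalTime ω p ∈ Set.Icc (0 : ℝ) 1 then
        ENNReal.ofReal (jump alg H p.1 (G.arrivalTime ω p)
          (stateBefore alg ω (G.arrivalTime ω p))) else 0) := by
    filter_upwards [G.ae_finite_arrivals, G.ae_injective_arrivalTime] with ω hfin hinj
    have hlt : (G.arrivalList ω).Pairwise fun p q => G.arrivalTime ω p < G.arrivalTime ω q := by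
      refine ((pairwise_arrivalList ω).and (nodup_arrivalList ω)).imp fun {p q} h => ?_
      have h1 : G.arrivalTime ω p ≠ G.arrivalTime ω q := fun h' => h.2 (hinj h')
      have h2 := h.1
      unfold arrivalKey at h2
      rw [Prod.Lex.toLex_le_toLex] at h2
      rcases h2 with h2 | h2
      · exact h2
      · exact absurd h2.1 h1
    have hmem : ∀ p ∈ G.arrivalList ω, G.arrivalTime ω p ∈ Set.Icc (0 : ℝ) 1 :=
      fun p hp => (mem_arrivalList hfin p).mp hp
    have := (runState_path alg (G.arrivalTime ω) hH hH' (G.arrivalList ω) hlt 0 zero_le_one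
      (fun p hp => (hmem p hp).1) (fun p hp => (hmem p hp).2) Finset.univ).2
    have hsum : F ω - H 0 Finset.univ - I ω = ((G.arrivalList ω).map fun p =>
        jump alg H p.1 (G.arrivalTime ω p) (stateBefore alg ω (G.arrivalTime ω p))).sum := by
      simp only [hF, this, hI]
      unfold jump stateBefore
      ring
    rw [← List.sum_toFinset _ (nodup_arrivalList ω)] at hsum
    have hnn : ∀ p ∈ (G.arrivalList ω).toFinset, 0 ≤ jump alg H p.1 (G.arrivalTime ω p)
        (stateBefore alg ω (G.arrivalTime ω p)) :=
      fun p hp => hjump _ (hmem p (List.mem_toFinset.mp hp)) _ _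
    rw [hsum]
    refine ⟨Finset.sum_nonneg hnn, ?_⟩
    rw [ENNReal.ofReal_sum_of_nonneg hnn, tsum_eq_sum (s := (G.arrivalList ω).toFinset)]
    · refine Finset.sum_congr rfl fun p hp => ?_
      rw [if_pos (hmem p (List.mem_toFinset.mp hp))]
    · intro p hp
      rw [if_neg]
      intro h
      exact hp (List.mem_toFinset.mpr ((mem_arrivalList hfin p).mpr h))
  set D : G.Sample → ℝ := fun ω => F ω - H 0 Finset.univ - I ω with hD
  have hDint : Integrable D G.law := (hFint.sub (integrable_const _)).sub hIint
  have hlin : ∫⁻ ω, ENNReal.ofReal (-I ω) ∂G.law ≤ ∫⁻ ω, ENNReal.ofReal (D ω) ∂G.law := by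
    rw [lintegral_congr_ae (hpath.mono fun ω h => h.2), lintegral_tsum_jump hm hHm]
    refine lintegral_mono fun ω => ?_
    have h1 : -I ω = ∫ t in Set.Icc (0 : ℝ) 1, -H' t (stateBefore alg ω t) := by
      rw [hI, integral_neg, integral_Icc_eq_integral_Ioc,
        ← intervalIntegral.integral_of_le zero_le_one]
    have h2 : ENNReal.ofReal (-I ω) ≤
        ∫⁻ t in Set.Icc (0 : ℝ) 1, ENNReal.ofReal (-H' t (stateBefore alg ω t)) := by
      rw [h1]
      exact ofReal_integral_le_lintegral _
    refine h2.trans (setLIntegral_mono' measurableSet_Icc fun t ht => ?_)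
    rw [← Finset.sum_congr rfl fun i _ => ENNReal.ofReal_mul (G.rate_pos i).le,
      ← ENNReal.ofReal_sum_of_nonneg fun i _ => mul_nonneg (G.rate_pos i).le (hjump t ht _ _)]
    exact ENNReal.ofReal_le_ofReal (by linarith [hdrift t ht (stateBefore alg ω t)])
  have hDI : -∫ ω, I ω ∂G.law ≤ ∫ ω, D ω ∂G.law := by
    rw [← integral_neg, integral_eq_lintegral_of_nonneg_ae (hpath.mono fun ω h => h.1)
      hDint.aestronglyMeasurable,
      integral_eq_lintegral_pos_part_sub_lintegral_neg_part (f := fun ω => -I ω) hIint.neg]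
    have hfin : ∫⁻ ω, ENNReal.ofReal (D ω) ∂G.law ≠ ∞ := hDint.lintegral_lt_top.ne
    have := ENNReal.toReal_mono hfin hlin
    have h0 := ENNReal.toReal_nonneg (a := ∫⁻ ω, ENNReal.ofReal (-(-I ω)) ∂G.law)
    linarith
  have hFD : ∫ ω, D ω ∂G.law = ∫ ω, F ω ∂G.law - H 0 Finset.univ - ∫ ω, I ω ∂G.law := by
    have h1 : Integrable (fun ω => F ω - H 0 Finset.univ) G.law := hFint.sub (integrable_const _)
    rw [integral_sub h1 hIint, integral_sub hFint (integrable_const _)]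
    simp
  linarith

end TypeGraph

namespace TypeGraph
variable {G : TypeGraph}

/-! ### The offline optimum as a solution of the Natural LP -/

/-- `M` is a matching of the online vertices in `L` with the offline vertices. -/
def IsListMatching (L : List (Fin G.n × ℕ)) (M : Finset ((Fin G.n × ℕ) × Fin G.m)) : Prop :=
  (∀ e ∈ M, e.1 ∈ L ∧ G.adj e.1.1 e.2) ∧
  Set.InjOn Prod.fst (M : Set ((Fin G.n × ℕ) × Fin G.m)) ∧
  Set.InjOn Prod.snd (M : Set ((Fin G.n × ℕ) × Fin G.m))

theorem IsListMatching.card_le {L : List (Fin G.n × ℕ)} {M : Finset ((Fin G.n × ℕ) × Fin G.m)}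
    (h : IsListMatching L M) : M.card ≤ G.m := by
  rw [← Finset.card_image_of_injOn h.2.2]
  exact (Finset.card_le_univ _).trans (by simp)

theorem exists_maxMatching (L : List (Fin G.n × ℕ)) :
    ∃ M : Finset ((Fin G.n × ℕ) × Fin G.m), IsListMatching L M ∧
      ∀ M', IsListMatching L M' → M'.card ≤ M.card := by
  have hne : ∃ k, ∃ M : Finset ((Fin G.n × ℕ) × Fin G.m), IsListMatching L M ∧ M.card = k :=
    ⟨0, ∅, ⟨by simp, by simp, by simp⟩, rfl⟩
  have hb : ∀ k, (∃ M : Finset ((Fin G.n × ℕ) × Fin G.m), IsListMatching L M ∧ M.card = k) →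
      k ≤ G.m := by
    rintro k ⟨M, hM, rfl⟩; exact hM.card_le
  obtain ⟨k, hk⟩ := hne
  obtain ⟨M, hM, hMk⟩ := Nat.findGreatest_spec (P := fun k =>
    ∃ M : Finset ((Fin G.n × ℕ) × Fin G.m), IsListMatching L M ∧ M.card = k) (hb k hk) hk
  refine ⟨M, hM, fun M' hM' => ?_⟩
  rw [hMk]
  exact Nat.le_findGreatest hM'.card_le ⟨M', hM', rfl⟩

/-- A maximum matching of the online vertices in `L`. -/
def maxMatching (L : List (Fin G.n × ℕ)) : Finset ((Fin G.n × ℕ) × Fin G.m) :=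
  (exists_maxMatching L).choose

theorem maxMatching_spec (L : List (Fin G.n × ℕ)) : IsListMatching (G := G) L (maxMatching L) :=
  (exists_maxMatching L).choose_spec.1

theorem optSize_eq {ω : G.Sample} (hfin : (G.arrivals ω).Finite) :
    G.optSize ω = (maxMatching (G.arrivalList ω)).card := by
  have hiff : ∀ M, G.IsMatching ω M ↔ IsListMatching (G.arrivalList ω) M := by
    intro M
    unfold IsMatching IsListMatching
    simp only [mem_arrivalList hfin]
  refine IsGreatest.csSup_eq ⟨⟨_, (hiff _).mpr (maxMatching_spec _), rfl⟩, ?_⟩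
  rintro k ⟨M, hM, rfl⟩
  exact (exists_maxMatching (G.arrivalList ω)).choose_spec.2 M ((hiff M).mp hM)

theorem measurable_comp_arrivalList {γ : Type*} [MeasurableSpace γ]
    (f : List (Fin G.n × ℕ) → γ) : Measurable fun ω => f (G.arrivalList ω) :=
  measurable_of_countable_fibers (S := G.arrivalList) (F := fun L _ => f L)
    measurableSet_arrivalList_eq fun _ => measurable_const

theorem integrable_comp_arrivalList {f : List (Fin G.n × ℕ) → ℕ} {B : ℕ} (hf : ∀ L, f L ≤ B) :
    Integrable (fun ω => (f (G.arrivalList ω) : ℝ)) G.law := by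
  refine Integrable.of_bound
    (measurable_comp_arrivalList fun L => (f L : ℝ)).aestronglyMeasurable (B : ℝ)
    (Filter.Eventually.of_forall fun ω => ?_)
  simpa using hf _

theorem integrable_optSize : Integrable (fun ω => (G.optSize ω : ℝ)) G.law := by
  refine (integrable_comp_arrivalList (f := fun L => (maxMatching L).card)
    fun L => (maxMatching_spec L).card_le).congr ?_
  filter_upwards [G.ae_finite_arrivals] with ω hω
  rw [optSize_eq hω]

/-- The edges of the maximum matching that join type `i` with `j`. -/
def matchedPairs (L : List (Fin G.n × ℕ)) (i : Fin G.n) (j : Fin G.m) :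
    Finset ((Fin G.n × ℕ) × Fin G.m) := {e ∈ maxMatching L | e.1.1 = i ∧ e.2 = j}

variable (G) in
/-- The expected number of times that the maximum matching in hindsight joins type `i` and `j`. -/
def offlineSolution (i : Fin G.n) (j : Fin G.m) : ℝ :=
  ∫ ω, ((matchedPairs (G.arrivalList ω) i j).card : ℝ) ∂G.law

theorem integrable_card_matchedPairs (i : Fin G.n) (j : Fin G.m) :
    Integrable (fun ω => ((matchedPairs (G.arrivalList ω) i j).card : ℝ)) G.law :=
  integrable_comp_arrivalList fun L =>
    (Finset.card_le_card (Finset.filter_subset _ _)).trans (maxMatching_spec L).card_le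

theorem lpValue_offlineSolution :
    G.lpValue G.offlineSolution = ∫ ω, (G.optSize ω : ℝ) ∂G.law := by
  have h : ∀ L : List (Fin G.n × ℕ), ((maxMatching L).card : ℝ) =
      ∑ i, ∑ j ∈ G.nbr i, ((matchedPairs L i j).card : ℝ) := by
    intro L
    rw [Finset.card_eq_sum_card_fiberwise (f := fun e => e.1.1) (t := Finset.univ)
      fun _ _ => by simp]
    push_cast
    refine Finset.sum_congr rfl fun i _ => ?_
    rw [Finset.card_eq_sum_card_fiberwise (f := fun e => e.2) (t := G.nbr i)]
    · push_cast
      refine Finset.sum_congr rfl fun j _ => ?_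
      rw [Finset.filter_filter]; rfl
    · intro e he
      have := Finset.mem_filter.mp he
      have h2 := ((maxMatching_spec L).1 e this.1).2
      rw [this.2] at h2
      simp [nbr, h2]
  have : ∫ ω, (G.optSize ω : ℝ) ∂G.law =
      ∫ ω, ∑ i, ∑ j ∈ G.nbr i, ((matchedPairs (G.arrivalList ω) i j).card : ℝ) ∂G.law := by
    refine integral_congr_ae ?_
    filter_upwards [G.ae_finite_arrivals] with ω hω
    rw [optSize_eq hω, h]
  rw [this, integral_finsetSum _ fun i _ => integrable_finsetSum _ fun j _ =>
    integrable_card_matchedPairs i j]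
  unfold lpValue
  refine Finset.sum_congr rfl fun i _ => ?_
  rw [integral_finsetSum _ fun j _ => integrable_card_matchedPairs i j]
  rfl

/-- Each arrival of type `i` is matched at most once, and the expected number of arrivals of type
`i` is at most `λ i`. -/
theorem offlineSolution_online (i : Fin G.n) :
    ∑ j ∈ G.nbr i, G.offlineSolution i j ≤ G.rate i := by
  unfold offlineSolution
  rw [← integral_finsetSum _ fun j _ => integrable_card_matchedPairs i j,
    integral_eq_lintegral_of_nonneg_ae (Filter.Eventually.of_forall fun ω =>
      Finset.sum_nonneg fun _ _ => Nat.cast_nonneg _)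
    (integrable_finsetSum _ fun j _ => integrable_card_matchedPairs i j).aestronglyMeasurable]
  refine ENNReal.toReal_le_of_le_ofReal (G.rate_pos i).le ?_
  refine le_trans ?_ (G.tsum_prob_arrival_le i)
  rw [← lintegral_tsum fun k => (Measurable.ite (G.measurable_arrivalTime (i, k) measurableSet_Icc)
    measurable_const measurable_const).aemeasurable]
  refine lintegral_mono_ae ?_
  filter_upwards [G.ae_finite_arrivals] with ω hω
  set L := G.arrivalList ω with hL
  have hcard : ∑ j ∈ G.nbr i, (matchedPairs L i j).card ≤
      ((L.toFinset.filter fun p => p.1 = i).image Prod.snd).card := by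
    rw [← Finset.card_biUnion]
    · refine Finset.card_le_card_of_injOn (fun e => e.1.2) ?_ ?_
      · intro e he
        simp only [matchedPairs, Finset.coe_biUnion, Set.mem_iUnion, Finset.coe_filter] at he
        obtain ⟨j, _, he1, he2⟩ := he
        have := ((maxMatching_spec L).1 e he1).1
        simp only [Finset.coe_image, Set.mem_image, Finset.coe_filter]
        exact ⟨e.1, ⟨by simpa using this, he2.1⟩, rfl⟩
      · intro e he f hf hef
        simp only [matchedPairs, Finset.coe_biUnion, Set.mem_iUnion, Finset.coe_filter] at he hf
        obtain ⟨j, _, he1, he2⟩ := he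
        obtain ⟨j', _, hf1, hf2⟩ := hf
        exact (maxMatching_spec L).2.1 he1 hf1 (Prod.ext (he2.1.trans hf2.1.symm) hef)
    · intro j _ j' _ hjj'
      refine Finset.disjoint_left.mpr ?_
      intro e he he'
      exact hjj' ((Finset.mem_filter.mp he).2.2.symm.trans (Finset.mem_filter.mp he').2.2)
  set K := (L.toFinset.filter fun p => p.1 = i).image Prod.snd with hK
  have hmem : ∀ k, k ∈ K ↔ G.arrivalTime ω (i, k) ∈ Set.Icc (0 : ℝ) 1 := by
    intro k
    have := mem_arrivalList hω (i, k)
    simp only [hK, Finset.mem_image, Finset.mem_filter, List.mem_toFinset]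
    constructor
    · rintro ⟨p, ⟨hp, rfl⟩, rfl⟩
      exact (mem_arrivalList hω p).mp hp
    · intro h
      exact ⟨(i, k), ⟨this.mpr h, rfl⟩, rfl⟩
  rw [tsum_eq_sum (s := K) fun k hk => if_neg fun h => hk ((hmem k).mpr h),
    Finset.sum_congr rfl fun k hk => if_pos ((hmem k).mp hk)]
  simp only [Finset.sum_const, nsmul_eq_mul, mul_one]
  rw [← Nat.cast_sum, ENNReal.ofReal_natCast]
  exact_mod_cast hcard

theorem prob_no_arrival (S : Finset (Fin G.n)) :
    G.law.real {ω | ∀ i ∈ S, 1 < ω (i, 0)} = Real.exp (-∑ i ∈ S, G.rate i) := by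
  have hI : ∀ p : Fin G.n × ℕ, IsProbabilityMeasure (expMeasure (G.rate p.1)) :=
    fun p => isProbabilityMeasure_expMeasure (G.rate_pos p.1)
  have e : {ω : G.Sample | ∀ i ∈ S, 1 < ω (i, 0)} =
      Set.pi (S.map ⟨fun i => (i, 0), fun _ _ h => (Prod.ext_iff.mp h).1⟩ : Finset (Fin G.n × ℕ))
        fun _ => Set.Ioi (1 : ℝ) := by
    ext ω
    simp [Set.mem_pi]
    rfl
  rw [e, Measure.real, law, Measure.infinitePi_pi _ fun _ _ => measurableSet_Ioi, Finset.prod_map]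
  simp only [expMeasure_Ioi (G.rate_pos _) zero_le_one, mul_one]
  rw [← ENNReal.ofReal_prod_of_nonneg fun _ _ => (Real.exp_pos _).le, ← Real.exp_sum,
    Finset.sum_neg_distrib, ENNReal.toReal_ofReal (Real.exp_pos _).le]
  rfl

/-- An offline vertex is matched at most once, and only if some type in `S` arrives. -/
theorem offlineSolution_offline (j : Fin G.m) (S : Finset (Fin G.n)) :
    ∑ i ∈ S, G.offlineSolution i j ≤ 1 - Real.exp (-∑ i ∈ S, G.rate i) := by
  unfold offlineSolution
  have hA : MeasurableSet {ω : G.Sample | ∀ i ∈ S, 1 < ω (i, 0)} := by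
    simp only [Set.ofPred_forall]
    exact MeasurableSet.iInter fun i => MeasurableSet.iInter fun _ =>
      measurableSet_lt measurable_const (measurable_pi_apply _)
  rw [← integral_finsetSum _ fun i _ => integrable_card_matchedPairs i j, ← prob_no_arrival,
    ← probReal_compl_eq_one_sub hA, ← integral_indicator_one hA.compl]
  refine integral_mono_ae (integrable_finsetSum _ fun i _ => integrable_card_matchedPairs i j)
    ((integrable_const 1).indicator hA.compl) ?_
  filter_upwards [G.ae_finite_arrivals, G.ae_pos] with ω hω hpos
  set L := G.arrivalList ω with hL
  have hsum : ∑ i ∈ S, (matchedPairs L i j).card =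
      ((maxMatching L).filter fun e => e.1.1 ∈ S ∧ e.2 = j).card := by
    rw [Finset.card_eq_sum_card_fiberwise (f := fun e => e.1.1) (t := S)
      fun e he => (Finset.mem_filter.mp he).2.1]
    refine Finset.sum_congr rfl fun i hi => congrArg _ ?_
    ext e
    simp only [matchedPairs, Finset.mem_filter]
    constructor
    · rintro ⟨h1, rfl, rfl⟩; exact ⟨⟨h1, hi, rfl⟩, rfl⟩
    · rintro ⟨⟨h1, _, h3⟩, h4⟩; exact ⟨h1, h4, h3⟩
  have hle1 : ((maxMatching L).filter fun e => e.1.1 ∈ S ∧ e.2 = j).card ≤ 1 := by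
    rw [Finset.card_le_one]
    intro e he f hf
    rw [Finset.mem_filter] at he hf
    exact (maxMatching_spec L).2.2 he.1 hf.1 (he.2.2.trans hf.2.2.symm)
  by_cases h : ω ∈ {ω : G.Sample | ∀ i ∈ S, 1 < ω (i, 0)}
  · have h0 : (maxMatching L).filter (fun e => e.1.1 ∈ S ∧ e.2 = j) = ∅ := by
      rw [Finset.filter_eq_empty_iff]
      rintro ⟨⟨i, k⟩, j'⟩ he ⟨hi, _⟩
      have h1 := (mem_arrivalList hω _).mp ((maxMatching_spec L).1 _ he).1
      have h2 : G.arrivalTime ω (i, 0) ≤ G.arrivalTime ω (i, k) :=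
        (arrivalTime_strictMono hpos i).monotone (Nat.zero_le k)
      have h3 : G.arrivalTime ω (i, 0) = ω (i, 0) := by simp [arrivalTime]
      have h4 := h i hi
      have h5 : G.arrivalTime ω (i, k) ≤ 1 := h1.2
      linarith
    rw [Set.indicator_of_notMem (by simpa using h)]
    rw [h0] at hsum
    exact_mod_cast hsum.le
  · rw [Set.indicator_of_mem (by simpa using h)]
    simp only [Pi.one_apply]
    exact_mod_cast hsum.trans_le hle1

variable (G) in
theorem isLPFeasible_offlineSolution : G.IsLPFeasible G.offlineSolution where
  nonneg _ _ _ := integral_nonneg fun _ => Nat.cast_nonneg _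
  online := offlineSolution_online
  offline j S _ := offlineSolution_offline j S

end TypeGraph

/-! ### The drift inequality -/

/-- The losses at one online type, after division by its rate. The vertices `j ∈ J` are charged the
term of the first branch, where `m j * (p / ρ)` is the probability with which the type is matched to
`j`, and the others `min (b m j) c`. Whatever the set `J` is, the charges cover the excess
`c = (b ρ - 1)⁺`. -/
theorem sum_split_ge {κ : Type*} (U J : Finset κ) (m : κ → ℝ) (b ρ c p : ℝ) (hb : 2 ≤ b)
    (hm : ∀ j ∈ U, 0 ≤ m j) (hρ : ∑ j ∈ U, m j = ρ) (hρ1 : ρ ≤ 1)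
    (hc : c = max (b * ρ - 1) 0) (hp : p = min (b * ρ) 1) :
    c ≤ ∑ j ∈ U, if j ∈ J then
      (b - 1) * (m j * (p / ρ)) - (b * m j - min (b * m j) c - max (b * m j - (b - 1)) 0)
      else min (b * m j) c := by
  have hρ0 : 0 ≤ ρ := hρ ▸ Finset.sum_nonneg hm
  have hmρ : ∀ j ∈ U, m j ≤ ρ := fun j hj => hρ ▸ Finset.single_le_sum hm hj
  have hc0 : 0 ≤ c := hc ▸ le_max_right _ _
  rcases le_or_gt (b * ρ) 1 with hle | hgt
  · have hc0 : c = 0 := by rw [hc, max_eq_right (by linarith)]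
    rw [hc0]
    refine Finset.sum_nonneg fun j hj => ?_
    have h0 := hm j hj
    have hbm : 0 ≤ b * m j := by positivity
    split_ifs
    · rw [min_eq_right hbm, hp, min_eq_left hle]
      have hq : m j * (b * ρ / ρ) = b * m j := by
        rcases eq_or_ne ρ 0 with h | h
        · have : m j = 0 := le_antisymm (h ▸ hmρ j hj) h0
          simp [this]
        · field_simp
      rw [hq]
      have := le_max_right (b * m j - (b - 1)) 0
      nlinarith
    · exact le_min hbm le_rfl
  have hρpos : 0 < ρ := by nlinarith
  have hcv : c = b * ρ - 1 := by rw [hc, max_eq_left (by linarith)]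
  have hp1 : p = 1 := by rw [hp, min_eq_right hgt.le]
  -- `ψ j` is what is subtracted in the first branch.
  set ψ : κ → ℝ := fun j => b * m j - min (b * m j) c - max (b * m j - (b - 1)) 0 with hψ
  have hψle : ∀ j ∈ U, ψ j ≤ m j / ρ := by
    intro j hj
    rw [le_div_iff₀ hρpos]
    have h1 := le_max_right (b * m j - (b - 1)) 0
    have h2 := hm j hj
    have h3 := hmρ j hj
    rcases le_total (b * m j) c with h | h
    · simp only [hψ, min_eq_left h]; nlinarith
    · simp only [hψ, min_eq_right h]
      nlinarith [mul_nonneg (sub_nonneg.mpr h3) (sub_nonneg.mpr hgt.le), mul_nonneg hρ0 h1]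
  have hterm : ∀ j ∈ U, 0 ≤ if j ∈ J then (b - 1) * (m j * (p / ρ)) - ψ j
      else min (b * m j) c := by
    intro j hj
    have h0 := hm j hj
    split_ifs
    · have h1 := hψle j hj
      have h2 : 0 ≤ m j / ρ := by positivity
      rw [hp1, mul_one_div]
      nlinarith
    · exact le_min (by positivity) hc0
  -- A single vertex outside `J` with a large share covers `c`, since all terms are nonnegative.
  by_cases hbig : ∃ j ∈ U, j ∉ J ∧ c ≤ b * m j
  · obtain ⟨j, hj, hjJ, hcj⟩ := hbig
    refine le_trans ?_ (Finset.single_le_sum hterm hj)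
    rw [if_neg hjJ, min_eq_right hcj]
  push Not at hbig
  set M := ∑ j ∈ U with j ∈ J, m j with hM
  have hM0 : 0 ≤ M := Finset.sum_nonneg fun j hj => hm j (Finset.mem_filter.mp hj).1
  have hMρ : M + ∑ j ∈ U with j ∉ J, m j = ρ := by
    rw [hM, Finset.sum_filter_add_sum_filter_not, hρ]
  have hM2 : 0 ≤ ∑ j ∈ U with j ∉ J, m j :=
    Finset.sum_nonneg fun j hj => hm j (Finset.mem_filter.mp hj).1
  have hsum : (∑ j ∈ U, if j ∈ J then (b - 1) * (m j * (p / ρ)) - ψ j else min (b * m j) c) =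
      (b - 1) * (M / ρ) - ∑ j ∈ U with j ∈ J, ψ j + b * (ρ - M) := by
    rw [Finset.sum_ite, Finset.sum_sub_distrib, ← Finset.mul_sum, ← Finset.sum_mul, hp1,
      ← eq_sub_of_add_eq' hMρ, Finset.mul_sum, mul_one_div]
    congr 1
    refine Finset.sum_congr rfl fun j hj => ?_
    rw [Finset.mem_filter] at hj
    exact min_eq_left (hbig j hj.1 hj.2).le
  have hMr : M / ρ ≤ 1 := by rw [div_le_one hρpos]; linarith
  have hMr0 : 0 ≤ M / ρ := by positivity
  have hψ1 : ∑ j ∈ U with j ∈ J, ψ j ≤ 1 := by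
    calc _ ≤ ∑ j ∈ U with j ∈ J, m j / ρ :=
          Finset.sum_le_sum fun j hj => hψle j (Finset.mem_filter.mp hj).1
      _ = M / ρ := by rw [← Finset.sum_div]
      _ ≤ 1 := hMr
  -- Only vertices with `b m j > c` have `ψ j > 0`. If there are two of them, their minima use up
  -- `2 c` of `b ρ = c + 1`, which leaves `1 - c ≤ b - 1 - c`; if there is one, the last term of `ψ`
  -- gives the bound.
  have hψd : ∑ j ∈ U with j ∈ J, ψ j ≤ b - 1 - c := by
    have hd0 : 0 ≤ b - 1 - c := by rw [hcv]; nlinarith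
    have hψ0 : ∀ j, b * m j ≤ c → ψ j ≤ 0 := by
      intro j h
      have := le_max_right (b * m j - (b - 1)) 0
      simp only [hψ, min_eq_left h]; linarith
    have hψd : ∀ j, ψ j ≤ b - 1 - c := by
      intro j
      rcases le_total (b * m j) c with h | h
      · exact (hψ0 j h).trans hd0
      · have := le_max_left (b * m j - (b - 1)) 0
        simp only [hψ, min_eq_right h]; linarith
    by_cases h2 : ∃ j ∈ U, ∃ k ∈ U, j ≠ k ∧ c < b * m j ∧ c < b * m k
    · obtain ⟨j, hj, k, hk, hjk, hcj, hck⟩ := h2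
      have hmin : 2 * c ≤ ∑ l ∈ U, min (b * m l) c := by
        have : ∑ l ∈ ({j, k} : Finset κ), min (b * m l) c ≤ ∑ l ∈ U, min (b * m l) c :=
          Finset.sum_le_sum_of_subset_of_nonneg (by
            intro l hl; simp only [Finset.mem_insert, Finset.mem_singleton] at hl
            rcases hl with rfl | rfl <;> assumption)
            fun l hl _ => le_min (mul_nonneg (by linarith) (hm l hl)) hc0
        rw [Finset.sum_pair hjk, min_eq_right hcj.le, min_eq_right hck.le] at this
        linarith
      have : ∑ l ∈ U with l ∈ J, ψ l ≤ ∑ l ∈ U, (b * m l - min (b * m l) c) := by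
        refine (Finset.sum_le_sum (g := fun l => b * m l - min (b * m l) c) fun l _ => ?_).trans
          (Finset.sum_le_sum_of_subset_of_nonneg (Finset.filter_subset _ _) fun l _ _ =>
            sub_nonneg.mpr (min_le_left _ _))
        have := le_max_right (b * m l - (b - 1)) 0
        simp only [hψ]; linarith
      have e : ∑ l ∈ U, (b * m l - min (b * m l) c) = b * ρ - ∑ l ∈ U, min (b * m l) c := by
        rw [Finset.sum_sub_distrib, ← Finset.mul_sum, hρ]
      linarith
    · push Not at h2
      by_cases h1 : ∃ j ∈ U.filter (· ∈ J), c < b * m j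
      · obtain ⟨j, hj, hcj⟩ := h1
        rw [← Finset.add_sum_erase _ _ hj]
        have : ∑ l ∈ (U.filter (· ∈ J)).erase j, ψ l ≤ 0 := by
          refine Finset.sum_nonpos fun l hl => hψ0 l ?_
          rw [Finset.mem_erase, Finset.mem_filter] at hl
          exact h2 j (Finset.mem_filter.mp hj).1 l hl.2.1 hl.1.symm hcj
        linarith [hψd j]
      · push Not at h1
        exact (Finset.sum_nonpos fun l hl => hψ0 l (h1 l hl)).trans hd0
  -- The bounds `1` and `b - 1 - c` on the sum of `ψ` serve the two signs of `b - 1 - b ρ`.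
  rw [hsum]
  have key : (b - 1) * (M / ρ) - b * M = (M / ρ) * (b - 1 - b * ρ) := by
    field_simp
  rcases le_or_gt 1 (b - 1 - c) with hd | hd
  · have : 0 ≤ (M / ρ) * (b - 1 - b * ρ) := mul_nonneg hMr0 (by linarith)
    nlinarith
  · have : (b - 1 - b * ρ) ≤ (M / ρ) * (b - 1 - b * ρ) := by nlinarith
    nlinarith

/-- The bound `∑ (b xᵢ - (b - 1) λᵢ)⁺ ≤ b - a (b - 1)` for a vector that satisfies the constraints
of the Natural LP at an offline vertex. It is attained where `exp (-∑ λᵢ) = 1 - 1 / b`. -/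
theorem sum_excess_le {ι : Type*} [Fintype ι] (x r : ι → ℝ) (a b : ℝ) (hb : 0 < b)
    (hab : Real.exp (1 - a) = 1 - b⁻¹)
    (hx : ∀ S : Finset ι, ∑ i ∈ S, x i ≤ 1 - Real.exp (-∑ i ∈ S, r i)) :
    ∑ i, max (b * x i - (b - 1) * r i) 0 ≤ b - a * (b - 1) := by
  set S : Finset ι := Finset.univ.filter fun i => 0 < b * x i - (b - 1) * r i with hS
  have h1 : ∑ i, max (b * x i - (b - 1) * r i) 0 = b * ∑ i ∈ S, x i - (b - 1) * ∑ i ∈ S, r i := by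
    rw [Finset.mul_sum, Finset.mul_sum, ← Finset.sum_sub_distrib, hS, Finset.sum_filter]
    refine Finset.sum_congr rfl fun i _ => ?_
    split_ifs with h
    · exact max_eq_left h.le
    · exact max_eq_right (not_lt.mp h)
  have h2 := hx S
  set Λ := ∑ i ∈ S, r i
  have h3 : Real.exp (-Λ) = (1 - b⁻¹) * Real.exp (a - 1 - Λ) := by
    rw [← hab, ← Real.exp_add]; congr 1; ring
  have h4 := Real.add_one_le_exp (a - 1 - Λ)
  have h5 : 0 ≤ 1 - b⁻¹ := hab ▸ (Real.exp_pos _).le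
  have h6 : b * (1 - b⁻¹) = b - 1 := by field_simp
  have h7 : (b - 1) * (a - Λ) ≤ b * Real.exp (-Λ) := by
    rw [h3, ← mul_assoc, h6]
    have : 0 ≤ b - 1 := h6 ▸ mul_nonneg hb.le h5
    nlinarith
  rw [h1]
  nlinarith

/-- The part of the drift inequality that does not depend on time: with the weights
`q i j = x i j * p (ρ i) / ρ i`, the losses `b x i j - min (b x i j) (λ i c i)` of `λ i p (ρ i)` and
`c i = (b ρ i - 1)⁺`. The total weight `w j` of an offline vertex is compared with `a`: for
`w j ≤ a` the capacity constraint enters through `sum_excess_le`, and for `w j ≥ a` it is enough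
that `j` has total value at most `1`. The array `K` distributes the right-hand side over the types
such that each row sum can be bounded below by `sum_split_ge`. -/
theorem weighted_loss_le {ι κ : Type*} [Fintype ι] (U : Finset κ) (x : ι → κ → ℝ) (r ρ c p : ι → ℝ)
    (a b : ℝ) (hb : 2 ≤ b) (ha : 1 ≤ a) (hab : Real.exp (1 - a) = 1 - b⁻¹) (hr : ∀ i, 0 < r i)
    (hx : ∀ i, ∀ j ∈ U, 0 ≤ x i j) (hρ : ∀ i, ∑ j ∈ U, x i j = r i * ρ i) (hρ1 : ∀ i, ρ i ≤ 1)
    (hS : ∀ j ∈ U, ∀ S : Finset ι, ∑ i ∈ S, x i j ≤ 1 - Real.exp (-∑ i ∈ S, r i))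
    (hc : ∀ i, c i = max (b * ρ i - 1) 0) (hp : ∀ i, p i = min (b * ρ i) 1) :
    a * ∑ i, r i * c i ≤ ∑ j ∈ U, (∑ i, x i j * (p i / ρ i)) *
      (b - ∑ i, (b * x i j - min (b * x i j) (r i * c i))) := by
  have hρ0 : ∀ i, 0 ≤ ρ i := fun i => by
    have := hρ i ▸ Finset.sum_nonneg (hx i)
    exact nonneg_of_mul_nonneg_right this (hr i)
  have hc0 : ∀ i, 0 ≤ c i := fun i => hc i ▸ le_max_right _ _
  have hcb : ∀ i, c i ≤ b - 1 := fun i => by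
    rw [hc]; exact max_le (by nlinarith [hρ1 i]) (by linarith)
  have hp0 : ∀ i, 0 ≤ p i := fun i => by
    rw [hp]; exact le_min (mul_nonneg (by linarith) (hρ0 i)) zero_le_one
  set w : κ → ℝ := fun j => ∑ i, x i j * (p i / ρ i) with hw
  have hw0 : ∀ j ∈ U, 0 ≤ w j := fun j hj =>
    Finset.sum_nonneg fun i _ => mul_nonneg (hx i j hj) (div_nonneg (hp0 i) (hρ0 i))
  set J : Finset κ := U.filter fun j => w j ≤ a with hJ
  set δ : ι → κ → ℝ := fun i j => b * x i j - min (b * x i j) (r i * c i) -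
    max (b * x i j - (b - 1) * r i) 0 with hδ
  set K : ι → κ → ℝ := fun i j => if j ∈ J then (b - 1) * (x i j * (p i / ρ i)) - δ i j
    else min (b * x i j) (r i * c i) with hK
  have hrow : ∀ i, r i * c i ≤ ∑ j ∈ U, K i j := by
    intro i
    have h := sum_split_ge U J (fun j => x i j / r i) b (ρ i) (c i) (p i) hb
      (fun j hj => div_nonneg (hx i j hj) (hr i).le)
      (by rw [← Finset.sum_div, hρ, mul_div_cancel_left₀ _ (hr i).ne']) (hρ1 i) (hc i) (hp i)
    refine (mul_le_mul_of_nonneg_left h (hr i).le).trans_eq ?_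
    rw [Finset.mul_sum]
    refine Finset.sum_congr rfl fun j _ => ?_
    have e1 : r i * (b * (x i j / r i)) = b * x i j := by
      have := (hr i).ne'
      field_simp
    have e2 : r i * min (b * (x i j / r i)) (c i) = min (b * x i j) (r i * c i) := by
      rw [mul_min_of_nonneg _ _ (hr i).le, e1]
    have e3 : r i * max (b * (x i j / r i) - (b - 1)) 0 = max (b * x i j - (b - 1) * r i) 0 := by
      rw [mul_max_of_nonneg _ _ (hr i).le, mul_sub, e1, mul_zero, mul_comm (r i)]
    have e4 : r i * ((b - 1) * (x i j / r i * (p i / ρ i))) = (b - 1) * (x i j * (p i / ρ i)) := by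
      have := (hr i).ne'
      field_simp
    simp only [hK, hδ]
    split_ifs
    · rw [mul_sub, mul_sub, mul_sub, e1, e2, e3, e4]
    · exact e2
  have hcol : ∀ j ∈ U, a * ∑ i, K i j ≤
      w j * (b - ∑ i, (b * x i j - min (b * x i j) (r i * c i))) := by
    intro j hj
    by_cases hjJ : j ∈ J
    · have hwa : w j ≤ a := (Finset.mem_filter.mp hjJ).2
      simp only [hK, if_pos hjJ]
      rw [Finset.sum_sub_distrib, ← Finset.mul_sum]
      have h1 := sum_excess_le (fun i => x i j) r a b (by linarith) hab (hS j hj)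
      have h2 : ∑ i, δ i j = ∑ i, (b * x i j - min (b * x i j) (r i * c i)) -
          ∑ i, max (b * x i j - (b - 1) * r i) 0 := by
        simp only [hδ, Finset.sum_sub_distrib]
      have h3 : 0 ≤ ∑ i, δ i j := by
        refine Finset.sum_nonneg fun i _ => ?_
        have hrc : r i * c i ≤ (b - 1) * r i := by
          rw [mul_comm]; exact mul_le_mul_of_nonneg_right (hcb i) (hr i).le
        simp only [hδ]
        rcases le_total (b * x i j) (r i * c i) with h | h
        · rw [min_eq_left h, max_eq_right (by linarith)]; simp
        · rw [min_eq_right h]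
          rcases le_total (b * x i j - (b - 1) * r i) 0 with h' | h'
          · rw [max_eq_right h']; linarith
          · rw [max_eq_left h']; linarith
      have h4 := hw0 j hj
      have h5 : a * (b - 1) - ∑ i, δ i j ≤ b - ∑ i, (b * x i j - min (b * x i j) (r i * c i)) := by
        linarith
      have h6 := mul_le_mul_of_nonneg_left h5 h4
      have h7 := mul_nonneg (sub_nonneg.mpr hwa) h3
      have h8 : ∑ i, x i j * (p i / ρ i) = w j := rfl
      rw [h8]
      nlinarith
    · have hwa : a ≤ w j := by
        by_contra h
        exact hjJ (Finset.mem_filter.mpr ⟨hj, (not_le.mp h).le⟩)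
      simp only [hK, if_neg hjJ]
      have h1 := hS j hj Finset.univ
      have h2 := Real.exp_pos (-∑ i, r i)
      have h3 : 0 ≤ ∑ i, min (b * x i j) (r i * c i) := Finset.sum_nonneg fun i _ =>
        le_min (mul_nonneg (by linarith) (hx i j hj)) (mul_nonneg (hr i).le (hc0 i))
      rw [Finset.sum_sub_distrib, ← Finset.mul_sum]
      nlinarith [mul_nonneg (show (0 : ℝ) ≤ b by linarith)
        (show 0 ≤ 1 - ∑ i, x i j by linarith), hw0 j hj]
  calc a * ∑ i, r i * c i ≤ a * ∑ i, ∑ j ∈ U, K i j :=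
        mul_le_mul_of_nonneg_left (Finset.sum_le_sum fun i _ => hrow i) (by linarith)
    _ = ∑ j ∈ U, a * ∑ i, K i j := by rw [Finset.sum_comm, Finset.mul_sum]
    _ ≤ _ := Finset.sum_le_sum hcol

/-! ### The coefficients of the potential function -/

theorem two_le_inv {θ : ℝ} (h0 : 0 < θ) (h1 : θ ≤ 1 / 2) : 2 ≤ θ⁻¹ := by
  rw [le_inv_comm₀ two_pos h0]; linarith

theorem one_le_expA {θ : ℝ} (h0 : 0 < θ) (h1 : θ ≤ 1 / 2) : 1 ≤ expA θ := by
  have := Real.log_nonpos (show 0 ≤ 1 - θ by linarith) (by linarith)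
  unfold expA; linarith

theorem exp_one_sub_expA {θ : ℝ} (h1 : θ ≤ 1 / 2) : Real.exp (1 - expA θ) = 1 - θ⁻¹⁻¹ := by
  unfold expA
  rw [sub_sub_cancel, Real.exp_log (by linarith), inv_inv]

theorem expA_lt_inv {θ : ℝ} (h0 : 0 < θ) (h1 : θ ≤ 1 / 2) : expA θ < θ⁻¹ := by
  have h3 : Real.log (1 - θ)⁻¹ < (1 - θ)⁻¹ - 1 := by
    refine Real.log_lt_sub_one_of_pos (by rw [inv_pos]; linarith) ?_
    intro h
    rw [inv_eq_one] at h
    linarith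
  rw [Real.log_inv] at h3
  have h4 : (1 - θ)⁻¹ ≤ θ⁻¹ := inv_anti₀ h0 (by linarith)
  unfold expA; linarith

/-- `α` and `β` solve a linear system of differential equations; see also `hasDerivAt_beta`. With
it, the terms in `drift_totalValue_nonneg` balance. -/
theorem hasDerivAt_alpha {θ : ℝ} (h0 : 0 < θ) (h1 : θ ≤ 1 / 2) (t : ℝ) :
    HasDerivAt (alpha θ) (-(expA θ * θ⁻¹ * beta θ t)) t := by
  have hne : θ⁻¹ - expA θ ≠ 0 := (sub_pos.mpr (expA_lt_inv h0 h1)).ne'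
  have e : ∀ c : ℝ, HasDerivAt (fun t => Real.exp (-(c * (1 - t))))
      (Real.exp (-(c * (1 - t))) * c) t := by
    intro c
    have := ((((hasDerivAt_id t).const_sub 1).const_mul c).neg).exp
    simpa using this
  have := (((e (expA θ)).const_mul (θ⁻¹ / (θ⁻¹ - expA θ))).const_sub 1).add
    ((e θ⁻¹).const_mul (expA θ / (θ⁻¹ - expA θ)))
  convert! this using 1
  unfold beta
  generalize θ⁻¹ = b at *
  field_simp
  ring

theorem hasDerivAt_beta {θ : ℝ} (h0 : 0 < θ) (h1 : θ ≤ 1 / 2) (t : ℝ) :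
    HasDerivAt (beta θ) ((expA θ + θ⁻¹) * beta θ t - (1 - alpha θ t)) t := by
  have hne : θ⁻¹ - expA θ ≠ 0 := (sub_pos.mpr (expA_lt_inv h0 h1)).ne'
  have e : ∀ c : ℝ, HasDerivAt (fun t => Real.exp (-(c * (1 - t))))
      (Real.exp (-(c * (1 - t))) * c) t := by
    intro c
    have := ((((hasDerivAt_id t).const_sub 1).const_mul c).neg).exp
    simpa using this
  have := ((e (expA θ)).sub (e θ⁻¹)).const_mul (1 / (θ⁻¹ - expA θ))
  convert! this using 1
  unfold beta alpha
  generalize θ⁻¹ = b at *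
  field_simp
  ring

theorem beta_nonneg {θ : ℝ} (h0 : 0 < θ) (h1 : θ ≤ 1 / 2) {t : ℝ} (ht : t ≤ 1) : 0 ≤ beta θ t := by
  have h2 := expA_lt_inv h0 h1
  have h3 := sub_pos.mpr h2
  unfold beta
  refine mul_nonneg (by positivity) (sub_nonneg.mpr (Real.exp_le_exp.mpr ?_))
  nlinarith

theorem alpha_one {θ : ℝ} (h0 : 0 < θ) (h1 : θ ≤ 1 / 2) : alpha θ 1 = 0 := by
  have hne : θ⁻¹ - expA θ ≠ 0 := (sub_pos.mpr (expA_lt_inv h0 h1)).ne'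
  unfold alpha
  generalize θ⁻¹ = b at *
  simp
  field_simp
  ring

theorem beta_one (θ : ℝ) : beta θ 1 = 0 := by simp [beta]

theorem alpha_nonneg {θ : ℝ} (h0 : 0 < θ) (h1 : θ ≤ 1 / 2) {t : ℝ} (ht : t ≤ 1) :
    0 ≤ alpha θ t := by
  have hanti : AntitoneOn (alpha θ) (Set.Iic 1) := by
    refine antitoneOn_of_deriv_nonpos (convex_Iic 1)
      (fun t _ => (hasDerivAt_alpha h0 h1 t).continuousAt.continuousWithinAt)
      (fun t _ => (hasDerivAt_alpha h0 h1 t).differentiableAt.differentiableWithinAt) ?_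
    intro t ht
    rw [(hasDerivAt_alpha h0 h1 t).deriv]
    have h2 := beta_nonneg h0 h1 (t := t) (Set.mem_Iic.mp (interior_subset ht))
    have h3 := one_le_expA h0 h1
    have h4 := two_le_inv h0 h1
    have : 0 ≤ expA θ * θ⁻¹ * beta θ t := by positivity
    linarith
  have := hanti (Set.mem_Iic.mpr ht) (Set.mem_Iic.mpr le_rfl) ht
  rwa [alpha_one h0 h1] at this

/-- The bound that keeps the decrease of the potential at a match at most `1`. -/
theorem alpha_add_inv_mul_beta_le {θ : ℝ} (h0 : 0 < θ) (h1 : θ ≤ 1 / 2) (t : ℝ) :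
    alpha θ t + θ⁻¹ * beta θ t ≤ 1 := by
  have hne : θ⁻¹ - expA θ ≠ 0 := (sub_pos.mpr (expA_lt_inv h0 h1)).ne'
  have : alpha θ t + θ⁻¹ * beta θ t = 1 - Real.exp (-(θ⁻¹ * (1 - t))) := by
    unfold alpha beta
    generalize θ⁻¹ = b at *
    field_simp
    ring
  rw [this]
  linarith [Real.exp_pos (-(θ⁻¹ * (1 - t)))]

namespace TypeGraph
variable {G : TypeGraph}

/-! ### The fractional matching behind the potential -/

/-- The reference solution, set to zero off the edges. -/
def edgeValue (G : TypeGraph) (x : Fin G.n → Fin G.m → ℝ) (i : Fin G.n) (j : Fin G.m) : ℝ :=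
  if G.adj i j then x i j else 0

theorem sum_nbr_inter (x : Fin G.n → Fin G.m → ℝ) (U : Finset (Fin G.m)) (i : Fin G.n) :
    ∑ j ∈ G.nbr i ∩ U, x i j = ∑ j ∈ U, G.edgeValue x i j := by
  unfold edgeValue
  rw [← Finset.sum_filter]
  congr 1
  ext j; simp [nbr, and_comm]

theorem rho_eq (x : Fin G.n → Fin G.m → ℝ) (U : Finset (Fin G.m)) (i : Fin G.n) :
    G.rho x U i = (∑ j ∈ U, G.edgeValue x i j) / G.rate i := by
  rw [rho, sum_nbr_inter]

theorem rate_mul_rho (x : Fin G.n → Fin G.m → ℝ) (U : Finset (Fin G.m)) (i : Fin G.n) :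
    G.rate i * G.rho x U i = ∑ j ∈ U, G.edgeValue x i j := by
  rw [rho_eq, mul_div_cancel₀ _ (G.rate_pos i).ne']

theorem rho_erase (x : Fin G.n → Fin G.m → ℝ) {U : Finset (Fin G.m)} {j : Fin G.m} (hj : j ∈ U)
    (i : Fin G.n) : G.rho x (U.erase j) i = G.rho x U i - G.edgeValue x i j / G.rate i := by
  rw [rho_eq, rho_eq, ← Finset.add_sum_erase _ _ hj]
  ring

theorem IsLPFeasible.edgeValue_nonneg {x : Fin G.n → Fin G.m → ℝ} (hx : G.IsLPFeasible x) (i j) :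
    0 ≤ G.edgeValue x i j := by
  unfold edgeValue
  split_ifs with h
  · exact hx.nonneg i j h
  · exact le_rfl

theorem IsLPFeasible.sum_edgeValue_le {x : Fin G.n → Fin G.m → ℝ} (hx : G.IsLPFeasible x)
    (j : Fin G.m) (S : Finset (Fin G.n)) :
    ∑ i ∈ S, G.edgeValue x i j ≤ 1 - Real.exp (-∑ i ∈ S, G.rate i) := by
  unfold edgeValue
  rw [← Finset.sum_filter]
  refine (hx.offline j _ fun i hi => (Finset.mem_filter.mp hi).2).trans ?_
  have : ∑ i ∈ S with G.adj i j, G.rate i ≤ ∑ i ∈ S, G.rate i :=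
    Finset.sum_le_sum_of_subset_of_nonneg (Finset.filter_subset _ _) fun i _ _ => (G.rate_pos i).le
  have := Real.exp_le_exp.mpr (neg_le_neg this)
  linarith

theorem IsLPFeasible.sum_le_rate {x : Fin G.n → Fin G.m → ℝ} (hx : G.IsLPFeasible x)
    (i : Fin G.n) (U : Finset (Fin G.m)) : ∑ j ∈ U, G.edgeValue x i j ≤ G.rate i := by
  rw [← sum_nbr_inter]
  refine (Finset.sum_le_sum_of_subset_of_nonneg Finset.inter_subset_left
    fun j hj _ => hx.nonneg i j (by simpa [nbr] using hj)).trans (hx.online i)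

theorem rho_nonneg {x : Fin G.n → Fin G.m → ℝ} (hx : G.IsLPFeasible x) (U) (i : Fin G.n) :
    0 ≤ G.rho x U i := by
  rw [rho_eq]
  exact div_nonneg (Finset.sum_nonneg fun j _ => hx.edgeValue_nonneg i j) (G.rate_pos i).le

theorem rho_le_one {x : Fin G.n → Fin G.m → ℝ} (hx : G.IsLPFeasible x) (U) (i : Fin G.n) :
    G.rho x U i ≤ 1 := by
  rw [rho_eq, div_le_one (G.rate_pos i)]
  exact hx.sum_le_rate i U

/-- The loss of `∑ λᵢ p(ρᵢ)` at type `i` if `j` gets matched. -/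
def cappedLoss (G : TypeGraph) (θ : ℝ) (x : Fin G.n → Fin G.m → ℝ) (U : Finset (Fin G.m))
    (i : Fin G.n) (j : Fin G.m) : ℝ :=
  θ⁻¹ * G.edgeValue x i j -
    min (θ⁻¹ * G.edgeValue x i j) (G.rate i * max (θ⁻¹ * G.rho x U i - 1) 0)

theorem capped_eq (θ ρ : ℝ) : capped θ ρ = min (θ⁻¹ * ρ) 1 := by
  rw [capped, div_eq_inv_mul]

theorem decrease_eq (θ : ℝ) (x : Fin G.n → Fin G.m → ℝ) (t : ℝ)
    {U : Finset (Fin G.m)} {j : Fin G.m} (hj : j ∈ U) :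
    G.decrease θ x t U j = alpha θ t * ∑ i, G.edgeValue x i j +
      beta θ t * ∑ i, G.rate i * (capped θ (G.rho x U i) -
        capped θ (G.rho x U i - G.edgeValue x i j / G.rate i)) := by
  unfold decrease potential
  have e1 : ∑ i, G.rate i * G.rho x U i - ∑ i, G.rate i * G.rho x (U.erase j) i =
      ∑ i, G.edgeValue x i j := by
    rw [← Finset.sum_sub_distrib]
    refine Finset.sum_congr rfl fun i _ => ?_
    rw [rho_erase x hj, mul_sub, sub_sub_cancel, mul_div_cancel₀ _ (G.rate_pos i).ne']
  simp only [mul_sub, Finset.sum_sub_distrib, ← rho_erase x hj]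
  rw [← e1]
  ring

theorem rate_mul_capped_sub {θ : ℝ} (h0 : 0 < θ) {x : Fin G.n → Fin G.m → ℝ}
    (hx : G.IsLPFeasible x) (U : Finset (Fin G.m)) (i : Fin G.n) (j : Fin G.m) :
    G.rate i * (capped θ (G.rho x U i) - capped θ (G.rho x U i - G.edgeValue x i j / G.rate i)) =
      G.cappedLoss θ x U i j := by
  have hr := G.rate_pos i
  have hv := hx.edgeValue_nonneg i j
  unfold cappedLoss
  rw [capped_eq, capped_eq]
  obtain ⟨v, hv'⟩ : ∃ v, v = G.edgeValue x i j / G.rate i := ⟨_, rfl⟩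
  have hv0 : 0 ≤ θ⁻¹ * v := by rw [hv']; positivity
  have e1 : θ⁻¹ * G.edgeValue x i j = G.rate i * (θ⁻¹ * v) := by rw [hv']; field_simp
  rw [← hv', e1, ← mul_min_of_nonneg _ _ hr.le, ← mul_sub]
  congr 1
  rw [mul_sub]
  generalize θ⁻¹ * v = u at *
  generalize θ⁻¹ * G.rho x U i = ρ at *
  rcases le_total ρ 1 with h | h
  · rw [min_eq_left h, max_eq_right (by linarith), min_eq_right hv0, min_eq_left (by linarith)]
    ring
  · rw [min_eq_right h, max_eq_left (by linarith)]
    rcases le_total u (ρ - 1) with h' | h'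
    · rw [min_eq_left h', min_eq_right (by linarith)]; ring
    · rw [min_eq_right h', min_eq_left (by linarith)]; ring

/-- A match adds `1` to the matching and costs at most `1` of the potential, so it never pays to
leave an arrival unmatched. -/
theorem decrease_le_one {θ : ℝ} (h0 : 0 < θ) (h1 : θ ≤ 1 / 2) {x : Fin G.n → Fin G.m → ℝ}
    (hx : G.IsLPFeasible x) {t : ℝ} (ht : t ≤ 1) {U : Finset (Fin G.m)} {j : Fin G.m}
    (hj : j ∈ U) : G.decrease θ x t U j ≤ 1 := by
  rw [decrease_eq θ x t hj]
  simp only [rate_mul_capped_sub h0 hx]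
  have hy0 : 0 ≤ ∑ i, G.edgeValue x i j := Finset.sum_nonneg fun i _ => hx.edgeValue_nonneg i j
  have hy1 : ∑ i, G.edgeValue x i j ≤ 1 :=
    (hx.sum_edgeValue_le j Finset.univ).trans (by linarith [Real.exp_pos (-∑ i, G.rate i)])
  have hz : ∑ i, G.cappedLoss θ x U i j ≤ θ⁻¹ * ∑ i, G.edgeValue x i j := by
    rw [Finset.mul_sum]
    refine Finset.sum_le_sum fun i _ => sub_le_self _ (le_min ?_ ?_)
    · exact mul_nonneg (inv_nonneg.mpr h0.le) (hx.edgeValue_nonneg i j)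
    · exact mul_nonneg (G.rate_pos i).le (le_max_right _ _)
  have hα := alpha_nonneg h0 h1 ht
  have hβ := beta_nonneg h0 h1 ht
  have hb := two_le_inv h0 h1
  have h2 := alpha_add_inv_mul_beta_le h0 h1 t
  have h3 := mul_le_mul_of_nonneg_left hz hβ
  have h4 : 0 ≤ alpha θ t + θ⁻¹ * beta θ t := by positivity
  nlinarith

/-! ### Regularized Greedy as a policy -/

theorem regGreedy_eq_some {θ : ℝ} {x : Fin G.n → Fin G.m → ℝ} {t : ℝ} {U : Finset (Fin G.m)}
    {i : Fin G.n} {j : Fin G.m} (h : G.regGreedy θ x t U i = some j) :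
    j ∈ G.bestNeighbours θ x t U i := by
  unfold regGreedy at h
  split_ifs at h with hne
  rw [← Option.some.inj h]
  exact Finset.min'_mem _ _

theorem regGreedy_eq_none {θ : ℝ} {x : Fin G.n → Fin G.m → ℝ} {t : ℝ} {U : Finset (Fin G.m)}
    {i : Fin G.n} (h : G.regGreedy θ x t U i = none) : G.nbr i ∩ U = ∅ := by
  unfold regGreedy at h
  split_ifs at h with hne
  by_contra hU
  obtain ⟨j, hj, hmin⟩ := Finset.exists_min_image (G.nbr i ∩ U) (G.decrease θ x t U)
    (Finset.nonempty_iff_ne_empty.mpr hU)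
  exact hne ⟨j, Finset.mem_filter.mpr ⟨hj, hmin⟩⟩

theorem regGreedy_mem {θ : ℝ} {x : Fin G.n → Fin G.m → ℝ} (t U i j)
    (h : G.regGreedy θ x t U i = some j) : j ∈ U :=
  (Finset.mem_inter.mp (Finset.mem_filter.mp (regGreedy_eq_some h)).1).2

theorem hasDerivAt_potential {θ : ℝ} (h0 : 0 < θ) (h1 : θ ≤ 1 / 2) (x : Fin G.n → Fin G.m → ℝ)
    (U : Finset (Fin G.m)) (t : ℝ) : HasDerivAt (fun t => G.potential θ x t U)
      (-(expA θ * θ⁻¹ * beta θ t) * ∑ i, G.rate i * G.rho x U i +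
        ((expA θ + θ⁻¹) * beta θ t - (1 - alpha θ t)) *
          ∑ i, G.rate i * capped θ (G.rho x U i)) t :=
  ((hasDerivAt_alpha h0 h1 t).mul_const _).add ((hasDerivAt_beta h0 h1 t).mul_const _)

theorem continuous_alpha (θ : ℝ) : Continuous (alpha θ) := by unfold alpha; fun_prop

theorem continuous_beta (θ : ℝ) : Continuous (beta θ) := by unfold beta; fun_prop

theorem measurablePolicy_regGreedy (θ : ℝ) (x : Fin G.n → Fin G.m → ℝ) :
    MeasurablePolicy (G.regGreedy θ x) := by
  intro U i o
  have hpot : ∀ V, Measurable fun t => G.potential θ x t V := by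
    intro V
    have h1 := (continuous_alpha θ).measurable
    have h2 := (continuous_beta θ).measurable
    unfold potential
    fun_prop
  have hdec : ∀ j, Measurable fun t => G.decrease θ x t U j := fun j => (hpot U).sub (hpot _)
  -- Only the set of best neighbours depends on time.
  suffices hB : ∀ B, MeasurableSet {t | G.bestNeighbours θ x t U i = B} by
    let _ : MeasurableSpace (Option (Fin G.m)) := ⊤
    have hmeas : Measurable fun t => G.regGreedy θ x t U i :=
      measurable_of_countable_fibers (S := fun t => G.bestNeighbours θ x t U i)
        (F := fun B _ => if h : B.Nonempty then some (B.min' h) else none) hB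
        fun _ => measurable_const
    exact hmeas (MeasurableSpace.measurableSet_top (s := {o}))
  intro B
  have : {t | G.bestNeighbours θ x t U i = B} = ⋂ j, {t | (j ∈ G.nbr i ∩ U ∧
      ∀ k ∈ G.nbr i ∩ U, G.decrease θ x t U j ≤ G.decrease θ x t U k) ↔ j ∈ B} := by
    ext t
    simp only [Set.mem_ofPred_eq, Set.mem_iInter, Finset.ext_iff, bestNeighbours,
      Finset.mem_filter]
  rw [this]
  refine MeasurableSet.iInter fun j => ?_
  have hmin : MeasurableSet
      {t | ∀ k ∈ G.nbr i ∩ U, G.decrease θ x t U j ≤ G.decrease θ x t U k} := by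
    simp only [Set.ofPred_forall]
    exact MeasurableSet.iInter fun k => MeasurableSet.iInter fun _ =>
      measurableSet_le (hdec j) (hdec k)
  exact MeasurableSet.iff (MeasurableSet.inter (MeasurableSet.const _) hmin)
    (MeasurableSet.const _)

end TypeGraph

namespace TypeGraph
variable {G : TypeGraph}

/-! ### The drift of the potential -/

/-- The potential plus the number of matched offline vertices. -/
def totalValue (G : TypeGraph) (θ : ℝ) (x : Fin G.n → Fin G.m → ℝ) (t : ℝ)
    (U : Finset (Fin G.m)) : ℝ :=
  G.potential θ x t U + (G.m - U.card)

/-- The effect of an arrival on `totalValue`: one minus the smallest decrease of the potential. -/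
theorem jump_totalValue {θ : ℝ} {x : Fin G.n → Fin G.m → ℝ} {t : ℝ} {U : Finset (Fin G.m)}
    {i : Fin G.n} :
    (G.nbr i ∩ U = ∅ ∧ jump (G.regGreedy θ x) (G.totalValue θ x) i t U = 0) ∨
    ∃ j ∈ G.bestNeighbours θ x t U i,
      jump (G.regGreedy θ x) (G.totalValue θ x) i t U = 1 - G.decrease θ x t U j := by
  rcases h : G.regGreedy θ x t U i with _ | j
  · left
    refine ⟨regGreedy_eq_none h, ?_⟩
    simp [jump, nextState, h]
  · right
    refine ⟨j, regGreedy_eq_some h, ?_⟩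
    have hj := regGreedy_mem t U i j h
    have := Finset.card_erase_add_one hj
    have hc : (U.card : ℝ) = (U.erase j).card + 1 := by exact_mod_cast this.symm
    simp only [jump, nextState, h, totalValue, decrease, hc]
    ring

theorem jump_totalValue_nonneg {θ : ℝ} (h0 : 0 < θ) (h1 : θ ≤ 1 / 2) {x : Fin G.n → Fin G.m → ℝ}
    (hx : G.IsLPFeasible x) {t : ℝ} (ht : t ≤ 1) (U : Finset (Fin G.m)) (i : Fin G.n) :
    0 ≤ jump (G.regGreedy θ x) (G.totalValue θ x) i t U := by
  rcases jump_totalValue (θ := θ) (x := x) (t := t) (U := U) (i := i) with h | ⟨j, hj, h⟩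
  · exact h.2.ge
  · rw [h]
    have hjU := (Finset.mem_inter.mp (Finset.mem_filter.mp hj).1).2
    linarith [decrease_le_one h0 h1 hx ht hjU]

/-- Greedy does at least as well as the random choice that matches type `i` to `j` with probability
`x i j / (λ i ρ i) * p (ρ i)`. -/
theorem le_rate_mul_jump {θ : ℝ} (h0 : 0 < θ) (h1 : θ ≤ 1 / 2) {x : Fin G.n → Fin G.m → ℝ}
    (hx : G.IsLPFeasible x) {t : ℝ} (ht : t ≤ 1) (U : Finset (Fin G.m)) (i : Fin G.n) :
    ∑ j ∈ U, G.edgeValue x i j * (capped θ (G.rho x U i) / G.rho x U i) *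
        (1 - G.decrease θ x t U j) ≤
      G.rate i * jump (G.regGreedy θ x) (G.totalValue θ x) i t U := by
  have hρ := rho_nonneg hx U i
  have hp0 : 0 ≤ capped θ (G.rho x U i) := le_min (div_nonneg hρ h0.le) zero_le_one
  have hq : ∀ j, 0 ≤ G.edgeValue x i j * (capped θ (G.rho x U i) / G.rho x U i) := fun j =>
    mul_nonneg (hx.edgeValue_nonneg i j) (div_nonneg hp0 hρ)
  have hoff : ∀ j ∈ U, j ∉ G.nbr i → G.edgeValue x i j = 0 := by
    intro j _ hj
    have : ¬ G.adj i j := by simpa [nbr] using hj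
    simp [edgeValue, this]
  rcases jump_totalValue (θ := θ) (x := x) (t := t) (U := U) (i := i) with ⟨hE, h⟩ | ⟨k, hk, h⟩
  · rw [h, mul_zero]
    refine (Finset.sum_eq_zero fun j hj => ?_).le
    rw [hoff j hj, zero_mul, zero_mul]
    intro hj'
    have : j ∈ G.nbr i ∩ U := Finset.mem_inter.mpr ⟨hj', hj⟩
    simp [hE] at this
  · rw [h]
    obtain ⟨hkU, hmin⟩ := Finset.mem_filter.mp hk
    have hk1 := decrease_le_one h0 h1 hx ht (Finset.mem_inter.mp hkU).2
    have hsum : ∑ j ∈ U, G.edgeValue x i j * (capped θ (G.rho x U i) / G.rho x U i) ≤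
        G.rate i := by
      rw [← Finset.sum_mul, ← rate_mul_rho]
      have hp1 : capped θ (G.rho x U i) ≤ 1 := min_le_right _ _
      rcases hρ.eq_or_lt with h' | h'
      · rw [← h']; simpa using (G.rate_pos i).le
      · rw [mul_assoc, mul_div_cancel₀ _ h'.ne']
        nlinarith [G.rate_pos i]
    calc _ ≤ ∑ j ∈ U, G.edgeValue x i j * (capped θ (G.rho x U i) / G.rho x U i) *
          (1 - G.decrease θ x t U k) := by
          refine Finset.sum_le_sum fun j hj => ?_
          by_cases hj' : j ∈ G.nbr i
          · exact mul_le_mul_of_nonneg_left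
              (by linarith [hmin j (Finset.mem_inter.mpr ⟨hj', hj⟩)]) (hq j)
          · rw [hoff j hj hj']; simp
      _ ≤ _ := by
          rw [← Finset.sum_mul]
          exact mul_le_mul_of_nonneg_right hsum (by linarith)

/-- The drift of `totalValue` is nonnegative: the time derivative of the potential, which the
differential equations of `α` and `β` express in `∑ λ ρ` and `∑ λ p(ρ)`, is compensated by the
expected effect of the arrivals, by `le_rate_mul_jump` and `weighted_loss_le`. -/
theorem drift_totalValue_nonneg {θ : ℝ} (h0 : 0 < θ) (h1 : θ ≤ 1 / 2)
    {x : Fin G.n → Fin G.m → ℝ} (hx : G.IsLPFeasible x) {t : ℝ} (ht : t ≤ 1)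
    (U : Finset (Fin G.m)) :
    0 ≤ (-(expA θ * θ⁻¹ * beta θ t) * ∑ i, G.rate i * G.rho x U i +
        ((expA θ + θ⁻¹) * beta θ t - (1 - alpha θ t)) *
          ∑ i, G.rate i * capped θ (G.rho x U i)) +
      ∑ i, G.rate i * jump (G.regGreedy θ x) (G.totalValue θ x) i t U := by
  set a := expA θ
  set b := θ⁻¹ with hb
  set X := ∑ i, G.rate i * G.rho x U i with hX
  set Y := ∑ i, G.rate i * capped θ (G.rho x U i) with hY
  set q : Fin G.n → Fin G.m → ℝ := fun i j =>
    G.edgeValue x i j * (capped θ (G.rho x U i) / G.rho x U i) with hq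
  set c : Fin G.n → ℝ := fun i => max (b * G.rho x U i - 1) 0 with hc
  have hα := alpha_nonneg h0 h1 ht
  have hβ := beta_nonneg h0 h1 ht
  have hq0 : ∀ i j, 0 ≤ q i j := fun i j => mul_nonneg (hx.edgeValue_nonneg i j)
    (div_nonneg (le_min (div_nonneg (rho_nonneg hx U i) h0.le) zero_le_one) (rho_nonneg hx U i))
  have hsumq : ∑ j ∈ U, ∑ i, q i j = Y := by
    rw [Finset.sum_comm]
    refine Finset.sum_congr rfl fun i _ => ?_
    rw [← Finset.sum_mul, ← rate_mul_rho]
    rcases eq_or_ne (G.rho x U i) 0 with h | h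
    · simp [h, capped]
    · rw [mul_assoc, mul_div_cancel₀ _ h]
  have hcXY : ∑ i, G.rate i * c i = b * X - Y := by
    rw [hX, hY, Finset.mul_sum, ← Finset.sum_sub_distrib]
    refine Finset.sum_congr rfl fun i _ => ?_
    simp only [hc]
    rw [capped_eq, ← hb]
    rcases le_total (b * G.rho x U i) 1 with h | h
    · rw [max_eq_right (by linarith), min_eq_left h]; ring
    · rw [max_eq_left (by linarith), min_eq_right h]; ring
  have hloss := weighted_loss_le U (G.edgeValue x) G.rate (G.rho x U) c
    (fun i => capped θ (G.rho x U i)) a b (two_le_inv h0 h1) (one_le_expA h0 h1)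
    (exp_one_sub_expA h1) G.rate_pos (fun i j _ => hx.edgeValue_nonneg i j)
    (fun i => (rate_mul_rho x U i).symm) (rho_le_one hx U) (fun j _ S => hx.sum_edgeValue_le j S)
    (fun i => rfl) (fun i => capped_eq _ _)
  rw [hcXY] at hloss
  have hjump : ∑ j ∈ U, (∑ i, q i j) * (1 - G.decrease θ x t U j) ≤
      ∑ i, G.rate i * jump (G.regGreedy θ x) (G.totalValue θ x) i t U := by
    simp only [Finset.sum_mul]
    rw [Finset.sum_comm]
    exact Finset.sum_le_sum fun i _ => le_rate_mul_jump h0 h1 hx ht U i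
  have hdec : ∑ j ∈ U, (∑ i, q i j) * (1 - G.decrease θ x t U j) =
      alpha θ t * ∑ j ∈ U, (∑ i, q i j) * (1 - ∑ i, G.edgeValue x i j) +
      beta θ t * ∑ j ∈ U, (∑ i, q i j) * (b - ∑ i, G.cappedLoss θ x U i j) +
      (1 - alpha θ t - b * beta θ t) * Y := by
    rw [← hsumq, Finset.mul_sum, Finset.mul_sum, Finset.mul_sum, ← Finset.sum_add_distrib,
      ← Finset.sum_add_distrib]
    refine Finset.sum_congr rfl fun j hj => ?_
    rw [decrease_eq θ x t hj]
    simp only [rate_mul_capped_sub h0 hx]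
    ring
  have hy : 0 ≤ ∑ j ∈ U, (∑ i, q i j) * (1 - ∑ i, G.edgeValue x i j) := by
    refine Finset.sum_nonneg fun j _ => mul_nonneg (Finset.sum_nonneg fun i _ => hq0 i j) ?_
    have := hx.sum_edgeValue_le j Finset.univ
    have := Real.exp_pos (-∑ i, G.rate i)
    linarith
  have h2 := mul_nonneg hα hy
  have h3 : beta θ t * (a * (b * X - Y)) ≤
      beta θ t * ∑ j ∈ U, (∑ i, q i j) * (b - ∑ i, G.cappedLoss θ x U i j) :=
    mul_le_mul_of_nonneg_left hloss hβ
  nlinarith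

theorem integrable_card_algMatching {alg : G.Policy} (hm : MeasurablePolicy alg)
    (halg : ∀ t U i j, alg t U i = some j → j ∈ U) :
    Integrable (fun ω => ((G.algMatching alg ω).card : ℝ)) G.law := by
  have hcard : ∀ ω, ((G.algMatching alg ω).card : ℝ) =
      G.m - (runState alg (G.arrivalTime ω) (G.arrivalList ω) Finset.univ).card := by
    intro ω
    rw [eq_sub_iff_add_eq]
    exact_mod_cast card_algMatching alg halg ω
  refine Integrable.of_bound (Measurable.aestronglyMeasurable ?_) (G.m : ℝ)
    (Filter.Eventually.of_forall fun ω => ?_)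
  · simp only [hcard]
    exact measurable_of_countable_fibers
      (S := fun ω => runState alg (G.arrivalTime ω) (G.arrivalList ω) Finset.univ)
      (F := fun U _ => (G.m : ℝ) - U.card) (measurableSet_finalState hm) fun _ => measurable_const
  · have := card_algMatching alg halg ω
    simp only [Real.norm_natCast, Nat.cast_le]
    omega

/-- Initially the potential is at least `(α(0) + β(0))` times the value of the reference solution,
since `p(ρ) ≥ ρ`; at time `1` it vanishes, so that only the size of the matching remains. -/
theorem lpValue_le_expectation {θ : ℝ} (h0 : 0 < θ) (h1 : θ ≤ 1 / 2)
    {x : Fin G.n → Fin G.m → ℝ} (hx : G.IsLPFeasible x) :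
    (alpha θ 0 + beta θ 0) * G.lpValue x ≤
      ∫ ω, ((G.algMatching (G.regGreedy θ x) ω).card : ℝ) ∂G.law := by
  have hstart : (alpha θ 0 + beta θ 0) * G.lpValue x ≤ G.totalValue θ x 0 Finset.univ := by
    have hX : ∑ i, G.rate i * G.rho x Finset.univ i = G.lpValue x := by
      refine Finset.sum_congr rfl fun i _ => ?_
      rw [rate_mul_rho, ← sum_nbr_inter, Finset.inter_univ]
    have hY : G.lpValue x ≤ ∑ i, G.rate i * capped θ (G.rho x Finset.univ i) := by
      rw [← hX]
      refine Finset.sum_le_sum fun i _ => mul_le_mul_of_nonneg_left ?_ (G.rate_pos i).le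
      refine le_min ?_ (rho_le_one hx _ i)
      rw [le_div_iff₀ h0]
      have := rho_nonneg hx Finset.univ i
      nlinarith
    have := mul_le_mul_of_nonneg_left hY (beta_nonneg h0 h1 zero_le_one)
    simp only [totalValue, potential, hX, Finset.card_univ, Fintype.card_fin, sub_self]
    linarith
  refine hstart.trans ((le_integral_of_drift_nonneg (measurablePolicy_regGreedy θ x)
    (H := G.totalValue θ x) (fun U t => (hasDerivAt_potential h0 h1 x U t).add_const _)
    (fun U => ?_) (fun t ht U i => jump_totalValue_nonneg h0 h1 hx ht.2 U i)
    (fun t ht U => drift_totalValue_nonneg h0 h1 hx ht.2 U)).trans_eq ?_)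
  · have := continuous_alpha θ
    have := continuous_beta θ
    fun_prop
  · refine integral_congr_ae (Filter.Eventually.of_forall fun ω => ?_)
    have h := card_algMatching (G.regGreedy θ x) regGreedy_mem ω
    simp only [totalValue, potential, alpha_one h0 h1, beta_one, zero_mul, zero_add]
    rw [sub_eq_iff_eq_add]
    exact_mod_cast h.symm

/-- A reference solution whose value is at least `q` times the optimum costs at most the factor `q`,
because the expected offline optimum is itself the value of a feasible solution. -/
theorem hasRatio_regGreedy {θ : ℝ} (h0 : 0 < θ) (h1 : θ ≤ 1 / 2) {x : Fin G.n → Fin G.m → ℝ}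
    (hx : G.IsLPFeasible x) {q Γ : ℝ} (hΓ : Γ ≤ q * (alpha θ 0 + beta θ 0))
    (hopt : ∀ x', G.IsLPFeasible x' → q * G.lpValue x' ≤ G.lpValue x) :
    G.HasRatio (G.regGreedy θ x) Γ := by
  refine ⟨integrable_optSize, integrable_card_algMatching (measurablePolicy_regGreedy θ x)
    regGreedy_mem, le_trans ?_ (lpValue_le_expectation h0 h1 hx)⟩
  have h2 := hopt _ G.isLPFeasible_offlineSolution
  rw [lpValue_offlineSolution] at h2
  have hO : 0 ≤ ∫ ω, (G.optSize ω : ℝ) ∂G.law := integral_nonneg fun _ => Nat.cast_nonneg _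
  have hab : 0 ≤ alpha θ 0 + beta θ 0 :=
    add_nonneg (alpha_nonneg h0 h1 zero_le_one) (beta_nonneg h0 h1 zero_le_one)
  nlinarith [mul_le_mul_of_nonneg_left h2 hab, mul_le_mul_of_nonneg_right hΓ hO]

end TypeGraph

theorem regGreedyCompetitive {θ Γ : ℝ} (h0 : 0 < θ) (h1 : θ ≤ 1 / 2)
    (hΓ : Γ ≤ alpha θ 0 + beta θ 0) : RegGreedyCompetitive θ Γ := fun G x hx =>
  TypeGraph.hasRatio_regGreedy (q := 1) h0 h1 hx.1 (by rwa [one_mul]) fun x' hx' => by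
    rw [one_mul]; exact hx.2 x' hx'

/-! ### Numerical values for `θ = 17/40` -/

theorem log_forty_div_le : Real.log (40 / 23) ≤ 0.55339 := by
  rw [Real.log_le_iff_le_exp (by norm_num)]
  have h := Real.sum_le_exp_of_nonneg (x := 0.55339) (by norm_num) 10
  refine le_trans ?_ h
  norm_num [Finset.sum_range_succ, Nat.factorial]

theorem exp_neg_ge : 0.0950 ≤ Real.exp (-(40 / 17)) := by
  have h1 : Real.exp (40 / 17) = Real.exp 1 ^ 2 * Real.exp (6 / 17) := by
    rw [← Real.exp_nat_mul, ← Real.exp_add]; norm_num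
  have h2 : Real.exp (6 / 17) ≤ 1.42328 := by
    refine (Real.exp_bound' (n := 8) (by norm_num) (by norm_num) (by norm_num)).trans ?_
    norm_num [Finset.sum_range_succ, Nat.factorial]
  have h3 : Real.exp 1 ^ 2 ≤ 2.7182818286 ^ 2 :=
    pow_le_pow_left₀ (Real.exp_pos 1).le Real.exp_one_lt_d9.le 2
  rw [Real.exp_neg, le_inv_comm₀ (by norm_num) (Real.exp_pos _), h1]
  have h4 := mul_le_mul h3 h2 (Real.exp_pos _).le (by norm_num)
  refine h4.trans ?_
  norm_num

/-- The ratio for `θ = 17/40` is about `0.70788`, which leaves room for a loss of `0.001` in the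
reference solution. -/
theorem ratio_le : (0.707 : ℝ) ≤ 0.999 * (alpha (17 / 40) 0 + beta (17 / 40) 0) := by
  have hlog : Real.log (1 - 17 / 40) = -Real.log (40 / 23) := by
    rw [← Real.log_inv]; norm_num
  have hL := log_forty_div_le
  have hE := exp_neg_ge
  have hexpA : Real.exp (-(1 + Real.log (40 / 23))) = 23 / 40 * Real.exp (-1) := by
    rw [neg_add, Real.exp_add, ← Real.log_inv, Real.exp_log (by norm_num)]; norm_num; ring
  have he1 : Real.exp (-1) ≤ 0.3678795 := by
    rw [Real.exp_neg, inv_le_comm₀ (Real.exp_pos 1) (by norm_num)]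
    refine le_trans ?_ Real.exp_one_gt_d9.le
    norm_num
  have hLpos : 0 ≤ Real.log (40 / 23) := Real.log_nonneg (by norm_num)
  unfold alpha beta expA
  rw [hlog]
  simp only [sub_neg_eq_add, sub_zero, mul_one]
  rw [hexpA, show ((17 / 40 : ℝ))⁻¹ = 40 / 17 by norm_num]
  set L := Real.log (40 / 23)
  set E := Real.exp (-(40 / 17))
  have hd : 0 < 40 / 17 - (1 + L) := by norm_num at hL ⊢; linarith
  have key : 0.7077078 * (40 / 17 - (1 + L)) ≤ (40 / 17 - (1 + L)) -
      (40 / 17 - 1) * (23 / 40 * Real.exp (-1)) + L * E := by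
    norm_num at hL hE he1 ⊢
    nlinarith [mul_le_mul_of_nonneg_left hE hLpos]
  have h2 : 0.7077078 ≤ 1 - 40 / 17 / (40 / 17 - (1 + L)) * (23 / 40 * Real.exp (-1)) +
      (1 + L) / (40 / 17 - (1 + L)) * E +
      1 / (40 / 17 - (1 + L)) * (23 / 40 * Real.exp (-1) - E) := by
    have e : 1 - 40 / 17 / (40 / 17 - (1 + L)) * (23 / 40 * Real.exp (-1)) +
        (1 + L) / (40 / 17 - (1 + L)) * E +
        1 / (40 / 17 - (1 + L)) * (23 / 40 * Real.exp (-1) - E) =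
        ((40 / 17 - (1 + L)) - (40 / 17 - 1) * (23 / 40 * Real.exp (-1)) + L * E) /
          (40 / 17 - (1 + L)) := by
      generalize 40 / 17 - (1 + L) = d at *
      field_simp
      ring
    rw [e, le_div_iff₀ hd]
    exact key
  norm_num at h2 ⊢
  linarith

theorem one_sub_inv_exp_lt : 1 - 1 / Real.exp 1 < 0.707 := by
  have h : (0.36 : ℝ) < 1 / Real.exp 1 := by
    rw [lt_div_iff₀ (Real.exp_pos 1)]
    have := Real.exp_one_lt_d9
    norm_num at this ⊢
    linarith
  norm_num at h ⊢
  linarith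

/-! ### Reasoning about programs -/

namespace RamState

/-- The state after writing `v` to the register `r`. -/
def setReg (σ : RamState) (r v : ℕ) : RamState := ⟨Function.update σ.reg r v, σ.mem⟩

/-- The state after writing `x` to the cell `(u, v)` of the array `A`. -/
def setMem (σ : RamState) (A u v : ℕ) (x : ℝ) : RamState :=
  ⟨σ.reg, fun B u' v' => if B = A ∧ u' = u ∧ v' = v then x else σ.mem B u' v'⟩

@[simp] theorem setReg_reg (σ : RamState) (r v s : ℕ) :
    (σ.setReg r v).reg s = if s = r then v else σ.reg s := by
  simp [setReg, Function.update_apply]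

@[simp] theorem setReg_mem (σ : RamState) (r v : ℕ) : (σ.setReg r v).mem = σ.mem := rfl

@[simp] theorem setMem_reg (σ : RamState) (A u v : ℕ) (x : ℝ) : (σ.setMem A u v x).reg = σ.reg :=
  rfl

@[simp] theorem setMem_mem (σ : RamState) (A u v : ℕ) (x : ℝ) (B u' v' : ℕ) :
    (σ.setMem A u v x).mem B u' v' = if B = A ∧ u' = u ∧ v' = v then x else σ.mem B u' v' := rfl

end RamState

namespace RamProg

@[simp] theorem output_zero (r σ) : (zero r).output σ = σ.setReg r 0 := rfl
@[simp] theorem output_incr (r) (σ : RamState) :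
    (incr r).output σ = σ.setReg r (σ.reg r + 1) := rfl
@[simp] theorem output_copy (r s) (σ : RamState) :
    (copy r s).output σ = σ.setReg r (σ.reg s) := rfl
@[simp] theorem output_store (A r s e) (σ : RamState) :
    (store A r s e).output σ = σ.setMem A (σ.reg r) (σ.reg s) (e.eval σ) := rfl
@[simp] theorem output_seq (c d σ) : (seq c d).output σ = d.output (c.output σ) := rfl
@[simp] theorem output_ifLe (e f c d σ) : (ifLe e f c d).output σ =
    if e.eval σ ≤ f.eval σ then c.output σ else d.output σ := by
  simp only [output, run]; split_ifs <;> rfl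
@[simp] theorem output_ifEq (r s c d) (σ : RamState) : (ifEq r s c d).output σ =
    if σ.reg r = σ.reg s then c.output σ else d.output σ := by
  simp only [output, run]; split_ifs <;> rfl

@[simp] theorem steps_zero (r σ) : (zero r).steps σ = 1 := rfl
@[simp] theorem steps_incr (r σ) : (incr r).steps σ = 1 := rfl
@[simp] theorem steps_copy (r s σ) : (copy r s).steps σ = 1 := rfl
@[simp] theorem steps_store (A r s e σ) : (store A r s e).steps σ = e.cost + 1 := rfl
@[simp] theorem steps_seq (c d σ) : (seq c d).steps σ = c.steps σ + d.steps (c.output σ) := rfl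
@[simp] theorem steps_ifLe (e f c d σ) : (ifLe e f c d).steps σ =
    (if e.eval σ ≤ f.eval σ then c.steps σ else d.steps σ) + e.cost + f.cost + 1 := by
  simp only [steps, run]; split_ifs <;> rfl
@[simp] theorem steps_ifEq (r s c d) (σ : RamState) : (ifEq r s c d).steps σ =
    (if σ.reg r = σ.reg s then c.steps σ else d.steps σ) + 1 := by
  simp only [steps, run]; split_ifs <;> rfl

/-- The rule for loops with an invariant `I` that depends on the number of rounds done. -/
theorem loop_spec (I : ℕ → RamState → Prop) {c : RamProg} {r N n : ℕ} {σ : RamState}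
    (hn : σ.reg r = n) (h0 : I 0 σ)
    (hstep : ∀ k < n, ∀ τ, I k τ → I (k + 1) (c.output τ) ∧ c.steps τ ≤ N) :
    I n ((loop r c).output σ) ∧ (loop r c).steps σ ≤ n * (N + 1) + 1 := by
  set F : RamState × ℕ → RamState × ℕ := fun τ => ((c.run τ.1).1, τ.2 + (c.run τ.1).2 + 1) with hF
  have hrun : (loop r c).run σ = F^[n] (σ, 1) := by rw [← hn]; rfl
  have key : ∀ k ≤ n, I k (F^[k] (σ, 1)).1 ∧ (F^[k] (σ, 1)).2 ≤ k * (N + 1) + 1 := by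
    intro k
    induction k with
    | zero => exact fun _ => ⟨h0, by simp⟩
    | succ k ih =>
      intro hk
      obtain ⟨h1, h2⟩ := ih (by omega)
      obtain ⟨h3, h4⟩ := hstep k (by omega) _ h1
      rw [Function.iterate_succ_apply']
      refine ⟨h3, ?_⟩
      have h4' : (c.run (F^[k] (σ, 1)).1).2 ≤ N := h4
      simp only [hF] at h2 h4' ⊢
      have : (k + 1) * (N + 1) = k * (N + 1) + (N + 1) := by ring
      omega
  have := key n le_rfl
  unfold output steps
  rw [hrun]
  exact this

/-- Execution of `c` with the register `idx` running from `0` to the content of register `r`. -/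
def forLoop (idx r : ℕ) (c : RamProg) : RamProg := seq (zero idx) (loop r (seq c (incr idx)))

/-- The rule for `forLoop`. The body may use the counter `idx`, which it has to leave unchanged, and
establishes the invariant for the counter after its increment. -/
theorem forLoop_spec (I : ℕ → RamState → Prop) {c : RamProg} {idx r N n : ℕ} {σ : RamState}
    (hr : r ≠ idx) (hn : σ.reg r = n) (h0 : I 0 (σ.setReg idx 0))
    (hstep : ∀ k < n, ∀ τ, τ.reg idx = k → I k τ → (c.output τ).reg idx = k ∧
      I (k + 1) ((c.output τ).setReg idx (k + 1)) ∧ c.steps τ ≤ N) :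
    (I n ((forLoop idx r c).output σ) ∧ ((forLoop idx r c).output σ).reg idx = n) ∧
      (forLoop idx r c).steps σ ≤ n * (N + 2) + 2 := by
  have h := loop_spec (fun k τ => I k τ ∧ τ.reg idx = k) (c := seq c (incr idx)) (r := r)
    (N := N + 1) (n := n) (σ := σ.setReg idx 0) (by simp [hr, hn]) ⟨h0, by simp⟩ ?_
  · refine ⟨h.1, ?_⟩
    have e : (forLoop idx r c).steps σ = 1 + (loop r (seq c (incr idx))).steps (σ.setReg idx 0) :=
      rfl
    have := h.2
    rw [show N + 1 + 1 = N + 2 from rfl] at this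
    rw [e]
    omega
  · rintro k hk τ ⟨h1, h2⟩
    obtain ⟨h3, h4, h5⟩ := hstep k hk τ h2 h1
    refine ⟨⟨?_, ?_⟩, ?_⟩
    · rw [output_seq, output_incr, h3]; exact h4
    · simp [h3]
    · simp only [steps_seq, steps_incr]; omega

end RamProg

/-! ### A program for the decisions of Regularized Greedy -/

/- Register `5` always contains `0`: it supplies the index `0`, and `zero 5` is an instruction
without effect. The loops count types in register `6`, and offline vertices in the registers `7`
(inner loops) and `4` (candidates). Register `3` holds the code of the best candidate so far, and
its score is in the array `8`. -/

namespace RamProg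
open RamExpr

/-- The exponent `a`. -/
def expAExpr (θ : ℚ) : RamExpr := sub (const 1) (log (sub (const 1) (const θ)))

/-- `alpha`, where the time is the entry `(0, 0)` of the array `4` and the register `5` is `0`. -/
def alphaExpr (θ : ℚ) : RamExpr :=
  add (sub (const 1) (mul (div (const θ⁻¹) (sub (const θ⁻¹) (expAExpr θ)))
      (exp (sub (const 0) (mul (expAExpr θ) (sub (const 1) (cell 4 5 5)))))))
    (mul (div (expAExpr θ) (sub (const θ⁻¹) (expAExpr θ)))
      (exp (sub (const 0) (mul (const θ⁻¹) (sub (const 1) (cell 4 5 5))))))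

/-- `beta`, with the same conventions. -/
def betaExpr (θ : ℚ) : RamExpr :=
  mul (div (const 1) (sub (const θ⁻¹) (expAExpr θ)))
    (sub (exp (sub (const 0) (mul (expAExpr θ) (sub (const 1) (cell 4 5 5)))))
      (exp (sub (const 0) (mul (const θ⁻¹) (sub (const 1) (cell 4 5 5))))))

theorem eval_alphaExpr (θ : ℚ) {σ : RamState} (h : σ.reg 5 = 0) :
    (alphaExpr θ).eval σ = alpha θ (σ.mem 4 0 0) := by
  simp [alphaExpr, expAExpr, alpha, expA, eval, h]

theorem eval_betaExpr (θ : ℚ) {σ : RamState} (h : σ.reg 5 = 0) :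
    (betaExpr θ).eval σ = beta θ (σ.mem 4 0 0) := by
  simp [betaExpr, expAExpr, beta, expA, eval, h]

/-- The unmatched part of the reference solution of every type, in the array `5`. -/
def loadProg : RamProg :=
  forLoop 6 0 (forLoop 7 1
    (store 5 6 5 (add (cell 5 6 5) (mul (cell 2 6 7) (cell 3 7 5)))))

/-- Adds to the entry `(0, 0)` of the array `6` the term of the type in register `6` in the
potential after the removal of the offline vertex in register `4`. -/
def scoreTerm (θ : ℚ) : RamProg :=
  seq (store 7 5 5 (div (div (sub (cell 5 6 5) (cell 2 6 4)) (cell 1 6 5)) (const θ)))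
    (seq (ifLe (cell 7 5 5) (const 1) (zero 5) (store 7 5 5 (const 1)))
      (store 6 5 5 (add (cell 6 5 5) (add (mul (alphaExpr θ) (sub (cell 5 6 5) (cell 2 6 4)))
        (mul (betaExpr θ) (mul (cell 1 6 5) (cell 7 5 5)))))))

/-- The potential after the removal of the offline vertex in register `4`. -/
def scoreProg (θ : ℚ) : RamProg := seq (store 6 5 5 (const 0)) (forLoop 6 0 (scoreTerm θ))

/-- Makes the offline vertex in register `4` the best one so far. -/
def recordBest : RamProg := seq (store 8 5 5 (cell 6 5 5)) (seq (copy 3 4) (incr 3))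

/-- Chooses the first unmatched neighbour whose removal leaves the largest potential. -/
def decisionProg (θ : ℚ) : RamProg :=
  seq loadProg (forLoop 4 1 (ifLe (const 1) (mul (cell 0 2 4) (cell 3 4 5))
    (seq (scoreProg θ) (ifEq 3 5 recordBest (ifLe (cell 6 5 5) (cell 8 5 5) (zero 5) recordBest)))
    (zero 5)))

end RamProg

namespace TypeGraph
variable {G : TypeGraph}
open RamProg RamExpr

/-- The state agrees with the input of a decision outside the work space. -/
structure IsDecisionState (G : TypeGraph) (x : Fin G.n → Fin G.m → ℝ) (t : ℝ)
    (U : Finset (Fin G.m)) (i : Fin G.n) (σ : RamState) : Prop where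
  reg0 : σ.reg 0 = G.n
  reg1 : σ.reg 1 = G.m
  reg2 : σ.reg 2 = i
  reg5 : σ.reg 5 = 0
  mem : ∀ A < 5, σ.mem A = (G.encodeArrival x t U i).mem A

variable {x : Fin G.n → Fin G.m → ℝ} {t : ℝ} {U : Finset (Fin G.m)} {i : Fin G.n} {σ : RamState}

theorem IsDecisionState.setReg (h : G.IsDecisionState x t U i σ) {r v : ℕ} (h0 : 0 ≠ r)
    (h1 : 1 ≠ r) (h2 : 2 ≠ r) (h5 : 5 = r → v = 0) : G.IsDecisionState x t U i (σ.setReg r v) where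
  reg0 := by simp [h0, h.reg0]
  reg1 := by simp [h1, h.reg1]
  reg2 := by simp [h2, h.reg2]
  reg5 := by
    rw [RamState.setReg_reg]
    split_ifs with h'
    · exact h5 h'
    · exact h.reg5
  mem := h.mem

theorem IsDecisionState.setMem (h : G.IsDecisionState x t U i σ) {A u v : ℕ} (hA : 5 ≤ A) (y : ℝ) :
    G.IsDecisionState x t U i (σ.setMem A u v y) where
  reg0 := h.reg0
  reg1 := h.reg1
  reg2 := h.reg2
  reg5 := h.reg5
  mem B hB := by
    rw [← h.mem B hB]
    funext u' v'
    have : B ≠ A := by omega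
    simp [this]

variable (G x t U i)

/-- The unmatched part of the reference solution at the type `u`. -/
def inputLoad (u k : ℕ) : ℝ := ∑ j ∈ Finset.range k,
  (G.encodeArrival x t U i).mem 2 u j * (G.encodeArrival x t U i).mem 3 j 0

/-- The term of type `u` in the potential after the removal of `j`. -/
def inputTerm (θ : ℝ) (j u : ℕ) : ℝ :=
  alpha θ t * (G.inputLoad x t U i u G.m - (G.encodeArrival x t U i).mem 2 u j) +
    beta θ t * ((G.encodeArrival x t U i).mem 1 u 0 *
      min ((G.inputLoad x t U i u G.m - (G.encodeArrival x t U i).mem 2 u j) /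
        (G.encodeArrival x t U i).mem 1 u 0 / θ) 1)

/-- The potential after the removal of `j`. -/
def inputScore (θ : ℝ) (j k : ℕ) : ℝ := ∑ u ∈ Finset.range k, G.inputTerm x t U i θ j u

variable {G x t U i}

/-- The sums `∑ x i j` over the unmatched neighbours `j` of each type `i` are computed once, before
the candidates are compared. -/
theorem loadProg_spec (h : G.IsDecisionState x t U i σ) (h5 : ∀ u v, σ.mem 5 u v = 0) :
    G.IsDecisionState x t U i (loadProg.output σ) ∧ (loadProg.output σ).reg 3 = σ.reg 3 ∧
      (∀ u < G.n, (loadProg.output σ).mem 5 u 0 = G.inputLoad x t U i u G.m) ∧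
      loadProg.steps σ ≤ G.n * (G.m * 8 + 4) + 2 := by
  have hbody : ∀ u < G.n, ∀ τ : RamState, τ.reg 6 = u →
      (G.IsDecisionState x t U i τ ∧ τ.reg 3 = σ.reg 3 ∧ ∀ u', τ.mem 5 u' 0 =
        if u' < u then G.inputLoad x t U i u' G.m else 0) →
      let c := forLoop 7 1 (store 5 6 5 (add (cell 5 6 5) (mul (cell 2 6 7) (cell 3 7 5))))
      (G.IsDecisionState x t U i (c.output τ) ∧ (c.output τ).reg 3 = σ.reg 3 ∧
        (c.output τ).reg 6 = u ∧ ∀ u', (c.output τ).mem 5 u' 0 =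
        if u' < u + 1 then G.inputLoad x t U i u' G.m else 0) ∧ c.steps τ ≤ G.m * (6 + 2) + 2 := by
    rintro u hu τ h6 ⟨hτ, h3, h5⟩ c
    have := forLoop_spec (σ := τ) (idx := 7) (r := 1) (N := 6) (n := G.m)
      (c := store 5 6 5 (add (cell 5 6 5) (mul (cell 2 6 7) (cell 3 7 5))))
      (fun k ω => G.IsDecisionState x t U i ω ∧ ω.reg 3 = σ.reg 3 ∧ ω.reg 6 = u ∧
        ∀ u', ω.mem 5 u' 0 = if u' < u then G.inputLoad x t U i u' G.m else
          if u' = u then G.inputLoad x t U i u k else 0) (by norm_num) hτ.reg1 ?_ ?_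
    · refine ⟨⟨this.1.1.1, this.1.1.2.1, this.1.1.2.2.1, fun u' => ?_⟩, this.2⟩
      rw [this.1.1.2.2.2 u']
      rcases lt_trichotomy u' u with h | h | h
      · simp [h, Nat.lt_succ_of_lt h]
      · simp [h]
      · simp [h.not_gt, h.ne', show ¬ u' < u + 1 by omega]
    · refine ⟨hτ.setReg (by norm_num) (by norm_num) (by norm_num) (by norm_num), by simpa using h3,
        by simpa using h6, fun u' => ?_⟩
      rw [RamState.setReg_mem, h5 u']
      simp [inputLoad]
    · rintro k hk ω h7 ⟨hω, h3, h6, h5⟩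
      refine ⟨by simpa using h7, ⟨(hω.setMem (by norm_num) _).setReg (by norm_num) (by norm_num)
        (by norm_num) (by norm_num), by simpa using h3, by simpa using h6, fun u' => ?_⟩, by
          simp [cost]⟩
      rw [RamState.setReg_mem, output_store, RamState.setMem_mem, h6, hω.reg5]
      simp only [true_and, and_true]
      by_cases hu' : u' = u
      · subst hu'
        simp only [if_true, eval, h6, hω.reg5, h7, h5 u', lt_irrefl, if_false]
        rw [hω.mem 2 (by norm_num), hω.mem 3 (by norm_num), inputLoad, inputLoad,
          Finset.sum_range_succ]
      · simp [hu', h5 u']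
  have := forLoop_spec (σ := σ) (idx := 6) (r := 0) (N := G.m * (6 + 2) + 2) (n := G.n)
    (c := forLoop 7 1 (store 5 6 5 (add (cell 5 6 5) (mul (cell 2 6 7) (cell 3 7 5)))))
    (fun u τ => G.IsDecisionState x t U i τ ∧ τ.reg 3 = σ.reg 3 ∧ ∀ u', τ.mem 5 u' 0 =
        if u' < u then G.inputLoad x t U i u' G.m else 0) (by norm_num) h.reg0 ?_ ?_
  · refine ⟨this.1.1.1, this.1.1.2.1, fun u hu => ?_, this.2⟩
    rw [loadProg, this.1.1.2.2 u, if_pos hu]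
  · exact ⟨h.setReg (by norm_num) (by norm_num) (by norm_num) (by norm_num), by simp,
      fun u' => by simp [h5]⟩
  · intro u hu τ h6 hI
    obtain ⟨⟨h1, h2, h3, h4⟩, h5⟩ := hbody u hu τ h6 hI
    exact ⟨h3, ⟨h1.setReg (by norm_num) (by norm_num) (by norm_num) (by norm_num),
      by simpa using h2,
      fun u' => by rw [RamState.setReg_mem, h4]⟩, h5⟩

/-- The score of a candidate is computed in a number of steps linear in the number of types. -/
theorem scoreProg_spec (θ : ℚ) {j : ℕ} (h : G.IsDecisionState x t U i σ)
    (h5 : ∀ u < G.n, σ.mem 5 u 0 = G.inputLoad x t U i u G.m) (h4 : σ.reg 4 = j) :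
    let τ := (scoreProg θ).output σ
    G.IsDecisionState x t U i τ ∧ τ.reg 3 = σ.reg 3 ∧ τ.reg 4 = j ∧
      (∀ u < G.n, τ.mem 5 u 0 = G.inputLoad x t U i u G.m) ∧ τ.mem 8 0 0 = σ.mem 8 0 0 ∧
      τ.mem 6 0 0 = G.inputScore x t U i θ j G.n ∧ (scoreProg θ).steps σ ≤ G.n * 122 + 4 := by
  have := forLoop_spec (σ := σ.setMem 6 0 0 0) (idx := 6) (r := 0) (N := 120) (n := G.n)
    (c := scoreTerm θ)
    (fun k τ => G.IsDecisionState x t U i τ ∧ τ.reg 3 = σ.reg 3 ∧ τ.reg 4 = j ∧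
      (∀ u < G.n, τ.mem 5 u 0 = G.inputLoad x t U i u G.m) ∧ τ.mem 8 0 0 = σ.mem 8 0 0 ∧
      τ.mem 6 0 0 = G.inputScore x t U i θ j k) (by norm_num) h.reg0 ?_ ?_
  · have e : (scoreProg θ).output σ = (forLoop 6 0 (scoreTerm θ)).output (σ.setMem 6 0 0 0) := by
      simp [scoreProg, h.reg5, eval]
    have e2 : (scoreProg θ).steps σ = 2 + (forLoop 6 0 (scoreTerm θ)).steps (σ.setMem 6 0 0 0) := by
      simp [scoreProg, h.reg5, eval, cost]
    obtain ⟨⟨⟨h1, h2, h3, h4, h6, h7⟩, _⟩, h8⟩ := this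
    simp only
    rw [e, e2]
    exact ⟨h1, h2, h3, h4, h6, h7, by omega⟩
  · refine ⟨(h.setMem (by norm_num) _).setReg (by norm_num) (by norm_num) (by norm_num)
      (by norm_num), by simp, by simpa using h4, fun u hu => ?_, by simp, by simp [inputScore]⟩
    simpa using h5 u hu
  · rintro u hu τ h6 ⟨hτ, h3, h4, h5, h8, hs⟩
    have hr5 := hτ.reg5
    have ht : τ.mem 4 0 0 = t := by
      rw [hτ.mem 4 (by norm_num)]; simp [encodeArrival, vecCells]
    -- The state before the last instruction of the loop body.
    set c := min ((G.inputLoad x t U i u G.m - (G.encodeArrival x t U i).mem 2 u j) /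
        (G.encodeArrival x t U i).mem 1 u 0 / θ) 1 with hc
    obtain ⟨ν, hν, hν3, hν4, hν6, hν5, hν8, hν6', hν7, hout, hsteps⟩ : ∃ ν : RamState,
        G.IsDecisionState x t U i ν ∧ ν.reg 3 = σ.reg 3 ∧ ν.reg 4 = j ∧ ν.reg 6 = u ∧
        (∀ u < G.n, ν.mem 5 u 0 = G.inputLoad x t U i u G.m) ∧ ν.mem 8 0 0 = σ.mem 8 0 0 ∧
        ν.mem 6 0 0 = G.inputScore x t U i θ j u ∧ ν.mem 7 0 0 = c ∧
        (scoreTerm θ).output τ = (store 6 5 5 (add (cell 6 5 5)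
          (add (mul (alphaExpr θ) (sub (cell 5 6 5) (cell 2 6 4)))
          (mul (betaExpr θ) (mul (cell 1 6 5) (cell 7 5 5)))))).output ν ∧
        (scoreTerm θ).steps τ ≤ 120 := by
      set y := (G.inputLoad x t U i u G.m - (G.encodeArrival x t U i).mem 2 u j) /
        (G.encodeArrival x t U i).mem 1 u 0 / θ with hy
      have hy' : eval τ (div (div (sub (cell 5 6 5) (cell 2 6 4)) (cell 1 6 5)) (const θ)) = y := by
        simp only [eval, h6, hr5, h4, h5 u hu]
        rw [hτ.mem 2 (by norm_num), hτ.mem 1 (by norm_num)]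
      have hw : (store 7 5 5 (div (div (sub (cell 5 6 5) (cell 2 6 4)) (cell 1 6 5))
          (const θ))).output τ = τ.setMem 7 0 0 y := by rw [output_store, hr5, hy']
      by_cases hle : y ≤ 1
      · refine ⟨(τ.setMem 7 0 0 y).setReg 5 0, (hτ.setMem (by norm_num) _).setReg (by norm_num)
          (by norm_num) (by norm_num) (by norm_num), by simpa using h3, by simpa using h4,
          by simpa using h6, fun u hu => by simpa using h5 u hu, by simpa using h8,
          by simpa using hs, ?_, ?_, ?_⟩
        · simp [hc, hle]
        · rw [scoreTerm, output_seq, output_seq, hw]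
          simp [eval, hr5, hle]
        · rw [scoreTerm, steps_seq, steps_seq, hw]
          simp [eval, hr5, hle, cost, alphaExpr, betaExpr, expAExpr]
      · refine ⟨(τ.setMem 7 0 0 y).setMem 7 0 0 1, (hτ.setMem (by norm_num) _).setMem (by norm_num)
          _, by simpa using h3, by simpa using h4,
          by simpa using h6, fun u hu => by simpa using h5 u hu, by simpa using h8,
          by simpa using hs, ?_, ?_, ?_⟩
        · simp [hc, (not_le.mp hle).le]
        · rw [scoreTerm, output_seq, output_seq, hw]
          simp [eval, hr5, hle]
        · rw [scoreTerm, steps_seq, steps_seq, hw]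
          simp [eval, hr5, hle, cost, alphaExpr, betaExpr, expAExpr]
    have hνt : ν.mem 4 0 0 = t := by
      rw [hν.mem 4 (by norm_num)]; simp [encodeArrival, vecCells]
    rw [hout]
    refine ⟨by simpa using hν6, ⟨(hν.setMem (by norm_num) _).setReg (by norm_num) (by norm_num)
      (by norm_num) (by norm_num), by simpa using hν3, by simpa using hν4,
      fun u hu => by simpa using hν5 u hu, by simpa using hν8, ?_⟩, hsteps⟩
    rw [RamState.setReg_mem, output_store, hν.reg5, RamState.setMem_mem, if_pos ⟨rfl, rfl, rfl⟩]
    simp only [eval, eval_alphaExpr θ hν.reg5, eval_betaExpr θ hν.reg5, hν.reg5, hν4, hν6,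
      hν5 u hu, hν6', hν7, hνt]
    rw [hν.mem 2 (by norm_num), hν.mem 1 (by norm_num), inputScore, inputScore,
      Finset.sum_range_succ, inputTerm]

end TypeGraph

/-- `r` encodes the first maximizer of `s` among the `j < k` that satisfy `c`: it is `j + 1` for the
maximizer `j`, and `0` if there is none. -/
def IsFirstMax (c : ℕ → Prop) (s : ℕ → ℝ) (k r : ℕ) : Prop :=
  (r = 0 ∧ ∀ j < k, ¬ c j) ∨ ∃ j < k, r = j + 1 ∧ c j ∧ (∀ j' < k, c j' → s j' ≤ s j) ∧
    ∀ j' < j, c j' → s j' < s j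

theorem IsFirstMax.skip {c : ℕ → Prop} {s : ℕ → ℝ} {k r : ℕ} (h : IsFirstMax c s k r)
    (hk : ¬ c k ∨ ∃ j, r = j + 1 ∧ s k ≤ s j) : IsFirstMax c s (k + 1) r := by
  rcases h with ⟨h1, h2⟩ | ⟨j, h1, h2, h3, h4, h5⟩
  · refine Or.inl ⟨h1, fun j hj => ?_⟩
    rcases Nat.lt_succ_iff_lt_or_eq.mp hj with h | rfl
    · exact h2 j h
    · rcases hk with hk | ⟨j', hk, _⟩
      · exact hk
      · omega
  · refine Or.inr ⟨j, by omega, h2, h3, fun j' hj' hc => ?_, h5⟩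
    rcases Nat.lt_succ_iff_lt_or_eq.mp hj' with h | rfl
    · exact h4 j' h hc
    · rcases hk with hk | ⟨j'', hk, h⟩
      · exact absurd hc hk
      · rwa [show j = j'' by omega]

theorem IsFirstMax.record {c : ℕ → Prop} {s : ℕ → ℝ} {k r : ℕ} (h : IsFirstMax c s k r)
    (hk : c k) (hr : ∀ j, r = j + 1 → s j < s k) : IsFirstMax c s (k + 1) (k + 1) := by
  have key : ∀ j < k, c j → s j < s k := by
    rcases h with ⟨h1, h2⟩ | ⟨j, h1, h2, h3, h4, h5⟩
    · exact fun j hj hc => absurd hc (h2 j hj)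
    · exact fun j' hj' hc => (h4 j' hj' hc).trans_lt (hr j h2)
  refine Or.inr ⟨k, by omega, rfl, hk, fun j' hj' hc => ?_, key⟩
  rcases Nat.lt_succ_iff_lt_or_eq.mp hj' with h | rfl
  · exact (key j' h hc).le
  · exact le_rfl

namespace TypeGraph
variable {G : TypeGraph}
open RamProg RamExpr

variable {x : Fin G.n → Fin G.m → ℝ} {t : ℝ} {U : Finset (Fin G.m)} {i : Fin G.n} {σ : RamState}

/-- `j` is the number of an unmatched neighbour of the type `i`. -/
def IsCandidate (G : TypeGraph) (U : Finset (Fin G.m)) (i : Fin G.n) (j : ℕ) : Prop :=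
  ∃ h : j < G.m, ⟨j, h⟩ ∈ G.nbr i ∩ U

theorem one_le_mul_iff_isCandidate (h : G.IsDecisionState x t U i σ) (j : ℕ) :
    1 ≤ σ.mem 0 i j * σ.mem 3 j 0 ↔ G.IsCandidate U i j := by
  rw [h.mem 0 (by norm_num), h.mem 3 (by norm_num)]
  by_cases hj : j < G.m
  · by_cases h1 : G.adj i ⟨j, hj⟩ <;> by_cases h2 : (⟨j, hj⟩ : Fin G.m) ∈ U <;>
      simp [encodeArrival, encode, matCells, vecCells, IsCandidate, hj, h1, h2, nbr]
  · simp [encodeArrival, vecCells, IsCandidate, hj]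

theorem inputLoad_eq (u : Fin G.n) :
    G.inputLoad x t U i u G.m = ∑ j ∈ U, G.edgeValue x u j := by
  rw [inputLoad, ← Fin.sum_univ_eq_sum_range (fun j =>
    (G.encodeArrival x t U i).mem 2 u j * (G.encodeArrival x t U i).mem 3 j 0),
    ← Finset.univ_inter U, ← Finset.sum_ite_mem]
  refine Finset.sum_congr rfl fun j _ => ?_
  simp [encodeArrival, matCells, vecCells, edgeValue]

theorem inputScore_eq (θ : ℝ) {j : Fin G.m} (hj : j ∈ U) :
    G.inputScore x t U i θ j G.n = G.potential θ x t (U.erase j) := by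
  rw [inputScore, ← Fin.sum_univ_eq_sum_range (fun u => G.inputTerm x t U i θ j u), potential,
    Finset.mul_sum, Finset.mul_sum, ← Finset.sum_add_distrib]
  refine Finset.sum_congr rfl fun u _ => ?_
  have e1 : (G.encodeArrival x t U i).mem 2 u j = G.edgeValue x u j := by
    simp [encodeArrival, matCells, edgeValue]
  have e2 : (G.encodeArrival x t U i).mem 1 u 0 = G.rate u := by
    simp [encodeArrival, encode, vecCells]
  have e3 : ∑ j' ∈ U, G.edgeValue x u j' - G.edgeValue x u j =
      ∑ j' ∈ U.erase j, G.edgeValue x u j' := by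
    rw [← Finset.add_sum_erase _ _ hj]; ring
  rw [inputTerm, inputLoad_eq, e1, e2, e3, rate_mul_rho, capped, rho_eq]

/-- The smallest decrease of the potential is the largest remaining potential, and the minimum of
the set of best neighbours is the first maximizer. -/
theorem decisionCode_regGreedy (θ : ℝ) {r : ℕ} (h : IsFirstMax (G.IsCandidate U i)
    (fun j => G.inputScore x t U i θ j G.n) G.m r) :
    r = G.decisionCode (G.regGreedy θ x t U i) := by
  rcases h with ⟨h1, h2⟩ | ⟨j, h1, h2, ⟨h3, h3'⟩, h4, h5⟩
  · cases hg : G.regGreedy θ x t U i with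
    | none => exact h1
    | some j =>
      exact absurd ⟨j.2, (Finset.mem_filter.mp (regGreedy_eq_some hg)).1⟩ (h2 j j.2)
  · have hdec : ∀ k ∈ G.nbr i ∩ U, G.decrease θ x t U k =
        G.potential θ x t U - G.inputScore x t U i θ k G.n := fun k hk => by
      rw [decrease, inputScore_eq θ (Finset.mem_inter.mp hk).2]
    have hmem : (⟨j, h1⟩ : Fin G.m) ∈ G.bestNeighbours θ x t U i := by
      refine Finset.mem_filter.mpr ⟨h3', fun k hk => ?_⟩
      rw [hdec _ h3', hdec _ hk]
      have := h4 k k.2 ⟨k.2, hk⟩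
      simp only at this ⊢
      linarith
    have hne : (G.bestNeighbours θ x t U i).Nonempty := ⟨_, hmem⟩
    have hmin : (G.bestNeighbours θ x t U i).min' hne = ⟨j, h1⟩ := by
      refine le_antisymm (Finset.min'_le _ _ hmem) (Finset.le_min' _ _ _ fun k hk => ?_)
      obtain ⟨hk1, hk2⟩ := Finset.mem_filter.mp hk
      by_contra hlt
      have h6 := h5 k (not_le.mp hlt) ⟨k.2, hk1⟩
      have h7 := hk2 _ h3'
      rw [hdec _ h3', hdec _ hk1] at h7
      simp only at h6 h7
      linarith
    rw [regGreedy, dif_pos hne, hmin]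
    exact h2

theorem decisionProg_spec (θ : ℚ) :
    ((decisionProg θ).output (G.encodeArrival x t U i)).reg 3 =
      G.decisionCode (G.regGreedy θ x t U i) ∧
    (decisionProg θ).steps (G.encodeArrival x t U i) ≤
      (G.n * (G.m * 8 + 4) + 2) + (G.m * (G.n * 122 + 22) + 2) := by
  have h0 : G.IsDecisionState x t U i (G.encodeArrival x t U i) :=
    ⟨by simp [encodeArrival, encode], by simp [encodeArrival, encode], by simp [encodeArrival],
      by simp [encodeArrival, encode], fun _ _ => rfl⟩
  obtain ⟨h1, h2, h3, h4⟩ := loadProg_spec h0 (fun u v => by simp [encodeArrival, encode])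
  have h2' : (loadProg.output (G.encodeArrival x t U i)).reg 3 = 0 := by
    rw [h2]; simp [encodeArrival, encode]
  have := forLoop_spec (σ := loadProg.output (G.encodeArrival x t U i)) (idx := 4) (r := 1)
    (N := G.n * 122 + 20) (n := G.m)
    (c := ifLe (const 1) (mul (cell 0 2 4) (cell 3 4 5))
    (seq (scoreProg θ) (ifEq 3 5 recordBest (ifLe (cell 6 5 5) (cell 8 5 5) (zero 5) recordBest)))
    (zero 5))
    (fun k τ => G.IsDecisionState x t U i τ ∧
      (∀ u < G.n, τ.mem 5 u 0 = G.inputLoad x t U i u G.m) ∧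
      (∀ j, τ.reg 3 = j + 1 → τ.mem 8 0 0 = G.inputScore x t U i θ j G.n) ∧
      IsFirstMax (G.IsCandidate U i) (fun j => G.inputScore x t U i θ j G.n) k (τ.reg 3))
    (by norm_num) h1.reg1 ?_ ?_
  · obtain ⟨⟨⟨_, _, _, h5⟩, _⟩, h6⟩ := this
    rw [decisionProg, output_seq, steps_seq]
    exact ⟨decisionCode_regGreedy _ h5, Nat.add_le_add h4 h6⟩
  · refine ⟨h1.setReg (by norm_num) (by norm_num) (by norm_num) (by norm_num),
      fun u hu => by simpa using h3 u hu, fun j hj => ?_, Or.inl ⟨by simpa using h2', by simp⟩⟩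
    simp [h2'] at hj
  · rintro k hk τ h4 ⟨hτ, h5, h8, hm⟩
    have hcond : (const 1).eval τ ≤ (mul (cell 0 2 4) (cell 3 4 5)).eval τ ↔
        G.IsCandidate U i k := by
      rw [← one_le_mul_iff_isCandidate hτ]
      simp [eval, hτ.reg2, hτ.reg5, h4]
    -- The candidate `k` is passed over.
    have hskip : ∀ ν : RamState, G.IsDecisionState x t U i ν → ν.reg 3 = τ.reg 3 → ν.reg 4 = k →
        (∀ u < G.n, ν.mem 5 u 0 = G.inputLoad x t U i u G.m) → ν.mem 8 0 0 = τ.mem 8 0 0 →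
        (¬ G.IsCandidate U i k ∨ ∃ j, τ.reg 3 = j + 1 ∧
          G.inputScore x t U i θ k G.n ≤ G.inputScore x t U i θ j G.n) →
        ((zero 5).output ν).reg 4 = k ∧
        G.IsDecisionState x t U i (((zero 5).output ν).setReg 4 (k + 1)) ∧
        (∀ u < G.n, (((zero 5).output ν).setReg 4 (k + 1)).mem 5 u 0 =
          G.inputLoad x t U i u G.m) ∧
        (∀ j, (((zero 5).output ν).setReg 4 (k + 1)).reg 3 = j + 1 →
          (((zero 5).output ν).setReg 4 (k + 1)).mem 8 0 0 = G.inputScore x t U i θ j G.n) ∧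
        IsFirstMax (G.IsCandidate U i) (fun j => G.inputScore x t U i θ j G.n) (k + 1)
          ((((zero 5).output ν).setReg 4 (k + 1)).reg 3) := by
      intro ν hν hν3 hν4 hν5 hν8 hc
      refine ⟨by simpa using hν4, (hν.setReg (by norm_num) (by norm_num) (by norm_num)
        (by norm_num)).setReg (by norm_num) (by norm_num) (by norm_num) (by norm_num),
        fun u hu => by simpa using hν5 u hu, fun j hj => ?_, ?_⟩
      · simp only [output_zero, RamState.setReg_mem]
        rw [hν8]
        exact h8 j (by simpa [hν3] using hj)
      · simpa [hν3] using hm.skip hc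
    -- The candidate `k` becomes the best one so far.
    have hrec : ∀ ν : RamState, G.IsDecisionState x t U i ν → ν.reg 4 = k →
        (∀ u < G.n, ν.mem 5 u 0 = G.inputLoad x t U i u G.m) →
        ν.mem 6 0 0 = G.inputScore x t U i θ k G.n → G.IsCandidate U i k →
        (∀ j, τ.reg 3 = j + 1 → G.inputScore x t U i θ j G.n < G.inputScore x t U i θ k G.n) →
        (recordBest.output ν).reg 4 = k ∧
        G.IsDecisionState x t U i ((recordBest.output ν).setReg 4 (k + 1)) ∧
        (∀ u < G.n, ((recordBest.output ν).setReg 4 (k + 1)).mem 5 u 0 =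
          G.inputLoad x t U i u G.m) ∧
        (∀ j, ((recordBest.output ν).setReg 4 (k + 1)).reg 3 = j + 1 →
          ((recordBest.output ν).setReg 4 (k + 1)).mem 8 0 0 = G.inputScore x t U i θ j G.n) ∧
        IsFirstMax (G.IsCandidate U i) (fun j => G.inputScore x t U i θ j G.n) (k + 1)
          (((recordBest.output ν).setReg 4 (k + 1)).reg 3) := by
      intro ν hν hν4 hν5 hν6 hc hlt
      have e : recordBest.output ν =
          ((ν.setMem 8 0 0 (ν.mem 6 0 0)).setReg 3 k).setReg 3 (k + 1) := by
        simp [recordBest, eval, hν.reg5, hν4]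
      rw [e]
      refine ⟨by simpa using hν4, (((hν.setMem (by norm_num) _).setReg (by norm_num) (by norm_num)
        (by norm_num) (by norm_num)).setReg (by norm_num) (by norm_num) (by norm_num)
        (by norm_num)).setReg (by norm_num) (by norm_num) (by norm_num) (by norm_num),
        fun u hu => by simpa using hν5 u hu, fun j hj => ?_, ?_⟩
      · obtain rfl : k = j := by simpa using hj
        simpa using hν6
      · simpa using hm.record hc hlt
    by_cases hc : G.IsCandidate U i k
    · obtain ⟨s1, s2, s3, s4, s5, s6, s7⟩ := scoreProg_spec θ hτ h5 h4
      rw [output_ifLe, steps_ifLe, if_pos (hcond.mpr hc), if_pos (hcond.mpr hc), output_seq,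
        steps_seq]
      generalize (scoreProg θ).output τ = ν at *
      have hrs : recordBest.steps ν = 4 := by simp [recordBest, cost]
      rw [output_ifEq, steps_ifEq, output_ifLe, steps_ifLe]
      have hle : (cell 6 5 5).eval ν ≤ (cell 8 5 5).eval ν ↔
          G.inputScore x t U i θ k G.n ≤ τ.mem 8 0 0 := by
        simp [eval, s1.reg5, s5, s6]
      by_cases hr : ν.reg 3 = ν.reg 5
      · rw [if_pos hr, if_pos hr]
        have hz : τ.reg 3 = 0 := by rw [← s2, hr, s1.reg5]
        obtain ⟨r1, r2⟩ := hrec ν s1 s3 s4 s6 hc (fun j hj => by omega)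
        exact ⟨r1, r2, by simp only [hrs, cost]; omega⟩
      · rw [if_neg hr, if_neg hr]
        rw [s2, s1.reg5] at hr
        obtain ⟨j, hj⟩ := Nat.exists_eq_succ_of_ne_zero hr
        have hj8 := h8 j hj
        by_cases hs : (cell 6 5 5).eval ν ≤ (cell 8 5 5).eval ν
        · rw [if_pos hs, if_pos hs]
          obtain ⟨r1, r2⟩ := hskip ν s1 s2 s3 s4 s5 (Or.inr ⟨j, hj, by rw [← hj8]; exact hle.mp hs⟩)
          exact ⟨r1, r2, by simp only [steps_zero, cost]; omega⟩
        · rw [if_neg hs, if_neg hs]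
          rw [hle, not_le, hj8] at hs
          obtain ⟨r1, r2⟩ := hrec ν s1 s3 s4 s6 hc (fun j' hj' => by
            rwa [show j' = j by omega])
          exact ⟨r1, r2, by simp only [hrs, cost]; omega⟩
    · rw [output_ifLe, steps_ifLe, if_neg (fun h => hc (hcond.mp h)),
        if_neg (fun h => hc (hcond.mp h))]
      obtain ⟨r1, r2⟩ := hskip τ hτ rfl h4 h5 rfl (Or.inl hc)
      exact ⟨r1, r2, by simp only [steps_zero, cost]; omega⟩

end TypeGraph

theorem polyTimeDecisions (θ : ℚ) : PolyTimeDecisions θ := by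
  refine ⟨RamProg.decisionProg θ, 200, 2, fun G x t U i => ?_⟩
  obtain ⟨h1, h2⟩ := TypeGraph.decisionProg_spec (G := G) (x := x) (t := t) (U := U) (i := i) θ
  refine ⟨h1, h2.trans ?_⟩
  nlinarith [Nat.zero_le (G.n * G.m), Nat.zero_le G.n, Nat.zero_le G.m, Nat.zero_le (G.n ^ 2),
    Nat.zero_le (G.m ^ 2)]

/-! ### Piecewise linear approximation of the offline capacities -/

/-- The weight of the `k`-th layer, `min Λ ((k + 1) h)`, in the piecewise linear interpolation of
`1 - exp (-Λ)` in the nodes `0, h, …, K h`, which is constant from `K h` on. It is the drop of the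
slope at the node `(k + 1) h`. -/
def layerWeight (h : ℝ) (K k : ℕ) : ℝ :=
  if k + 1 = K then Real.exp (-(k * h)) * ((1 - Real.exp (-h)) / h)
  else Real.exp (-(k * h)) * ((1 - Real.exp (-h)) * ((1 - Real.exp (-h)) / h))

/-- The piecewise linear interpolation of `1 - exp (-Λ)` as a combination of `K` layers. -/
def layered (h : ℝ) (K : ℕ) (Λ : ℝ) : ℝ :=
  ∑ k ∈ Finset.range K, layerWeight h K k * min Λ ((k + 1) * h)

theorem layerWeight_pos {h : ℝ} (h0 : 0 < h) (K k : ℕ) : 0 < layerWeight h K k := by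
  have : 0 < 1 - Real.exp (-h) := by
    have : Real.exp (-h) < Real.exp 0 := Real.exp_lt_exp.mpr (by linarith)
    rw [Real.exp_zero] at this
    linarith
  unfold layerWeight
  split_ifs <;> positivity

theorem layerWeight_succ_succ (h : ℝ) (K k : ℕ) :
    layerWeight h (K + 1) (k + 1) = Real.exp (-h) * layerWeight h K k := by
  have : Real.exp (-(((k + 1 : ℕ) : ℝ) * h)) = Real.exp (-h) * Real.exp (-(k * h)) := by
    rw [← Real.exp_add]; congr 1; push_cast; ring
  unfold layerWeight
  simp only [this, Nat.add_right_cancel_iff]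
  split_ifs <;> ring

theorem sum_layerWeight (h : ℝ) (K : ℕ) :
    ∑ k ∈ Finset.range (K + 1), layerWeight h (K + 1) k = (1 - Real.exp (-h)) / h := by
  induction K with
  | zero => simp [layerWeight]
  | succ K ih =>
    rw [Finset.sum_range_succ']
    simp only [layerWeight_succ_succ, ← Finset.mul_sum, ih]
    simp [layerWeight]
    ring

theorem layered_succ_of_le {h Λ : ℝ} (h0 : 0 < h) (hΛ : Λ ≤ h) (K : ℕ) :
    layered h (K + 1) Λ = (1 - Real.exp (-h)) / h * Λ := by
  rw [layered, ← sum_layerWeight h K, Finset.sum_mul]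
  refine Finset.sum_congr rfl fun k _ => ?_
  rw [min_eq_left]
  have : 0 ≤ (k : ℝ) * h := by positivity
  linarith

/-- Beyond the first node, the interpolation satisfies the functional equation of `1 - exp (-Λ)`
with respect to the shift by `h`, which allows induction on the number of layers. -/
theorem layered_succ_of_ge {h Λ : ℝ} (h0 : 0 < h) (hΛ : h ≤ Λ) (K : ℕ) :
    layered h (K + 2) Λ = 1 - Real.exp (-h) + Real.exp (-h) * layered h (K + 1) (Λ - h) := by
  have e : ∀ k : ℕ, min Λ (((k + 1 : ℕ) + 1 : ℝ) * h) = h + min (Λ - h) ((k + 1) * h) := fun k => by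
    rw [← min_add_add_left]; push_cast; ring_nf
  rw [layered, Finset.sum_range_succ']
  simp only [layerWeight_succ_succ, e, mul_add (Real.exp (-h) * _), Finset.sum_add_distrib]
  simp only [← Finset.sum_mul, ← Finset.mul_sum, sum_layerWeight, mul_assoc (Real.exp (-h))]
  rw [← layered]
  simp only [layerWeight]
  rw [if_neg (by omega)]
  simp [hΛ]
  field_simp
  ring

theorem one_sub_le_div {h : ℝ} (h0 : 0 < h) : 1 - h ≤ (1 - Real.exp (-h)) / h := by
  rw [le_div_iff₀ h0]
  have h1 : Real.exp (-h) * (1 + h) ≤ 1 := by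
    rw [Real.exp_neg, inv_mul_le_one₀ (Real.exp_pos _)]
    linarith [Real.add_one_le_exp h]
  have h2 := (Real.exp_pos (-h)).le
  nlinarith [mul_nonneg h2 h0.le, mul_nonneg (mul_nonneg h0.le h0.le) h2]

/-- On the first piece, the chord lies below the concave function `1 - exp (-Λ)`. -/
theorem chord_le {h Λ : ℝ} (h0 : 0 < h) (hΛ0 : 0 ≤ Λ) (hΛ : Λ ≤ h) :
    (1 - Real.exp (-h)) / h * Λ ≤ 1 - Real.exp (-Λ) := by
  have := convexOn_exp.2 (Set.mem_univ (-h)) (Set.mem_univ (0 : ℝ))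
    (show 0 ≤ Λ / h by positivity) (show 0 ≤ 1 - Λ / h by rw [sub_nonneg, div_le_one h0]; exact hΛ)
      (by ring)
  simp only [smul_eq_mul, mul_neg, div_mul_cancel₀ _ h0.ne', mul_zero, add_zero, Real.exp_zero,
    mul_one] at this
  have e : (1 - Real.exp (-h)) / h * Λ = Λ / h - Λ / h * Real.exp (-h) := by ring
  rw [e]
  linarith

theorem layered_le {h : ℝ} (h0 : 0 < h) (K : ℕ) {Λ : ℝ} (hΛ : 0 ≤ Λ) :
    layered h K Λ ≤ 1 - Real.exp (-Λ) := by
  have key : ∀ K : ℕ, ∀ Λ : ℝ, 0 ≤ Λ → layered h (K + 1) Λ ≤ 1 - Real.exp (-Λ) := by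
    intro K
    induction K with
    | zero =>
      intro Λ hΛ
      rcases le_total Λ h with h1 | h1
      · rw [layered_succ_of_le h0 h1]
        exact chord_le h0 hΛ h1
      · have : Real.exp (-Λ) ≤ Real.exp (-h) := Real.exp_le_exp.mpr (by linarith)
        simp [layered, layerWeight, h1, h0.ne']
        linarith
    | succ K ih =>
      intro Λ hΛ
      rcases le_total Λ h with h1 | h1
      · rw [layered_succ_of_le h0 h1]
        exact chord_le h0 hΛ h1
      · rw [layered_succ_of_ge h0 h1]
        have := mul_le_mul_of_nonneg_left (ih (Λ - h) (by linarith)) (Real.exp_pos (-h)).le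
        have e : Real.exp (-Λ) = Real.exp (-h) * Real.exp (-(Λ - h)) := by
          rw [← Real.exp_add]; congr 1; ring
        rw [e]
        linarith
  cases K with
  | zero =>
    have : Real.exp (-Λ) ≤ 1 := Real.exp_le_one_iff.mpr (by linarith)
    simpa [layered] using hΛ
  | succ K => exact key K Λ hΛ

/-- On the first piece the interpolation has slope at least `1 - h`; the other pieces follow by the
shift by `h`, and beyond the last node the interpolation keeps its value there. -/
theorem mul_min_le_layered {h : ℝ} (h0 : 0 < h) (h1 : h ≤ 1) (K : ℕ) {Λ : ℝ} (hΛ : 0 ≤ Λ) :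
    (1 - h) * min (1 - Real.exp (-Λ)) (1 - Real.exp (-((K + 1 : ℕ) * h))) ≤
      layered h (K + 1) Λ := by
  have small : ∀ Λ : ℝ, ∀ b : ℝ, 0 ≤ Λ →
      (1 - h) * min (1 - Real.exp (-Λ)) b ≤ (1 - Real.exp (-h)) / h * Λ := by
    intro Λ b hΛ
    have e1 : min (1 - Real.exp (-Λ)) b ≤ Λ :=
      (min_le_left _ _).trans (by linarith [Real.add_one_le_exp (-Λ)])
    exact (mul_le_mul_of_nonneg_left e1 (by linarith)).trans
      (mul_le_mul_of_nonneg_right (one_sub_le_div h0) hΛ)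
  have hexp : Real.exp (-h) ≤ 1 := Real.exp_le_one_iff.mpr (by linarith)
  induction K generalizing Λ with
  | zero =>
    rcases le_total Λ h with h2 | h2
    · rw [layered_succ_of_le h0 h2]
      exact small _ _ hΛ
    · have e : layered h (0 + 1) Λ = 1 - Real.exp (-h) := by
        simp [layered, layerWeight, h2, h0.ne']
      rw [e]
      have : min (1 - Real.exp (-Λ)) (1 - Real.exp (-((0 + 1 : ℕ) * h))) ≤ 1 - Real.exp (-h) :=
        (min_le_right _ _).trans (by simp)
      nlinarith
  | succ K ih =>
    rcases le_total Λ h with h2 | h2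
    · rw [layered_succ_of_le h0 h2]
      exact small _ _ hΛ
    · rw [layered_succ_of_ge h0 h2]
      have := mul_le_mul_of_nonneg_left (ih (Λ := Λ - h) (by linarith)) (Real.exp_pos (-h)).le
      have e1 : Real.exp (-Λ) = Real.exp (-h) * Real.exp (-(Λ - h)) := by
        rw [← Real.exp_add]; congr 1; ring
      have e2 : Real.exp (-((K + 1 + 1 : ℕ) * h)) =
          Real.exp (-h) * Real.exp (-((K + 1 : ℕ) * h)) := by
        rw [← Real.exp_add]; congr 1; push_cast; ring
      have e3 : min (1 - Real.exp (-Λ)) (1 - Real.exp (-((K + 1 + 1 : ℕ) * h))) =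
          1 - Real.exp (-h) + Real.exp (-h) *
            min (1 - Real.exp (-(Λ - h))) (1 - Real.exp (-((K + 1 : ℕ) * h))) := by
        rw [mul_min_of_nonneg _ _ (Real.exp_pos (-h)).le, ← min_add_add_left, e1, e2]
        congr 1 <;> ring
      rw [e3]
      have : 0 ≤ h * (1 - Real.exp (-h)) := mul_nonneg h0.le (by linarith)
      linarith

/-- The interpolation loses at most the factor `(1 - h) (1 - exp (-K h))`. -/
theorem mul_le_layered {h : ℝ} (h0 : 0 < h) (h1 : h ≤ 1) {K : ℕ} (hK : 0 < K) {Λ : ℝ}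
    (hΛ : 0 ≤ Λ) :
    (1 - h) * (1 - Real.exp (-(K * h))) * (1 - Real.exp (-Λ)) ≤ layered h K Λ := by
  obtain ⟨K, rfl⟩ := Nat.exists_eq_succ_of_ne_zero hK.ne'
  refine le_trans ?_ (mul_min_le_layered h0 h1 K hΛ)
  rw [mul_assoc]
  refine mul_le_mul_of_nonneg_left (le_min ?_ ?_) (by linarith)
  · refine mul_le_of_le_one_left ?_ (by linarith [Real.exp_pos (-((K.succ : ℕ) * h))])
    linarith [Real.exp_le_one_iff.mpr (neg_nonpos.mpr hΛ)]
  · refine mul_le_of_le_one_right ?_ (by linarith [Real.exp_pos (-Λ)])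
    have : Real.exp (-((K.succ : ℕ) * h)) ≤ 1 := Real.exp_le_one_iff.mpr (by
      have : 0 ≤ (K.succ : ℕ) * h := by positivity
      linarith)
    linarith

/-! ### Weak duality for the layered problem -/

theorem integral_indicator_Iio {v : ℝ} (h0 : 0 ≤ v) :
    ∫ τ in Set.Ico (0 : ℝ) 1, (Set.Iio v).indicator 1 τ = min v 1 := by
  rw [integral_indicator_one measurableSet_Iio, measureReal_restrict_apply measurableSet_Iio,
    Set.inter_comm, Set.Ico_inter_Iio, Real.volume_real_Ico]
  rw [sub_zero, min_comm, max_eq_left (le_min h0 zero_le_one)]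

theorem integral_indicator_Ico {r v : ℝ} (h0 : 0 ≤ r) (h1 : v ≤ 1) :
    ∫ τ in Set.Ico (0 : ℝ) 1, (Set.Ico r v).indicator 1 τ = max (v - r) 0 := by
  rw [integral_indicator_one measurableSet_Ico, measureReal_restrict_apply measurableSet_Ico,
    Set.inter_comm, Set.Ico_inter_Ico, Real.volume_real_Ico]
  rw [max_eq_right h0, min_eq_right h1]

/-- Layer-cake form of the dual feasibility of one offline vertex: if the sums of `x` over sets are
bounded by the combination of layers, then a weighted sum of `x` is bounded by the layerwise
fractional cost for any thresholds `r`. The inequality is integrated over the level `τ` of the sets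
`{v > τ}`: the layer `k` is charged to `s k` for the levels below `r k` and to the sum of `lam`
above. -/
theorem mul_sum_le_sum_layers {ι : Type*} {S : Finset ι} {x lam v : ι → ℝ} {K : ℕ} {μ s r : ℕ → ℝ}
    {q : ℝ} (hlam : ∀ i ∈ S, 0 ≤ lam i) (hμ : ∀ k, 0 ≤ μ k) (hs : ∀ k, 0 ≤ s k)
    (hr : ∀ k < K, 0 ≤ r k) (hv0 : ∀ i ∈ S, 0 ≤ v i) (hv1 : ∀ i ∈ S, v i ≤ 1)
    (h : ∀ A ⊆ S, q * ∑ i ∈ A, x i ≤ ∑ k ∈ Finset.range K, μ k * min (∑ i ∈ A, lam i) (s k)) :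
    q * ∑ i ∈ S, x i * v i ≤
      ∑ k ∈ Finset.range K, μ k * (s k * r k + ∑ i ∈ S, lam i * max (v i - r k) 0) := by
  have hfin : volume (Set.Ico (0 : ℝ) 1) ≠ ⊤ := by simp
  have int1 : ∀ u : ℝ, IntegrableOn ((Set.Iio u).indicator (1 : ℝ → ℝ)) (Set.Ico (0 : ℝ) 1) :=
    fun u => (integrable_indicator_iff measurableSet_Iio).mpr
      (integrableOn_const (by
        rw [Measure.restrict_apply measurableSet_Iio]
        exact ((measure_mono Set.inter_subset_right).trans_lt hfin.lt_top).ne))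
  have int2 : ∀ u w : ℝ, IntegrableOn ((Set.Ico u w).indicator (1 : ℝ → ℝ)) (Set.Ico (0 : ℝ) 1) :=
    fun u w => (integrable_indicator_iff measurableSet_Ico).mpr
      (integrableOn_const (by
        rw [Measure.restrict_apply measurableSet_Ico]
        exact ((measure_mono Set.inter_subset_right).trans_lt hfin.lt_top).ne))
  -- The inequality at the level `τ`.
  have pt : ∀ τ : ℝ, q * ∑ i ∈ S, x i * (Set.Iio (v i)).indicator 1 τ ≤
      ∑ k ∈ Finset.range K, μ k * (s k * (Set.Iio (r k)).indicator 1 τ +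
        ∑ i ∈ S, lam i * (Set.Ico (r k) (v i)).indicator 1 τ) := by
    intro τ
    have hA := h {i ∈ S | τ < v i} (Finset.filter_subset _ _)
    have e1 : ∑ i ∈ S, x i * (Set.Iio (v i)).indicator 1 τ = ∑ i ∈ S with τ < v i, x i := by
      rw [Finset.sum_filter]
      refine Finset.sum_congr rfl fun i _ => ?_
      by_cases hi : τ < v i <;> simp [hi]
    rw [e1]
    refine hA.trans (Finset.sum_le_sum fun k _ => mul_le_mul_of_nonneg_left ?_ (hμ k))
    have hnn : 0 ≤ ∑ i ∈ S, lam i * (Set.Ico (r k) (v i)).indicator (1 : ℝ → ℝ) τ :=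
      Finset.sum_nonneg fun i hi => mul_nonneg (hlam i hi)
        (Set.indicator_nonneg (fun _ _ => zero_le_one) _)
    by_cases hτ : τ < r k
    · refine (min_le_right _ _).trans ?_
      rw [Set.indicator_of_mem (show τ ∈ Set.Iio (r k) from hτ)]
      simpa using hnn
    · refine (min_le_left _ _).trans ?_
      rw [Set.indicator_of_notMem (show τ ∉ Set.Iio (r k) from hτ), mul_zero, zero_add,
        Finset.sum_filter]
      refine le_of_eq (Finset.sum_congr rfl fun i _ => ?_)
      by_cases hi : τ < v i <;> simp [hi, not_lt.mp hτ]
  have i1 : IntegrableOn (fun τ => q * ∑ i ∈ S, x i * (Set.Iio (v i)).indicator (1 : ℝ → ℝ) τ)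
      (Set.Ico (0 : ℝ) 1) :=
    (integrable_finsetSum _ fun i _ => (int1 (v i)).const_mul (x i)).const_mul q
  have i2' : ∀ k, IntegrableOn (fun τ => ∑ i ∈ S, lam i * (Set.Ico (r k) (v i)).indicator
      (1 : ℝ → ℝ) τ) (Set.Ico (0 : ℝ) 1) :=
    fun k => integrable_finsetSum _ fun i _ => (int2 (r k) (v i)).const_mul (lam i)
  have i2 : ∀ k, IntegrableOn (fun τ => s k * (Set.Iio (r k)).indicator (1 : ℝ → ℝ) τ +
        ∑ i ∈ S, lam i * (Set.Ico (r k) (v i)).indicator (1 : ℝ → ℝ) τ) (Set.Ico (0 : ℝ) 1) :=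
    fun k => ((int1 (r k)).const_mul (s k)).add (i2' k)
  have := integral_mono i1 (integrable_finsetSum _ fun k _ => (i2 k).const_mul (μ k)) pt
  rw [integral_const_mul, integral_finsetSum _ (fun i _ => (int1 (v i)).const_mul (x i)),
    integral_finsetSum _ (fun k _ => (i2 k).const_mul (μ k))] at this
  simp only [integral_const_mul] at this
  have e2 : ∑ i ∈ S, x i * v i =
      ∑ i ∈ S, x i * ∫ τ in Set.Ico (0 : ℝ) 1, (Set.Iio (v i)).indicator 1 τ := by
    refine Finset.sum_congr rfl fun i hi => ?_
    rw [integral_indicator_Iio (hv0 i hi), min_eq_left (hv1 i hi)]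
  rw [e2]
  refine this.trans (Finset.sum_le_sum fun k hk => mul_le_mul_of_nonneg_left ?_ (hμ k))
  rw [integral_add ((int1 (r k)).const_mul (s k)) (i2' k), integral_const_mul,
    integral_finsetSum _ (fun i _ => (int2 (r k) (v i)).const_mul (lam i)),
    integral_indicator_Iio (hr k (Finset.mem_range.mp hk))]
  refine add_le_add (mul_le_mul_of_nonneg_left (min_le_left _ _) (hs k)) (le_of_eq ?_)
  refine Finset.sum_congr rfl fun i hi => ?_
  rw [integral_const_mul, integral_indicator_Ico (hr k (Finset.mem_range.mp hk)) (hv1 i hi)]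

/-! ### Multiplicative weights for packing paths -/

/-- The resources: row `i < n` and column `v < V` for the edge from `i` to `v`, column `V` for the
sources, and row `n` for the sinks. -/
def cells (n V : ℕ) : Finset (ℕ × ℕ) := Finset.range (n + 1) ×ˢ Finset.range (V + 1)

theorem sum_cells {n V : ℕ} (F : ℕ → ℕ → ℝ) :
    ∑ e ∈ cells n V, F e.1 e.2 = ∑ i ∈ Finset.range n, ∑ v ∈ Finset.range V, F i v +
      ∑ i ∈ Finset.range n, F i V + ∑ v ∈ Finset.range V, F n v + F n V := by
  rw [cells, Finset.sum_product]
  simp only [Finset.sum_range_succ, Finset.sum_add_distrib]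
  ring

/-- `c` is the array of capacities of a network with three-edge paths: each edge that has a positive
capacity runs from a source to a sink of positive capacities. -/
structure IsNetwork (n V : ℕ) (c : ℕ → ℕ → ℝ) : Prop where
  nonneg : ∀ u v, 0 ≤ c u v
  source : ∀ i < n, ∀ v < V, 0 < c i v → 0 < c i V
  sink : ∀ i < n, ∀ v < V, 0 < c i v → 0 < c n v

/-- `D` is at most the cost of each fractional cut, in homogeneous form: prices `y` that make every
path at least as long as `l` cost at least `D * l`. -/
def IsDualBound (n V : ℕ) (c : ℕ → ℕ → ℝ) (D : ℝ) : Prop :=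
  ∀ (y : ℕ → ℕ → ℝ) (l : ℝ), (∀ u v, 0 ≤ y u v) →
    (∀ i < n, ∀ v < V, 0 < c i v → l ≤ y i v + y i V + y n v) →
    D * l ≤ ∑ e ∈ cells n V, c e.1 e.2 * y e.1 e.2

/-- The price of a unit of the resource `(u, v)` under the load `f`. The division by zero makes it
`0` for a resource of capacity `0`. -/
def price (ε : ℝ) (c f : ℕ → ℕ → ℝ) (u v : ℕ) : ℝ := Real.exp (ε * (f u v / c u v)) / c u v

/-- The length of the path through the edge `(i, v)`. -/
def pathLength (ε : ℝ) (c f : ℕ → ℕ → ℝ) (n V i v : ℕ) : ℝ :=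
  price ε c f i v + price ε c f i V + price ε c f n v

/-- The load after sending `γ` along the path through the edge `(i, v)`. -/
def pushFlow (f : ℕ → ℕ → ℝ) (n V i v : ℕ) (γ : ℝ) (u w : ℕ) : ℝ :=
  f u w + if (u = i ∧ w = v) ∨ (u = i ∧ w = V) ∨ (u = n ∧ w = v) then γ else 0

/-- What holds for the loads after `T` rounds of the multiplicative weights method: they are a flow
(`nonneg`, `supp`, `source`, `sink`), the exponential potential is bounded in terms of the amount of
flow (`weight`), and the congestions have grown by at least `1` in total in each round
(`congestion`). Resources of capacity `0` have congestion `0`, by the convention for division by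
zero. -/
structure FlowInvariant (n V : ℕ) (c : ℕ → ℕ → ℝ) (ε : ℝ) (f : ℕ → ℕ → ℝ) (T : ℕ) : Prop where
  nonneg : ∀ u v, 0 ≤ f u v
  supp : ∀ i < n, ∀ v < V, c i v ≤ 0 → f i v = 0
  source : ∀ i < n, f i V = ∑ v ∈ Finset.range V, f i v
  sink : ∀ v < V, f n v = ∑ i ∈ Finset.range n, f i v
  weight : ∀ D, 0 < D → IsDualBound n V c D →
    ∑ e ∈ cells n V, Real.exp (ε * (f e.1 e.2 / c e.1 e.2)) ≤
      (cells n V).card * Real.exp (ε * (1 + ε) * (∑ i ∈ Finset.range n, f i V) / D)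
  congestion : (∃ i < n, ∃ v < V, 0 < c i v) → (T : ℝ) ≤ ∑ e ∈ cells n V, f e.1 e.2 / c e.1 e.2

theorem flowInvariant_zero (n V : ℕ) (c : ℕ → ℕ → ℝ) (ε : ℝ) :
    FlowInvariant n V c ε (fun _ _ => 0) 0 where
  nonneg _ _ := le_rfl
  supp _ _ _ _ _ := rfl
  source _ _ := by simp
  sink _ _ := by simp
  weight D hD _ := by simp
  congestion _ := by simp

/-- Without edges there is nothing to do in a round. -/
theorem FlowInvariant.skip {n V : ℕ} {c f : ℕ → ℕ → ℝ} {ε : ℝ} {T : ℕ}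
    (h : FlowInvariant n V c ε f T) (hc : ∀ i < n, ∀ v < V, ¬ 0 < c i v) :
    FlowInvariant n V c ε f (T + 1) where
  nonneg := h.nonneg
  supp := h.supp
  source := h.source
  sink := h.sink
  weight := h.weight
  congestion := fun ⟨i, hi, v, hv, h⟩ => absurd h (hc i hi v hv)

/-- The sum of the weights grows at most in proportion to the flow sent along a shortest path. -/
theorem sum_exp_add_le {ι : Type*} [DecidableEq ι] {E P : Finset ι} {c f : ι → ℝ} {ε γ D : ℝ}
    (hP : P ⊆ E) (hc : ∀ e ∈ P, 0 < c e) (h0 : 0 ≤ γ) (hγ : ∀ e ∈ P, γ ≤ c e)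
    (hε : 0 < ε) (hε1 : ε ≤ 1)
    (hD : 0 < D)
    (hlen : D * ∑ e ∈ P, Real.exp (ε * (f e / c e)) / c e ≤ ∑ e ∈ E, Real.exp (ε * (f e / c e))) :
    ∑ e ∈ E, Real.exp (ε * ((f e + if e ∈ P then γ else 0) / c e)) ≤
      (∑ e ∈ E, Real.exp (ε * (f e / c e))) * Real.exp (ε * (1 + ε) * γ / D) := by
  set W := ∑ e ∈ E, Real.exp (ε * (f e / c e)) with hW
  have hW0 : 0 ≤ W := Finset.sum_nonneg fun e _ => (Real.exp_pos _).le
  set κ := ε * (1 + ε) * γ with hκ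
  have hκ0 : 0 ≤ κ := by positivity
  have hterm : ∀ e ∈ E, Real.exp (ε * ((f e + if e ∈ P then γ else 0) / c e)) ≤
      Real.exp (ε * (f e / c e)) +
        κ * (if e ∈ P then Real.exp (ε * (f e / c e)) / c e else 0) := by
    intro e _
    split_ifs with he
    · have hce := hc e he
      have hz0 : 0 ≤ ε * (γ / c e) := by positivity
      have hz1 : γ / c e ≤ 1 := (div_le_one hce).mpr (hγ e he)
      have hz2 : ε * (γ / c e) ≤ ε := mul_le_of_le_one_right hε.le hz1
      have hexp : Real.exp (ε * (γ / c e)) ≤ 1 + (1 + ε) * (ε * (γ / c e)) := by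
        have := Real.abs_exp_sub_one_sub_id_le (x := ε * (γ / c e))
          (by rw [abs_of_nonneg hz0]; linarith)
        have := (abs_le.mp this).2
        nlinarith
      rw [add_div, mul_add, Real.exp_add]
      have := mul_le_mul_of_nonneg_left hexp (Real.exp_pos (ε * (f e / c e))).le
      refine this.trans (le_of_eq ?_)
      rw [hκ]; ring
    · simp
  calc _ ≤ ∑ e ∈ E, (Real.exp (ε * (f e / c e)) +
        κ * (if e ∈ P then Real.exp (ε * (f e / c e)) / c e else 0)) := Finset.sum_le_sum hterm
    _ = W + κ * ∑ e ∈ P, Real.exp (ε * (f e / c e)) / c e := by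
        rw [Finset.sum_add_distrib, ← Finset.mul_sum, Finset.sum_ite_mem,
          Finset.inter_eq_right.mpr hP]
    _ ≤ W + κ * (W / D) := by
        gcongr
        rw [le_div_iff₀ hD, mul_comm]
        exact hlen
    _ = W * (κ / D + 1) := by ring
    _ ≤ W * Real.exp (κ / D) := mul_le_mul_of_nonneg_left (Real.add_one_le_exp _) hW0

/-- The resources of the path through the edge `(i, v)`. -/
def pathCells (n V i v : ℕ) : Finset (ℕ × ℕ) := {(i, v), (i, V), (n, v)}

theorem sum_pathCells {n V i v : ℕ} (hi : i < n) (hv : v < V) (F : ℕ × ℕ → ℝ) :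
    ∑ e ∈ pathCells n V i v, F e = F (i, v) + F (i, V) + F (n, v) := by
  rw [pathCells, Finset.sum_insert, Finset.sum_insert, Finset.sum_singleton, add_assoc]
  · simp [hi.ne]
  · simp [hi.ne, hv.ne]

theorem pathCells_subset {n V i v : ℕ} (hi : i < n) (hv : v < V) :
    pathCells n V i v ⊆ cells n V := by
  intro e he
  simp only [pathCells, Finset.mem_insert, Finset.mem_singleton] at he
  simp only [cells, Finset.mem_product, Finset.mem_range]
  rcases he with rfl | rfl | rfl <;> constructor <;> simp only <;> omega

theorem pushFlow_eq (f : ℕ → ℕ → ℝ) (n V i v : ℕ) (γ : ℝ) (e : ℕ × ℕ) :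
    pushFlow f n V i v γ e.1 e.2 = f e.1 e.2 + if e ∈ pathCells n V i v then γ else 0 := by
  simp [pushFlow, pathCells, Prod.ext_iff]

/-- A round sends along a shortest path as much flow as the capacities of this path allow. Its
length is bounded by the dual bound, applied to the prices. -/
theorem FlowInvariant.push {n V : ℕ} {c f : ℕ → ℕ → ℝ} {ε : ℝ} {T i v : ℕ}
    (h : FlowInvariant n V c ε f T) (hc : IsNetwork n V c) (hε : 0 < ε) (hε1 : ε ≤ 1) (hi : i < n)
    (hv : v < V) (hiv : 0 < c i v)
    (hmin : ∀ i' < n, ∀ v' < V, 0 < c i' v' →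
      pathLength ε c f n V i v ≤ pathLength ε c f n V i' v') :
    FlowInvariant n V c ε (pushFlow f n V i v (min (c i v) (min (c i V) (c n v)))) (T + 1) := by
  have hiV := hc.source i hi v hv hiv
  have hnv := hc.sink i hi v hv hiv
  set γ := min (c i v) (min (c i V) (c n v)) with hγ
  have hγ0 : 0 < γ := lt_min hiv (lt_min hiV hnv)
  have hpos : ∀ e ∈ pathCells n V i v, 0 < c e.1 e.2 := by
    intro e he
    simp only [pathCells, Finset.mem_insert, Finset.mem_singleton] at he
    rcases he with rfl | rfl | rfl <;> assumption
  have hle : ∀ e ∈ pathCells n V i v, γ ≤ c e.1 e.2 := by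
    intro e he
    simp only [pathCells, Finset.mem_insert, Finset.mem_singleton] at he
    rcases he with rfl | rfl | rfl
    · exact min_le_left _ _
    · exact (min_le_right _ _).trans (min_le_left _ _)
    · exact (min_le_right _ _).trans (min_le_right _ _)
  have hX : ∑ i' ∈ Finset.range n, pushFlow f n V i v γ i' V =
      ∑ i' ∈ Finset.range n, f i' V + γ := by
    unfold pushFlow
    rw [Finset.sum_add_distrib]
    congr 1
    rw [Finset.sum_eq_single_of_mem i (Finset.mem_range.mpr hi), if_pos (by simp)]
    intro b _ hb
    rw [if_neg]
    rintro (h | h | h)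
    · exact hb h.1
    · exact hb h.1
    · exact hv.ne' h.2
  constructor
  · intro u w
    unfold pushFlow
    have := h.nonneg u w
    split_ifs <;> linarith
  · intro u hu w hw hcu
    rw [pushFlow, h.supp u hu w hw hcu, if_neg, zero_add]
    rintro (⟨rfl, rfl⟩ | ⟨_, rfl⟩ | ⟨rfl, _⟩)
    · linarith
    · exact lt_irrefl _ hw
    · exact lt_irrefl _ hu
  · intro u hu
    unfold pushFlow
    rw [Finset.sum_add_distrib, h.source u hu]
    congr 1
    by_cases hui : u = i
    · rw [if_pos (by simp [hui]), Finset.sum_eq_single_of_mem v (Finset.mem_range.mpr hv),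
        if_pos (by simp [hui])]
      intro b hb hbv
      have := Finset.mem_range.mp hb
      rw [if_neg]
      rintro (h | h | h) <;> omega
    · rw [if_neg (by omega), Finset.sum_eq_zero]
      intro b _
      rw [if_neg (by omega)]
  · intro w hw
    unfold pushFlow
    rw [Finset.sum_add_distrib, h.sink w hw]
    congr 1
    by_cases hwv : w = v
    · rw [if_pos (by simp [hwv]), Finset.sum_eq_single_of_mem i (Finset.mem_range.mpr hi),
        if_pos (by simp [hwv])]
      intro b hb hbv
      have := Finset.mem_range.mp hb
      rw [if_neg]
      rintro (h | h | h) <;> omega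
    · rw [if_neg (by omega), Finset.sum_eq_zero]
      intro b _
      rw [if_neg (by omega)]
  · intro D hD hdual
    have hlen : D * ∑ e ∈ pathCells n V i v, Real.exp (ε * (f e.1 e.2 / c e.1 e.2)) / c e.1 e.2 ≤
        ∑ e ∈ cells n V, Real.exp (ε * (f e.1 e.2 / c e.1 e.2)) := by
      rw [sum_pathCells hi hv]
      have := hdual (price ε c f) (pathLength ε c f n V i v)
        (fun u w => div_nonneg (Real.exp_pos _).le (hc.nonneg u w)) hmin
      refine this.trans (Finset.sum_le_sum fun e _ => ?_)
      rcases (hc.nonneg e.1 e.2).eq_or_lt with h | h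
      · rw [← h, zero_mul]; exact (Real.exp_pos _).le
      · rw [price, mul_div_cancel₀ _ h.ne']
    have := sum_exp_add_le (f := fun e : ℕ × ℕ => f e.1 e.2) (c := fun e : ℕ × ℕ => c e.1 e.2)
      (pathCells_subset hi hv) hpos hγ0.le hle hε hε1 hD hlen
    simp only [pushFlow_eq]
    refine this.trans ?_
    refine (mul_le_mul_of_nonneg_right (h.weight D hD hdual) (Real.exp_pos _).le).trans
      (le_of_eq ?_)
    rw [mul_assoc, ← Real.exp_add, hX]
    congr 2
    ring
  · intro hex
    have := h.congestion hex
    have hsum : ∑ e ∈ cells n V, pushFlow f n V i v γ e.1 e.2 / c e.1 e.2 =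
        ∑ e ∈ cells n V, f e.1 e.2 / c e.1 e.2 +
          ∑ e ∈ pathCells n V i v, γ / c e.1 e.2 := by
      simp only [pushFlow_eq, add_div, Finset.sum_add_distrib, ite_div, zero_div]
      rw [Finset.sum_ite_mem, Finset.inter_eq_right.mpr (pathCells_subset hi hv)]
    -- The edge of the smallest capacity on the path becomes saturated.
    have hsat : ∃ e ∈ pathCells n V i v, γ = c e.1 e.2 := by
      rcases min_choice (c i v) (min (c i V) (c n v)) with h1 | h1
      · exact ⟨(i, v), by simp [pathCells], h1⟩
      · rcases min_choice (c i V) (c n v) with h2 | h2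
        · exact ⟨(i, V), by simp [pathCells], by rw [hγ, h1, h2]⟩
        · exact ⟨(n, v), by simp [pathCells], by rw [hγ, h1, h2]⟩
    obtain ⟨e, he, hγe⟩ := hsat
    have h1 : (1 : ℝ) ≤ ∑ e ∈ pathCells n V i v, γ / c e.1 e.2 := by
      have := Finset.single_le_sum (f := fun e => γ / c e.1 e.2)
        (fun e he => div_nonneg hγ0.le (hpos e he).le) he
      refine le_trans (le_of_eq ?_) this
      simp only [hγe]
      rw [div_self (hpos e he).ne']
    rw [hsum]
    push_cast
    linarith

/-- After sufficiently many rounds the loads, divided by the largest congestion `M`, are nearly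
optimal. With `L` resources, `N * L ^ 2` rounds raise the largest congestion to at least `N * L`, so
that the logarithm of the initial weight `L`, for which `L` is a sufficient bound, is a small
fraction of `ε * M`. -/
theorem FlowInvariant.mul_le {n V : ℕ} {c f : ℕ → ℕ → ℝ} {ε : ℝ} {N : ℕ}
    (h : FlowInvariant n V c ε f (N * ((cells n V).card * (cells n V).card)))
    (hc : IsNetwork n V c) (hε : 0 < ε) (hN : 1 ≤ ε * N) {M D : ℝ} (hM : 1 ≤ M)
    (hmax : ∀ e ∈ cells n V, 0 < c e.1 e.2 → f e.1 e.2 / c e.1 e.2 ≤ M)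
    (hex : M = 1 ∨ ∃ e ∈ cells n V, 0 < c e.1 e.2 ∧ M = f e.1 e.2 / c e.1 e.2)
    (hD : IsDualBound n V c D) :
    D * ((1 - 1 / (ε * N)) / (1 + ε)) ≤ (∑ i ∈ Finset.range n, f i V) / M := by
  set X := ∑ i ∈ Finset.range n, f i V with hX
  have hX0 : 0 ≤ X := Finset.sum_nonneg fun i _ => h.nonneg i V
  have hN0 : (0 : ℝ) < N := by
    by_contra hN0
    have : ε * N ≤ 0 := mul_nonpos_of_nonneg_of_nonpos hε.le (not_lt.mp hN0)
    linarith
  have hN1 : (1 : ℝ) ≤ N := by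
    have : 0 < N := by exact_mod_cast hN0
    exact_mod_cast this
  have hfac : 0 ≤ (1 - 1 / (ε * N)) / (1 + ε) := by
    refine div_nonneg ?_ (by linarith)
    rw [sub_nonneg, div_le_one (by positivity)]
    exact hN
  rcases le_or_gt D 0 with hD0 | hD0
  · exact (mul_nonpos_of_nonpos_of_nonneg hD0 hfac).trans (div_nonneg hX0 (by linarith))
  -- A positive dual bound is only possible if there is an edge.
  have hcol : ∃ i < n, ∃ v < V, 0 < c i v := by
    by_contra hcon
    push Not at hcon
    have := hD (fun _ _ => 0) 1 (fun _ _ => le_rfl)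
      (fun i hi v hv hp => absurd hp (not_lt.mpr (hcon i hi v hv)))
    simp at this
    linarith
  have hcong := h.congestion hcol
  set L : ℕ := (cells n V).card with hL
  have hLpos : (1 : ℝ) ≤ L := by
    have : 0 < L := Finset.card_pos.mpr ⟨(0, 0), by simp [cells]⟩
    exact_mod_cast this
  have hbound : ∀ e ∈ cells n V, f e.1 e.2 / c e.1 e.2 ≤ M := by
    intro e he
    rcases (hc.nonneg e.1 e.2).eq_or_lt with h0 | h0
    · rw [← h0, div_zero]; linarith
    · exact hmax e he h0
  have hML : N * L ≤ M := by
    have h1 := Finset.sum_le_card_nsmul _ _ _ hbound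
    rw [← hL, nsmul_eq_mul] at h1
    have h2 := hcong.trans h1
    push_cast at h2
    have : (L : ℝ) * (N * L) ≤ L * M := by linarith
    exact le_of_mul_le_mul_left this (by linarith)
  -- The largest congestion is attained, since the average is at least `1`.
  have hatt : ∃ e ∈ cells n V, M ≤ f e.1 e.2 / c e.1 e.2 := by
    rcases hex with hM1 | ⟨e, he, _, hMe⟩
    · by_contra hcon
      push Not at hcon
      have h1 := Finset.sum_lt_sum_of_nonempty (Finset.card_pos.mp
        (show 0 < (cells n V).card by rw [← hL]; exact_mod_cast (by linarith : (0 : ℝ) < L))) hcon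
      rw [Finset.sum_const, nsmul_eq_mul, hM1, mul_one, ← hL] at h1
      have h2 := hcong.trans_lt h1
      push_cast at h2
      nlinarith
    · exact ⟨e, he, hMe.le⟩
  obtain ⟨e, he, hMe⟩ := hatt
  have hw := h.weight D hD0 hD
  have h1 : Real.exp (ε * M) ≤ L * Real.exp (ε * (1 + ε) * X / D) := by
    refine le_trans ?_ hw
    refine le_trans ?_ (Finset.single_le_sum (f := fun e : ℕ × ℕ =>
      Real.exp (ε * (f e.1 e.2 / c e.1 e.2))) (fun e _ => (Real.exp_pos _).le) he)
    exact Real.exp_le_exp.mpr (mul_le_mul_of_nonneg_left hMe hε.le)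
  have h2 : ε * M ≤ L + ε * (1 + ε) * X / D := by
    rw [← Real.exp_le_exp, Real.exp_add]
    refine h1.trans (mul_le_mul_of_nonneg_right ?_ (Real.exp_pos _).le)
    linarith [Real.add_one_le_exp (L : ℝ)]
  have h3 : (L : ℝ) ≤ M / N := by rw [le_div_iff₀ hN0]; linarith
  have hMpos : 0 < M := by linarith
  have h4 : (ε * M - M / N) * D ≤ ε * (1 + ε) * X := by
    have : ε * M - M / N ≤ ε * (1 + ε) * X / D := by linarith
    rwa [le_div_iff₀ hD0] at this
  rw [le_div_iff₀ hMpos, mul_div_assoc', div_mul_eq_mul_div, div_le_iff₀ (by linarith)]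
  have e1 : ε * (D * (1 - 1 / (ε * N)) * M) = (ε * M - M / N) * D := by
    field_simp
  have : ε * (D * (1 - 1 / (ε * N)) * M) ≤ ε * (X * (1 + ε)) := by
    rw [e1]; linarith
  exact le_of_mul_le_mul_left this hε

/-! ### The layered network of an instance -/

theorem sum_range_mul_eq (m K : ℕ) (F : ℕ → ℝ) :
    ∑ v ∈ Finset.range (m * K), F v =
      ∑ j ∈ Finset.range m, ∑ k ∈ Finset.range K, F (j * K + k) := by
  induction m with
  | zero => simp
  | succ m ih => rw [Finset.sum_range_succ, ← ih, Nat.succ_mul, Finset.sum_range_add]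

namespace TypeGraph
variable {G : TypeGraph}

/-- The capacities of the layered network, in which the column `j * K + k` is the `k`-th layer of
the offline vertex `j`, the column `m * K` contains the sources and the row `n` the sinks. -/
def layerCap (G : TypeGraph) (h : ℝ) (K u v : ℕ) : ℝ :=
  if u < G.n ∧ v < G.m * K then
    G.encode.mem 0 u (v / K) * G.encode.mem 1 u 0 * layerWeight h K (v % K)
  else if u < G.n ∧ v = G.m * K then G.encode.mem 1 u 0
  else if u = G.n ∧ v < G.m * K then ((v % K : ℕ) + 1) * h * layerWeight h K (v % K)
  else 0

theorem layer_lt {m K j k : ℕ} (hj : j < m) (hk : k < K) : j * K + k < m * K := by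
  have : (j + 1) * K ≤ m * K := Nat.mul_le_mul_right K hj
  rw [Nat.succ_mul] at this
  omega

theorem layer_div {K j k : ℕ} (hk : k < K) : (j * K + k) / K = j := by
  rw [Nat.mul_comm, Nat.mul_add_div (by omega), Nat.div_eq_of_lt hk, add_zero]

theorem layer_mod {K j k : ℕ} (hk : k < K) : (j * K + k) % K = k := by
  rw [Nat.mul_comm, Nat.mul_add_mod, Nat.mod_eq_of_lt hk]

theorem layerCap_edge (h : ℝ) {K k : ℕ} (i : Fin G.n) (j : Fin G.m) (hk : k < K) :
    G.layerCap h K i (j * K + k) = if G.adj i j then G.rate i * layerWeight h K k else 0 := by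
  rw [layerCap, if_pos ⟨i.2, layer_lt j.2 hk⟩, layer_div hk, layer_mod hk]
  simp [encode, matCells, vecCells]

theorem layerCap_source (h : ℝ) (K : ℕ) (i : Fin G.n) :
    G.layerCap h K i (G.m * K) = G.rate i := by
  rw [layerCap, if_neg (by simp), if_pos ⟨i.2, rfl⟩]
  simp [encode, vecCells]

theorem layerCap_sink (h : ℝ) {K k : ℕ} (j : Fin G.m) (hk : k < K) :
    G.layerCap h K G.n (j * K + k) = (k + 1) * h * layerWeight h K k := by
  rw [layerCap, if_neg (by simp), if_neg (by simp), if_pos ⟨rfl, layer_lt j.2 hk⟩, layer_mod hk]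

theorem layerCap_corner (h : ℝ) (K : ℕ) : G.layerCap h K G.n (G.m * K) = 0 := by
  simp [layerCap]

theorem encode_adj_nonneg (u v : ℕ) : 0 ≤ G.encode.mem 0 u v := by
  simp only [encode, matCells, if_true]
  split_ifs <;> norm_num

theorem encode_rate_nonneg (u v : ℕ) : 0 ≤ G.encode.mem 1 u v := by
  simp only [encode, vecCells, one_ne_zero, if_true, if_false]
  split_ifs
  · exact (G.rate_pos _).le
  · exact le_rfl

theorem isNetwork_layerCap {h : ℝ} (h0 : 0 < h) (K : ℕ) :
    IsNetwork G.n (G.m * K) (G.layerCap h K) where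
  nonneg u v := by
    have := layerWeight_pos h0 K (v % K)
    have := G.encode_adj_nonneg u (v / K)
    have := G.encode_rate_nonneg u 0
    unfold layerCap
    split_ifs <;> positivity
  source i hi v hv _ := by
    rw [show G.layerCap h K i (G.m * K) = _ from layerCap_source h K ⟨i, hi⟩]
    exact G.rate_pos _
  sink i hi v hv _ := by
    have := layerWeight_pos h0 K (v % K)
    rw [layerCap, if_neg (by simp), if_neg (by simp), if_pos ⟨rfl, hv⟩]
    positivity

/-- A sum over the resources of the layered network. -/
theorem sum_cells_layer (K : ℕ) (F : ℕ → ℕ → ℝ) (hF : F G.n (G.m * K) = 0) :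
    ∑ e ∈ cells G.n (G.m * K), F e.1 e.2 =
      ∑ i : Fin G.n, F i (G.m * K) + ∑ j : Fin G.m, ∑ k ∈ Finset.range K,
        (F G.n (j * K + k) + ∑ i : Fin G.n, F i (j * K + k)) := by
  rw [sum_cells, hF, Finset.sum_comm, sum_range_mul_eq, sum_range_mul_eq, Finset.sum_range,
    Finset.sum_range, Finset.sum_range]
  simp only [Finset.sum_add_distrib, Finset.sum_range (n := G.n)]
  ring

theorem lpValue_eq (x : Fin G.n → Fin G.m → ℝ) :
    G.lpValue x = ∑ i, ∑ j, G.edgeValue x i j := by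
  unfold lpValue
  refine Finset.sum_congr rfl fun i _ => ?_
  rw [← sum_nbr_inter, Finset.inter_univ]

theorem lpValue_nonneg {x : Fin G.n → Fin G.m → ℝ} (hx : G.IsLPFeasible x) : 0 ≤ G.lpValue x := by
  rw [lpValue_eq]
  exact Finset.sum_nonneg fun i _ => Finset.sum_nonneg fun j _ => hx.edgeValue_nonneg i j

/-- Weak duality between the Natural LP and the layered network. For prices `y` that make every path
at least as long as `l`, let `1 - v i` be the part of the length covered by the source `i`. This
part is paid for by the constraint of the type `i`, and the rest by the constraints of the offline
vertices, by `mul_sum_le_sum_layers` with the prices of the sinks as thresholds. -/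
theorem isDualBound_layerCap {h : ℝ} (h0 : 0 < h) (h1 : h ≤ 1) {K : ℕ} (hK : 0 < K)
    {x : Fin G.n → Fin G.m → ℝ} (hx : G.IsLPFeasible x) :
    IsDualBound G.n (G.m * K) (G.layerCap h K)
      ((1 - h) * (1 - Real.exp (-(K * h))) * G.lpValue x) := by
  intro y l hy hl
  set q := (1 - h) * (1 - Real.exp (-(K * h))) with hq
  have hexp : Real.exp (-(K * h)) ≤ 1 := Real.exp_le_one_iff.mpr (by
    have : 0 ≤ (K : ℝ) * h := by positivity
    linarith)
  have hexp0 := Real.exp_pos (-(K * h))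
  have hq0 : 0 ≤ q := mul_nonneg (by linarith) (by linarith)
  have hq1 : q ≤ 1 := mul_le_one₀ (by linarith) (by linarith) (by linarith)
  have hnet := G.isNetwork_layerCap h0 K
  have hLP := lpValue_nonneg hx
  rcases le_or_gt l 0 with hl0 | hl0
  · exact (mul_nonpos_of_nonneg_of_nonpos (mul_nonneg hq0 hLP) hl0).trans
      (Finset.sum_nonneg fun e _ => mul_nonneg (hnet.nonneg _ _) (hy _ _))
  rw [sum_cells_layer K (fun u v => G.layerCap h K u v * y u v) (by simp [layerCap_corner]),
    ← le_div_iff₀ hl0]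
  set a : Fin G.n → ℝ := fun i => y i (G.m * K) / l with ha
  have ha0 : ∀ i, 0 ≤ a i := fun i => div_nonneg (hy _ _) hl0.le
  -- The part of the normalized path lengths not covered by the sources.
  set v : Fin G.n → ℝ := fun i => max (1 - a i) 0 with hv
  have hv0 : ∀ i, 0 ≤ v i := fun i => le_max_right _ _
  have hv1 : ∀ i, v i ≤ 1 := fun i => max_le (by linarith [ha0 i]) zero_le_one
  have hva : ∀ i, 1 - v i ≤ a i := fun i => by linarith [le_max_left (1 - a i) 0]
  have hoff : ∀ j : Fin G.m, q * ∑ i, G.edgeValue x i j * v i ≤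
      (∑ k ∈ Finset.range K, (G.layerCap h K G.n (j * K + k) * y G.n (j * K + k) +
        ∑ i : Fin G.n, G.layerCap h K i (j * K + k) * y i (j * K + k))) / l := by
    intro j
    set S : Finset (Fin G.n) := {i | G.adj i j} with hS
    have hSadj : ∀ i ∈ S, G.adj i j := fun i hi => (Finset.mem_filter.mp hi).2
    have key := mul_sum_le_sum_layers (S := S) (x := fun i => x i j) (lam := G.rate) (v := v)
      (K := K) (μ := layerWeight h K) (s := fun k => (k + 1) * h)
      (r := fun k => y G.n (j * K + k) / l) (q := q) (fun i _ => (G.rate_pos i).le)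
      (fun k => (layerWeight_pos h0 K k).le) (fun k => by positivity)
      (fun k _ => div_nonneg (hy _ _) hl0.le) (fun i _ => hv0 i) (fun i _ => hv1 i) (by
        intro A hA
        have e1 := hx.offline j A fun i hi => hSadj i (hA hi)
        exact (mul_le_mul_of_nonneg_left e1 hq0).trans
          (mul_le_layered h0 h1 hK (Finset.sum_nonneg fun i _ => (G.rate_pos i).le)))
    have e2 : ∑ i, G.edgeValue x i j * v i = ∑ i ∈ S, x i j * v i := by
      rw [hS, Finset.sum_filter]
      refine Finset.sum_congr rfl fun i _ => ?_
      unfold edgeValue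
      split_ifs <;> simp
    rw [e2, Finset.sum_div]
    refine key.trans (Finset.sum_le_sum fun k hk => ?_)
    have hk := Finset.mem_range.mp hk
    have hμ := layerWeight_pos h0 K k
    have e3 : ∑ i : Fin G.n, G.layerCap h K i (j * K + k) * y i (j * K + k) =
        ∑ i ∈ S, G.rate i * layerWeight h K k * y i (j * K + k) := by
      rw [hS, Finset.sum_filter]
      refine Finset.sum_congr rfl fun i _ => ?_
      rw [layerCap_edge h i j hk]
      split_ifs <;> simp
    rw [layerCap_sink h j hk, e3, add_div, mul_add, Finset.mul_sum, Finset.sum_div]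
    refine add_le_add (le_of_eq (by ring)) (Finset.sum_le_sum fun i hi => ?_)
    have e4 : max (v i - y G.n (j * K + k) / l) 0 ≤ y i (j * K + k) / l := by
      have hpos : 0 < G.layerCap h K i (j * K + k) := by
        rw [layerCap_edge h i j hk, if_pos (hSadj i hi)]
        exact mul_pos (G.rate_pos i) hμ
      have := hl i i.2 _ (layer_lt j.2 hk) hpos
      have h3 : 1 ≤ y i (j * K + k) / l + a i + y G.n (j * K + k) / l := by
        rw [ha]
        simp only
        rw [← add_div, ← add_div, le_div_iff₀ hl0]
        linarith
      have h4 : 0 ≤ y i (j * K + k) / l := div_nonneg (hy _ _) hl0.le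
      have h5 : 0 ≤ y G.n (j * K + k) / l := div_nonneg (hy _ _) hl0.le
      refine max_le ?_ h4
      rw [sub_le_iff_le_add]
      exact max_le (by linarith) (by linarith)
    have := mul_le_mul_of_nonneg_left e4 (mul_pos (G.rate_pos i) hμ).le
    calc _ = G.rate i * layerWeight h K k * max (v i - y G.n (j * K + k) / l) 0 := by ring
      _ ≤ _ := this
      _ = _ := by ring
  have hon : q * ∑ i, (1 - v i) * ∑ j, G.edgeValue x i j ≤
      (∑ i : Fin G.n, G.layerCap h K i (G.m * K) * y i (G.m * K)) / l := by
    have hnn : 0 ≤ ∑ i, (1 - v i) * ∑ j, G.edgeValue x i j := Finset.sum_nonneg fun i _ =>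
      mul_nonneg (by linarith [hv1 i]) (Finset.sum_nonneg fun j _ => hx.edgeValue_nonneg i j)
    refine (mul_le_of_le_one_left hnn hq1).trans ?_
    rw [Finset.sum_div]
    refine Finset.sum_le_sum fun i _ => ?_
    rw [layerCap_source, mul_div_assoc, mul_comm (G.rate i)]
    exact mul_le_mul (hva i) (hx.sum_le_rate i Finset.univ)
      (Finset.sum_nonneg fun j _ => hx.edgeValue_nonneg i j) (ha0 i)
  have hsplit : G.lpValue x = ∑ i, (1 - v i) * ∑ j, G.edgeValue x i j +
      ∑ j, ∑ i, G.edgeValue x i j * v i := by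
    rw [lpValue_eq, Finset.sum_comm (f := fun j i => G.edgeValue x i j * v i),
      ← Finset.sum_add_distrib]
    refine Finset.sum_congr rfl fun i _ => ?_
    rw [← Finset.sum_mul]
    ring
  rw [hsplit, mul_add, add_div]
  refine add_le_add hon ?_
  rw [Finset.sum_div, Finset.mul_sum]
  exact Finset.sum_le_sum fun j _ => hoff j

/-- A flow in the layered network, scaled to respect the capacities, is feasible for the Natural LP:
in each layer the flow from `S` to `j` is bounded both by the edges and by the sink, and the layers
add up to a lower bound for `1 - exp (-Λ)`. -/
theorem isLPFeasible_of_flow {h : ℝ} (h0 : 0 < h) {K T : ℕ} {ε M : ℝ} {f : ℕ → ℕ → ℝ}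
    (hf : FlowInvariant G.n (G.m * K) (G.layerCap h K) ε f T) (hM : 0 < M)
    (hmax : ∀ e ∈ cells G.n (G.m * K), 0 < G.layerCap h K e.1 e.2 →
      f e.1 e.2 / G.layerCap h K e.1 e.2 ≤ M)
    {x : Fin G.n → Fin G.m → ℝ}
    (hx : ∀ i j, x i j = ∑ k ∈ Finset.range K, f i (j * K + k) / M) :
    G.IsLPFeasible x ∧
      G.lpValue x = (∑ i ∈ Finset.range G.n, f i (G.m * K)) / M := by
  have hnn : ∀ i j, 0 ≤ x i j := fun i j => by
    rw [hx]
    exact Finset.sum_nonneg fun k _ => div_nonneg (hf.nonneg _ _) hM.le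
  have hle : ∀ e ∈ cells G.n (G.m * K), 0 < G.layerCap h K e.1 e.2 →
      f e.1 e.2 / M ≤ G.layerCap h K e.1 e.2 := fun e he hpos => by
    have := hmax e he hpos
    rw [div_le_iff₀ hpos] at this
    rw [div_le_iff₀ hM]
    linarith
  have hzero : ∀ i j, ¬ G.adj i j → x i j = 0 := fun i j hij => by
    rw [hx]
    refine Finset.sum_eq_zero fun k hk => ?_
    have hk := Finset.mem_range.mp hk
    rw [hf.supp i i.2 _ (layer_lt j.2 hk) (by rw [layerCap_edge h i j hk, if_neg hij]), zero_div]
  have hrow : ∀ i : Fin G.n, ∑ j ∈ G.nbr i, x i j = f i (G.m * K) / M := fun i => by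
    rw [hf.source i i.2, sum_range_mul_eq, Finset.sum_div, Finset.sum_range, nbr, Finset.sum_filter]
    refine Finset.sum_congr rfl fun j _ => ?_
    rw [Finset.sum_div, ← hx]
    split_ifs with hij
    · rfl
    · exact (hzero i j hij).symm
  refine ⟨⟨fun i j _ => hnn i j, fun i => ?_, fun j S hS => ?_⟩, ?_⟩
  · rw [hrow, ← layerCap_source h K i]
    refine hle (i, G.m * K) ?_ ?_
    · have := i.2
      simp only [cells, Finset.mem_product, Finset.mem_range]
      omega
    · rw [layerCap_source]
      exact G.rate_pos i
  · have hΛ : 0 ≤ ∑ i ∈ S, G.rate i := Finset.sum_nonneg fun i _ => (G.rate_pos i).le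
    refine le_trans ?_ (layered_le h0 K hΛ)
    simp only [hx]
    rw [Finset.sum_comm, layered]
    refine Finset.sum_le_sum fun k hk => ?_
    have hk := Finset.mem_range.mp hk
    have hμ := layerWeight_pos h0 K k
    have hV := layer_lt j.2 hk
    rw [mul_min_of_nonneg _ _ hμ.le]
    refine le_min ?_ ?_
    · rw [Finset.mul_sum]
      refine Finset.sum_le_sum fun i hi => ?_
      have hc := layerCap_edge h i j hk
      rw [if_pos (hS i hi)] at hc
      refine (hle (i, j * K + k) ?_ ?_).trans (by rw [hc, mul_comm])
      · have := i.2
        simp only [cells, Finset.mem_product, Finset.mem_range]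
        omega
      · rw [hc]
        exact mul_pos (G.rate_pos i) hμ
    · have hc := layerCap_sink (G := G) h j hk
      have hpos : 0 < G.layerCap h K G.n (j * K + k) := by
        rw [hc]; positivity
      have h1 := hle (G.n, j * K + k) (by
        simp only [cells, Finset.mem_product, Finset.mem_range]
        omega) hpos
      simp only at h1
      rw [hc, hf.sink _ hV] at h1
      rw [← Finset.sum_div, mul_comm (layerWeight h K k)]
      refine le_trans (div_le_div_of_nonneg_right ?_ hM.le) h1
      rw [Finset.sum_range]
      exact Finset.sum_le_sum_of_subset_of_nonneg (Finset.subset_univ _)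
        fun i _ _ => hf.nonneg _ _
  · rw [lpValue, Finset.sum_div, Finset.sum_range]
    exact Finset.sum_congr rfl fun i _ => hrow i

end TypeGraph

/-! ### A program for the layered network -/

/- Capacities are stored in the array `3` and loads in the array `4`. Register `5` always contains
`0`. The number of layers is a constant of the program, so that loops over the layers of an offline
vertex are unrolled. -/

namespace RamState

theorem setReg_self (σ : RamState) (r : ℕ) : σ.setReg r (σ.reg r) = σ := by
  simp [setReg]

theorem setReg_setReg (σ : RamState) (r u v : ℕ) : (σ.setReg r u).setReg r v = σ.setReg r v := by
  simp [setReg]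

theorem setMem_self (σ : RamState) (A u v : ℕ) : σ.setMem A u v (σ.mem A u v) = σ := by
  have : (fun B u' v' => if B = A ∧ u' = u ∧ v' = v then σ.mem A u v else σ.mem B u' v') =
      σ.mem := by
    funext B u' v'
    split_ifs with h
    · rw [h.1, h.2.1, h.2.2]
    · rfl
  simp only [setMem, this]

theorem setMem_setMem (σ : RamState) (A u v : ℕ) (x y : ℝ) :
    (σ.setMem A u v x).setMem A u v y = σ.setMem A u v y := by
  simp only [setMem]
  congr 1
  funext B u' v'
  split_ifs <;> rfl

end RamState

namespace RamProg
open RamExpr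

/-- An instruction without effect, as long as the register `5` contains `0`. -/
def skip : RamProg := zero 5

theorem output_skip {σ : RamState} (h : σ.reg 5 = 0) : skip.output σ = σ := by
  conv_rhs => rw [← σ.setReg_self 5, h]
  rfl

theorem steps_skip (σ : RamState) : skip.steps σ = 1 := rfl

/-- The sequential composition of the first `K` of a sequence of programs. -/
def unroll (p : ℕ → RamProg) : ℕ → RamProg
  | 0 => skip
  | K + 1 => seq (unroll p K) (p K)

theorem unroll_spec (I : ℕ → RamState → Prop) {p : ℕ → RamProg} {N K : ℕ} {σ : RamState}
    (h5 : σ.reg 5 = 0) (h0 : I 0 σ)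
    (hstep : ∀ k < K, ∀ τ, I k τ → I (k + 1) ((p k).output τ) ∧ (p k).steps τ ≤ N) :
    I K ((unroll p K).output σ) ∧ (unroll p K).steps σ ≤ K * N + 1 := by
  induction K with
  | zero => exact ⟨by rw [unroll, output_skip h5]; exact h0, by simp [unroll, steps_skip]⟩
  | succ K ih =>
    obtain ⟨h1, h2⟩ := ih fun k hk => hstep k (by omega)
    obtain ⟨h3, h4⟩ := hstep K (by omega) _ h1
    refine ⟨h3, ?_⟩
    rw [unroll, steps_seq, Nat.succ_mul]
    omega

/-- Replaces the entry `(0, 0)` of the array `A` by the minimum with the value of `e`. -/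
def storeMin (A : ℕ) (e : RamExpr) : RamProg := ifLe (cell A 5 5) e skip (store A 5 5 e)

/-- Replaces the entry `(0, 0)` of the array `A` by the maximum with the value of `e`. -/
def storeMax (A : ℕ) (e : RamExpr) : RamProg := ifLe e (cell A 5 5) skip (store A 5 5 e)

theorem output_storeMin (A : ℕ) (e : RamExpr) {σ : RamState} (h5 : σ.reg 5 = 0) :
    (storeMin A e).output σ = σ.setMem A 0 0 (min (σ.mem A 0 0) (e.eval σ)) := by
  rw [storeMin, output_ifLe]
  by_cases h : (cell A 5 5).eval σ ≤ e.eval σ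
  · rw [if_pos h, output_skip h5]
    simp only [eval, h5] at h
    rw [min_eq_left h, RamState.setMem_self]
  · rw [if_neg h, output_store, h5]
    simp only [eval, h5] at h
    rw [min_eq_right (not_le.mp h).le]

theorem output_storeMax (A : ℕ) (e : RamExpr) {σ : RamState} (h5 : σ.reg 5 = 0) :
    (storeMax A e).output σ = σ.setMem A 0 0 (max (σ.mem A 0 0) (e.eval σ)) := by
  rw [storeMax, output_ifLe]
  by_cases h : e.eval σ ≤ (cell A 5 5).eval σ
  · rw [if_pos h, output_skip h5]
    simp only [eval, h5] at h
    rw [max_eq_left h, RamState.setMem_self]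
  · rw [if_neg h, output_store, h5]
    simp only [eval, h5] at h
    rw [max_eq_right (not_le.mp h).le]

theorem steps_storeMin_le (A : ℕ) (e : RamExpr) (σ : RamState) :
    (storeMin A e).steps σ ≤ 2 * e.cost + 3 := by
  rw [storeMin, steps_ifLe, steps_skip, steps_store]
  simp only [cost]
  split_ifs <;> omega

theorem steps_storeMax_le (A : ℕ) (e : RamExpr) (σ : RamState) :
    (storeMax A e).steps σ ≤ 2 * e.cost + 3 := by
  rw [storeMax, steps_ifLe, steps_skip, steps_store]
  simp only [cost]
  split_ifs <;> omega

/-- The weight of the `k`-th layer. -/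
def weightExpr (h : ℚ) (K k : ℕ) : RamExpr :=
  mul (exp (const (-(k * h)))) (if k + 1 = K then
    div (sub (const 1) (exp (const (-h)))) (const h) else
    mul (sub (const 1) (exp (const (-h)))) (div (sub (const 1) (exp (const (-h)))) (const h)))

theorem eval_weightExpr (h : ℚ) (K k : ℕ) (σ : RamState) :
    (weightExpr h K k).eval σ = layerWeight h K k := by
  unfold weightExpr layerWeight
  split_ifs <;> simp [eval]

theorem cost_weightExpr (h : ℚ) (K k : ℕ) : (weightExpr h K k).cost ≤ 20 := by
  unfold weightExpr
  split_ifs <;> simp [cost]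

/-- Computes the number `m * K` of layers in the register `3`, the numbers of rows and columns in
the registers `13` and `14`, and their product in the register `12`. -/
def sizeProg (K : ℕ) : RamProg :=
  seq (loop 1 (unroll (fun _ => incr 3) K)) (seq (copy 13 0) (seq (incr 13) (seq (copy 14 3)
    (seq (incr 14) (loop 13 (loop 14 (incr 12)))))))

/-- Writes the capacities of the layered network to the array `3`. -/
def capProg (h : ℚ) (K : ℕ) : RamProg :=
  seq (forLoop 6 0 (seq (store 3 6 3 (cell 1 6 5)) (seq (zero 8) (forLoop 7 1 (unroll (fun k =>
      seq (store 3 6 8 (mul (mul (cell 0 6 7) (cell 1 6 5)) (weightExpr h K k))) (incr 8)) K)))))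
    (seq (zero 8) (forLoop 7 1 (unroll (fun k =>
      seq (store 3 0 8 (mul (mul (const (k + 1)) (const h)) (weightExpr h K k))) (incr 8)) K)))

theorem loop_incr_spec (r s : ℕ) (σ : RamState) :
    (loop r (incr s)).output σ = σ.setReg s (σ.reg s + σ.reg r) ∧
      (loop r (incr s)).steps σ ≤ σ.reg r * 2 + 1 :=
  loop_spec (N := 1) (fun k τ => τ = σ.setReg s (σ.reg s + k)) rfl (σ.setReg_self s).symm
    (by rintro k _ τ rfl; simp [RamState.setReg_setReg, add_assoc])

theorem sizeProg_spec (K : ℕ) {σ : RamState} (h5 : σ.reg 5 = 0) (h3 : σ.reg 3 = 0)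
    (h12 : σ.reg 12 = 0) :
    (sizeProg K).output σ = (((σ.setReg 3 (σ.reg 1 * K)).setReg 13 (σ.reg 0 + 1)).setReg 14
      (σ.reg 1 * K + 1)).setReg 12 ((σ.reg 0 + 1) * (σ.reg 1 * K + 1)) ∧
    (sizeProg K).steps σ ≤ σ.reg 1 * (K + 2) + (σ.reg 0 + 1) * (σ.reg 1 * K * 2 + 4) + 6 := by
  have hA := loop_spec (fun j τ => τ = σ.setReg 3 (j * K)) (c := unroll (fun _ => incr 3) K)
    (r := 1) (N := K * 1 + 1) (σ := σ) rfl (by rw [zero_mul, ← h3, σ.setReg_self]) (by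
      rintro j _ τ rfl
      have := unroll_spec (fun k τ => τ = σ.setReg 3 (j * K + k)) (p := fun _ => incr 3) (N := 1)
        (K := K) (σ := σ.setReg 3 (j * K)) (by simp [h5]) rfl (by
          rintro k _ τ rfl; simp [RamState.setReg_setReg, add_assoc])
      exact ⟨by rw [this.1, Nat.succ_mul], this.2⟩)
  set σ1 := (((σ.setReg 3 (σ.reg 1 * K)).setReg 13 (σ.reg 0 + 1)).setReg 14
      (σ.reg 1 * K + 1)) with hσ1
  have hB := loop_spec (fun j τ => τ = σ1.setReg 12 (j * (σ.reg 1 * K + 1)))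
    (c := loop 14 (incr 12)) (r := 13) (n := σ.reg 0 + 1) (N := (σ.reg 1 * K + 1) * 2 + 1) (σ := σ1)
    (by simp [hσ1]) (by
      rw [zero_mul, ← show σ1.reg 12 = 0 by simp [hσ1, h12], σ1.setReg_self]) (by
      rintro j _ τ rfl
      have := loop_incr_spec 14 12 (σ1.setReg 12 (j * (σ.reg 1 * K + 1)))
      have e : (σ1.setReg 12 (j * (σ.reg 1 * K + 1))).reg 14 = σ.reg 1 * K + 1 := by simp [hσ1]
      rw [e] at this
      refine ⟨?_, this.2⟩
      rw [this.1]
      simp [RamState.setReg_setReg, Nat.succ_mul])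
  have e : (incr 14).output ((copy 14 3).output ((incr 13).output ((copy 13 0).output
      (σ.setReg 3 (σ.reg 1 * K))))) = σ1 := by
    simp [hσ1, RamState.setReg_setReg]
  constructor
  · rw [sizeProg]
    simp only [output_seq]
    rw [hA.1, e, hB.1]
  · rw [sizeProg]
    simp only [steps_seq]
    rw [hA.1, e]
    have h1 := hA.2
    have h2 := hB.2
    simp only [steps_incr, steps_copy]
    have e1 : σ.reg 1 * (K * 1 + 1 + 1) = σ.reg 1 * (K + 2) := by ring
    have e2 : (σ.reg 0 + 1) * ((σ.reg 1 * K + 1) * 2 + 1 + 1) =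
      (σ.reg 0 + 1) * (σ.reg 1 * K * 2 + 4) := by ring
    omega

/-- The state `σ` agrees with `ρ` outside the work space of the computations in the network. -/
structure Agrees (ρ σ : RamState) : Prop where
  reg : ∀ r ∈ ({0, 1, 3, 5, 12, 13, 14} : Finset ℕ), σ.reg r = ρ.reg r
  mem : ∀ A ∈ ({0, 1, 3, 4} : Finset ℕ), σ.mem A = ρ.mem A

theorem Agrees.refl (σ : RamState) : Agrees σ σ := ⟨fun _ _ => rfl, fun _ _ => rfl⟩

theorem Agrees.trans {ρ σ τ : RamState} (h : Agrees ρ σ) (h' : Agrees σ τ) : Agrees ρ τ :=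
  ⟨fun r hr => (h'.reg r hr).trans (h.reg r hr), fun A hA => (h'.mem A hA).trans (h.mem A hA)⟩

theorem Agrees.setReg {ρ σ : RamState} (h : Agrees ρ σ) {r : ℕ} (v : ℕ)
    (hr : r ∉ ({0, 1, 3, 5, 12, 13, 14} : Finset ℕ)) : Agrees ρ (σ.setReg r v) where
  reg s hs := by
    rw [RamState.setReg_reg, if_neg (by rintro rfl; exact hr hs)]
    exact h.reg s hs
  mem := h.mem

theorem Agrees.setMem {ρ σ : RamState} (h : Agrees ρ σ) {A : ℕ} (u v : ℕ) (x : ℝ)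
    (hA : A ∉ ({0, 1, 3, 4} : Finset ℕ)) : Agrees ρ (σ.setMem A u v x) where
  reg := h.reg
  mem B hB := by
    rw [← h.mem B hB]
    funext u' v'
    rw [RamState.setMem_mem, if_neg]
    rintro ⟨rfl, _⟩
    exact hA hB

/-- The state agrees with `ρ` outside the work space, except that an array `A` contains `F` only in
the cells `P`, and `0` elsewhere. -/
structure IsPartial (ρ : RamState) (A : ℕ) (F : ℕ → ℕ → ℝ) (P : ℕ → ℕ → Prop) (σ : RamState) :
    Prop where
  reg : ∀ r ∈ ({0, 1, 3, 5, 12, 13, 14} : Finset ℕ), σ.reg r = ρ.reg r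
  mem : ∀ B ∈ ({0, 1, 3, 4} : Finset ℕ), B ≠ A → σ.mem B = ρ.mem B
  cell : ∀ u v, σ.mem A u v = if P u v then F u v else 0

theorem IsPartial.setReg {ρ σ : RamState} {A : ℕ} {F : ℕ → ℕ → ℝ} {P : ℕ → ℕ → Prop}
    (h : IsPartial ρ A F P σ) {r : ℕ} (v : ℕ)
    (hr : r ∉ ({0, 1, 3, 5, 12, 13, 14} : Finset ℕ)) : IsPartial ρ A F P (σ.setReg r v) where
  reg s hs := by
    rw [RamState.setReg_reg, if_neg (by rintro rfl; exact hr hs)]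
    exact h.reg s hs
  mem := h.mem
  cell := h.cell

theorem IsPartial.setMem {ρ σ : RamState} {A : ℕ} {F : ℕ → ℕ → ℝ} {P : ℕ → ℕ → Prop}
    (h : IsPartial ρ A F P σ) (u v : ℕ) :
    IsPartial ρ A F (fun u' v' => P u' v' ∨ (u' = u ∧ v' = v)) (σ.setMem A u v (F u v)) where
  reg := h.reg
  mem B hB hBA := by
    rw [← h.mem B hB hBA]
    funext u' v'
    rw [RamState.setMem_mem, if_neg]
    rintro ⟨rfl, _⟩
    exact hBA rfl
  cell u' v' := by
    rw [RamState.setMem_mem, h.cell u' v']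
    by_cases h1 : u' = u ∧ v' = v
    · simp [h1]
    · simp [h1]

/-- The set of cells written so far matters only where `F` does not vanish, because the array is
initially zero. -/
theorem IsPartial.congr {ρ σ : RamState} {A : ℕ} {F : ℕ → ℕ → ℝ} {P Q : ℕ → ℕ → Prop}
    (h : IsPartial ρ A F P σ) (hPQ : ∀ u v, F u v ≠ 0 → (P u v ↔ Q u v)) :
    IsPartial ρ A F Q σ where
  reg := h.reg
  mem := h.mem
  cell u v := by
    rw [h.cell u v]
    by_cases hF : F u v = 0
    · simp [hF]
    · simp [hPQ u v hF]

end RamProg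

namespace TypeGraph
variable {G : TypeGraph}
open RamProg RamExpr

/-- The state in which the layered network is stored, with the loads `f`. -/
def netState (G : TypeGraph) (h : ℝ) (K : ℕ) (f : ℕ → ℕ → ℝ) : RamState where
  reg := fun r => if r = 0 then G.n else if r = 1 then G.m else if r = 3 then G.m * K else
    if r = 12 then (G.n + 1) * (G.m * K + 1) else if r = 13 then G.n + 1 else
    if r = 14 then G.m * K + 1 else 0
  mem := fun A => if A = 3 then G.layerCap h K else if A = 4 then f else G.encode.mem A

theorem capProg_spec {h : ℚ} {K : ℕ} {σ : RamState}
    (hσ : IsPartial (G.netState h K 0) 3 (G.layerCap h K) (fun _ _ => False) σ) :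
    Agrees (G.netState h K 0) ((capProg h K).output σ) ∧
      (capProg h K).steps σ ≤ G.n * (G.m * (K * 40 + 3) + 10) + G.m * (K * 40 + 3) + 10 := by
  have hregs : ∀ P τ, IsPartial (G.netState h K 0) 3 (G.layerCap h K) P τ →
      τ.reg 0 = G.n ∧ τ.reg 1 = G.m ∧ τ.reg 3 = G.m * K ∧ τ.reg 5 = 0 := fun P τ hτ =>
    ⟨hτ.reg 0 (by simp), hτ.reg 1 (by simp), hτ.reg 3 (by simp), hτ.reg 5 (by simp)⟩
  have hmems : ∀ P τ, IsPartial (G.netState h K 0) 3 (G.layerCap h K) P τ →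
      τ.mem 0 = G.encode.mem 0 ∧ τ.mem 1 = G.encode.mem 1 := fun P τ hτ =>
    ⟨hτ.mem 0 (by simp) (by simp), hτ.mem 1 (by simp) (by simp)⟩
  have hrow : ∀ i < G.n, ∀ τ : RamState, τ.reg 6 = i →
      IsPartial (G.netState h K 0) 3 (G.layerCap h K) (fun u _ => u < i) τ →
      let c := seq (store 3 6 3 (cell 1 6 5)) (seq (zero 8) (forLoop 7 1 (unroll (fun k =>
        seq (store 3 6 8 (mul (mul (cell 0 6 7) (cell 1 6 5)) (weightExpr h K k))) (incr 8)) K)))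
      (c.output τ).reg 6 = i ∧
        IsPartial (G.netState h K 0) 3 (G.layerCap h K) (fun u _ => u < i + 1) (c.output τ) ∧
        c.steps τ ≤ G.m * (K * 40 + 1 + 2) + 6 := by
    intro i hi τ h6 hτ c
    obtain ⟨_, _, r3, r5⟩ := hregs _ _ hτ
    have e1 : (cell 1 6 5).eval τ = G.layerCap h K i (G.m * K) := by
      rw [show G.layerCap h K i (G.m * K) = _ from layerCap_source h K ⟨i, hi⟩]
      simp only [eval, h6, r5]
      rw [(hmems _ _ hτ).2]
      simp [encode, vecCells, hi]
    have hτ1 : IsPartial (G.netState h K 0) 3 (G.layerCap h K)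
        (fun u v => u < i ∨ (u = i ∧ v = G.m * K))
        (((store 3 6 3 (cell 1 6 5)).output τ).setReg 8 0) := by
      rw [output_store, e1, h6, r3]
      exact (hτ.setMem i (G.m * K)).setReg _ (by simp)
    have := forLoop_spec (σ := ((store 3 6 3 (cell 1 6 5)).output τ).setReg 8 0) (idx := 7) (r := 1)
      (N := K * 40 + 1) (n := G.m)
      (c := unroll (fun k =>
        seq (store 3 6 8 (mul (mul (cell 0 6 7) (cell 1 6 5)) (weightExpr h K k))) (incr 8)) K)
      (fun j ω => ω.reg 6 = i ∧ ω.reg 8 = j * K ∧ IsPartial (G.netState h K 0) 3 (G.layerCap h K)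
        (fun u v => u < i ∨ (u = i ∧ (v = G.m * K ∨ v < j * K))) ω) (by norm_num)
      (hregs _ _ hτ1).2.1 ?_ ?_
    · obtain ⟨⟨⟨h1, h2, h3⟩, _⟩, h5⟩ := this
      refine ⟨h1, h3.congr fun u v huv => ?_, ?_⟩
      · have : v ≤ G.m * K := by
          by_contra hv
          refine huv ?_
          rw [layerCap, if_neg (by omega), if_neg (by omega), if_neg (by omega)]
        constructor <;> intro <;> omega
      · simp only [c, steps_seq, steps_store, steps_zero, cost, output_zero]
        omega
    · refine ⟨by simp [h6], by simp, (hτ1.setReg _ (by simp)).congr fun u v _ => ?_⟩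
      simp
    · rintro j hj ω h7 ⟨h6, h8, hω⟩
      have := unroll_spec (fun k υ => υ.reg 6 = i ∧ υ.reg 7 = j ∧ υ.reg 8 = j * K + k ∧
        IsPartial (G.netState h K 0) 3 (G.layerCap h K)
        (fun u v => u < i ∨ (u = i ∧ (v = G.m * K ∨ v < j * K + k))) υ) (p := fun k =>
        seq (store 3 6 8 (mul (mul (cell 0 6 7) (cell 1 6 5)) (weightExpr h K k))) (incr 8))
        (N := 40) (K := K) (σ := ω) (hregs _ _ hω).2.2.2 ⟨h6, h7, h8, hω⟩ ?_
      · obtain ⟨⟨h1, h2, h3, h4⟩, h5⟩ := this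
        refine ⟨h2, ⟨by simpa using h1, by simpa [Nat.succ_mul] using h3, ?_⟩, h5⟩
        rw [Nat.succ_mul]
        exact h4.setReg _ (by simp)
      · rintro k hk υ ⟨h6, h7, h8, hυ⟩
        have e2 : (mul (mul (cell 0 6 7) (cell 1 6 5)) (weightExpr h K k)).eval υ =
            G.layerCap h K i (j * K + k) := by
          simp only [eval, eval_weightExpr, h6, h7, (hregs _ _ hυ).2.2.2]
          rw [(hmems _ _ hυ).1, (hmems _ _ hυ).2, layerCap, if_pos ⟨hi, layer_lt hj hk⟩,
            layer_div hk, layer_mod hk]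
        have hc := cost_weightExpr h K k
        refine ⟨?_, ?_⟩
        · rw [output_seq, output_store, e2, h6, h8, output_incr]
          refine ⟨by simpa using h6, by simpa using h7, by simp [h8, add_assoc],
            ((hυ.setMem i (j * K + k)).setReg _ (by simp)).congr fun u v _ => ?_⟩
          constructor <;> intro <;> omega
        · simp only [steps_seq, steps_store, steps_incr, cost]
          omega
  have hA := forLoop_spec (σ := σ) (idx := 6) (r := 0) (N := G.m * (K * 40 + 1 + 2) + 6) (n := G.n)
    (c := seq (store 3 6 3 (cell 1 6 5)) (seq (zero 8) (forLoop 7 1 (unroll (fun k =>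
        seq (store 3 6 8 (mul (mul (cell 0 6 7) (cell 1 6 5)) (weightExpr h K k))) (incr 8)) K))))
    (fun i τ => IsPartial (G.netState h K 0) 3 (G.layerCap h K) (fun u _ => u < i) τ)
    (by norm_num) (hregs _ _ hσ).1 ((hσ.setReg _ (by simp)).congr fun u v _ => by simp)
    (fun i hi τ h6 hτ => ⟨(hrow i hi τ h6 hτ).1, (hrow i hi τ h6 hτ).2.1.setReg _ (by simp),
      (hrow i hi τ h6 hτ).2.2⟩)
  rw [capProg, output_seq, steps_seq]
  set σ1 := (forLoop 6 0 (seq (store 3 6 3 (cell 1 6 5)) (seq (zero 8) (forLoop 7 1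
    (unroll (fun k => seq (store 3 6 8 (mul (mul (cell 0 6 7) (cell 1 6 5)) (weightExpr h K k)))
      (incr 8)) K))))).output σ with hσ1
  obtain ⟨⟨hσ1', _⟩, hst⟩ := hA
  have hB := forLoop_spec (σ := σ1.setReg 8 0) (idx := 7) (r := 1) (N := K * 40 + 1) (n := G.m)
      (c := unroll (fun k =>
        seq (store 3 0 8 (mul (mul (const (k + 1)) (const h)) (weightExpr h K k))) (incr 8)) K)
      (fun j ω => ω.reg 8 = j * K ∧ IsPartial (G.netState h K 0) 3 (G.layerCap h K)
        (fun u v => u < G.n ∨ (u = G.n ∧ v < j * K)) ω) (by norm_num)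
      (by simpa using (hregs _ _ hσ1').2.1) ?_ ?_
  · obtain ⟨⟨⟨h1, h2⟩, _⟩, h5⟩ := hB
    refine ⟨⟨h2.reg, fun A hA => ?_⟩, ?_⟩
    · by_cases hA3 : A = 3
      · subst hA3
        funext u v
        rw [show (G.netState h K 0).mem 3 u v = G.layerCap h K u v by simp [netState]]
        change ((forLoop 7 1 _).output (σ1.setReg 8 0)).mem 3 u v = _
        rw [h2.cell u v]
        split_ifs with hP
        · rfl
        · rw [layerCap, if_neg (by omega), if_neg (by omega), if_neg (by omega)]
      · exact h2.mem A hA hA3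
    · simp only [steps_seq, steps_zero, output_zero]
      have e1 : G.n * (G.m * (K * 40 + 1 + 2) + 6 + 2) ≤ G.n * (G.m * (K * 40 + 3) + 10) := by
        refine Nat.mul_le_mul_left G.n ?_
        linarith
      have e2 : G.m * (K * 40 + 1 + 2) = G.m * (K * 40 + 3) := rfl
      linarith
  · refine ⟨by simp, ((hσ1'.setReg _ (by simp)).setReg _ (by simp)).congr fun u v _ => by simp⟩
  · rintro j hj ω h7 ⟨h8, hω⟩
    have := unroll_spec (fun k υ => υ.reg 7 = j ∧ υ.reg 8 = j * K + k ∧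
      IsPartial (G.netState h K 0) 3 (G.layerCap h K)
      (fun u v => u < G.n ∨ (u = G.n ∧ v < j * K + k)) υ) (p := fun k =>
      seq (store 3 0 8 (mul (mul (const (k + 1)) (const h)) (weightExpr h K k))) (incr 8))
      (N := 40) (K := K) (σ := ω) (hregs _ _ hω).2.2.2 ⟨h7, h8, hω⟩ ?_
    · obtain ⟨⟨h2, h3, h4⟩, h5⟩ := this
      refine ⟨h2, ⟨by simpa [Nat.succ_mul] using h3, ?_⟩, h5⟩
      rw [Nat.succ_mul]
      exact h4.setReg _ (by simp)
    · rintro k hk υ ⟨h7, h8, hυ⟩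
      have e2 : (mul (mul (const (k + 1)) (const h)) (weightExpr h K k)).eval υ =
          G.layerCap h K G.n (j * K + k) := by
        rw [layerCap_sink h (⟨j, hj⟩ : Fin G.m) hk]
        simp [eval, eval_weightExpr]
      have hc := cost_weightExpr h K k
      refine ⟨?_, ?_⟩
      · rw [output_seq, output_store, e2, (hregs _ _ hυ).1, h8, output_incr]
        refine ⟨by simpa using h7, by simp [h8, add_assoc],
          ((hυ.setMem G.n (j * K + k)).setReg _ (by simp)).congr fun u v _ => ?_⟩
        constructor <;> intro <;> omega
      · simp only [steps_seq, steps_store, steps_incr, cost]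
        omega

end TypeGraph

/-! ### A program for the multiplicative weights method -/

namespace RamProg
open RamExpr

/-- The price of the resource in the registers `r` and `s`. -/
def priceExpr (ε : ℚ) (r s : ℕ) : RamExpr :=
  div (exp (mul (const ε) (div (cell 4 r s) (cell 3 r s)))) (cell 3 r s)

/-- The length of the path through the edge in the registers `6` and `7`. -/
def lengthExpr (ε : ℚ) : RamExpr :=
  add (add (priceExpr ε 6 7) (priceExpr ε 6 3)) (priceExpr ε 0 7)

/-- Makes the edge in the registers `6` and `7` the best one so far. -/
def recordPath : RamProg :=
  seq (store 6 5 5 (cell 5 5 5)) (seq (copy 9 6) (seq (copy 10 7) (seq (zero 11) (incr 11))))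

/-- Compares the edge in the registers `6` and `7` with the best one so far. -/
def comparePath (ε : ℚ) : RamProg :=
  ifLe (cell 3 6 7) (const 0) skip (seq (store 5 5 5 (lengthExpr ε))
    (ifEq 11 5 recordPath (ifLe (cell 6 5 5) (cell 5 5 5) skip recordPath)))

/-- Finds an edge, in the registers `9` and `10`, on a shortest path; the register `11` tells
whether there is any. -/
def shortestProg (ε : ℚ) : RamProg :=
  seq (zero 11) (forLoop 6 0 (forLoop 7 3 (comparePath ε)))

/-- Saturates the path through the edge in the registers `9` and `10`. -/
def pushProg : RamProg :=
  seq (store 6 5 5 (cell 3 9 10)) (seq (storeMin 6 (cell 3 9 3)) (seq (storeMin 6 (cell 3 0 10))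
    (seq (store 4 9 10 (add (cell 4 9 10) (cell 6 5 5)))
      (seq (store 4 9 3 (add (cell 4 9 3) (cell 6 5 5)))
        (store 4 0 10 (add (cell 4 0 10) (cell 6 5 5)))))))

/-- A round of the multiplicative weights method. -/
def roundProg (ε : ℚ) : RamProg := seq (shortestProg ε) (ifEq 11 5 skip pushProg)

/-- The rounds of the multiplicative weights method: their number is `N` times the square of the
number of resources. -/
def roundsProg (ε : ℚ) (N : ℕ) : RamProg :=
  unroll (fun _ => loop 12 (loop 12 (roundProg ε))) N

/-- The registers `9`, `10` and `11` and the entry `(0, 0)` of the array `6` describe a shortest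
path among those through an edge that satisfies `P`. -/
def IsShortest (n V : ℕ) (c : ℕ → ℕ → ℝ) (len : ℕ → ℕ → ℝ) (P : ℕ → ℕ → Prop) (σ : RamState) :
    Prop :=
  (σ.reg 11 = 0 ∧ ∀ i < n, ∀ v < V, P i v → ¬ 0 < c i v) ∨
  (σ.reg 11 = 1 ∧ σ.reg 9 < n ∧ σ.reg 10 < V ∧ 0 < c (σ.reg 9) (σ.reg 10) ∧
    σ.mem 6 0 0 = len (σ.reg 9) (σ.reg 10) ∧
    ∀ i < n, ∀ v < V, P i v → 0 < c i v → len (σ.reg 9) (σ.reg 10) ≤ len i v)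

theorem IsShortest.congr {n V : ℕ} {c len : ℕ → ℕ → ℝ} {P Q : ℕ → ℕ → Prop} {σ τ : RamState}
    (h : IsShortest n V c len P σ) (hQ : ∀ i < n, ∀ v < V, Q i v → P i v)
    (h9 : τ.reg 9 = σ.reg 9) (h10 : τ.reg 10 = σ.reg 10) (h11 : τ.reg 11 = σ.reg 11)
    (h6 : τ.mem 6 0 0 = σ.mem 6 0 0) : IsShortest n V c len Q τ := by
  unfold IsShortest
  rw [h9, h10, h11, h6]
  rcases h with ⟨h1, h2⟩ | ⟨h1, h2, h3, h4, h5, h6⟩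
  · exact Or.inl ⟨h1, fun i hi v hv hq => h2 i hi v hv (hQ i hi v hv hq)⟩
  · exact Or.inr ⟨h1, h2, h3, h4, h5, fun i hi v hv hq => h6 i hi v hv (hQ i hi v hv hq)⟩

theorem comparePath_spec (ε : ℚ) {n V i v : ℕ} {ρ τ : RamState} {P : ℕ → ℕ → Prop}
    (hn : ρ.reg 0 = n) (hV : ρ.reg 3 = V) (h5 : ρ.reg 5 = 0) (hτ : Agrees ρ τ) (hi : i < n)
    (hv : v < V) (h6 : τ.reg 6 = i) (h7 : τ.reg 7 = v)
    (hs : IsShortest n V (ρ.mem 3) (pathLength ε (ρ.mem 3) (ρ.mem 4) n V) P τ) :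
    let υ := (comparePath ε).output τ
    Agrees ρ υ ∧ υ.reg 6 = i ∧ υ.reg 7 = v ∧
      IsShortest n V (ρ.mem 3) (pathLength ε (ρ.mem 3) (ρ.mem 4) n V)
        (fun i' v' => P i' v' ∨ (i' = i ∧ v' = v)) υ ∧ (comparePath ε).steps τ ≤ 50 := by
  have r0 : τ.reg 0 = n := (hτ.reg 0 (by simp)).trans hn
  have r3 : τ.reg 3 = V := (hτ.reg 3 (by simp)).trans hV
  have r5 : τ.reg 5 = 0 := (hτ.reg 5 (by simp)).trans h5
  have m3 : τ.mem 3 = ρ.mem 3 := hτ.mem 3 (by simp)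
  have m4 : τ.mem 4 = ρ.mem 4 := hτ.mem 4 (by simp)
  have hcond : (cell 3 6 7).eval τ ≤ (const 0).eval τ ↔ ρ.mem 3 i v ≤ 0 := by
    simp [eval, h6, h7, m3]
  have hlen : (lengthExpr ε).eval τ = pathLength ε (ρ.mem 3) (ρ.mem 4) n V i v := by
    simp [lengthExpr, priceExpr, eval, h6, h7, m3, m4, r0, r3, pathLength, price]
  set len := pathLength ε (ρ.mem 3) (ρ.mem 4) n V with hlen'
  simp only
  rw [comparePath, output_ifLe, steps_ifLe]
  by_cases hc : (cell 3 6 7).eval τ ≤ (const 0).eval τ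
  · rw [if_pos hc, if_pos hc, output_skip r5, steps_skip]
    refine ⟨hτ, h6, h7, ?_, by simp [cost]⟩
    rw [hcond] at hc
    rcases hs with ⟨h1, h2⟩ | ⟨h1, h2, h3, h4, h5, h6⟩
    · refine Or.inl ⟨h1, fun i' hi' v' hv' hP => ?_⟩
      rcases hP with hP | ⟨rfl, rfl⟩
      · exact h2 i' hi' v' hv' hP
      · exact not_lt.mpr hc
    · refine Or.inr ⟨h1, h2, h3, h4, h5, fun i' hi' v' hv' hP hpos => ?_⟩
      rcases hP with hP | ⟨rfl, rfl⟩
      · exact h6 i' hi' v' hv' hP hpos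
      · exact absurd hpos (not_lt.mpr hc)
  · rw [if_neg hc, if_neg hc, output_seq, steps_seq]
    rw [hcond, not_le] at hc
    have hν : (store 5 5 5 (lengthExpr ε)).output τ = τ.setMem 5 0 0 (len i v) := by
      rw [output_store, hlen, r5]
    rw [hν]
    set ν := τ.setMem 5 0 0 (len i v) with hνdef
    have aν : Agrees ρ ν := hτ.setMem _ _ _ (by simp)
    have hrec : recordPath.output ν = ((((ν.setMem 6 0 0 (len i v)).setReg 9 i).setReg 10 v).setReg
        11 0).setReg 11 1 := by
      simp [recordPath, eval, hνdef, r5, h6, h7]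
    have hrs : recordPath.steps ν = 6 := by simp [recordPath, cost]
    have hcl : (lengthExpr ε).cost = 26 := by simp [lengthExpr, priceExpr, cost]
    have hrecord : (∀ i' < n, ∀ v' < V, P i' v' → 0 < ρ.mem 3 i' v' → len i v ≤ len i' v') →
        Agrees ρ (recordPath.output ν) ∧ (recordPath.output ν).reg 6 = i ∧
        (recordPath.output ν).reg 7 = v ∧ IsShortest n V (ρ.mem 3) len
          (fun i' v' => P i' v' ∨ (i' = i ∧ v' = v)) (recordPath.output ν) := by
      intro hmin
      rw [hrec]
      refine ⟨((((aν.setMem _ _ _ (by simp)).setReg _ (by simp)).setReg _ (by simp)).setReg _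
        (by simp)).setReg _ (by simp), by simp [hνdef, h6], by simp [hνdef, h7],
        Or.inr ⟨by simp, by simpa using hi, by simpa using hv, by simpa using hc, by simp, ?_⟩⟩
      intro i' hi' v' hv' hP hpos
      simp only [RamState.setReg_reg]
      norm_num
      rcases hP with hP | ⟨rfl, rfl⟩
      · exact hmin i' hi' v' hv' hP hpos
      · exact le_rfl
    rw [output_ifEq, steps_ifEq, output_ifLe, steps_ifLe]
    have e11 : ν.reg 11 = ν.reg 5 ↔ τ.reg 11 = 0 := by simp [hνdef, r5]
    have r5ν : ν.reg 5 = 0 := r5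
    rcases hs with ⟨h1, h2⟩ | ⟨h1, h2, h3, h4, h5, h6'⟩
    · rw [if_pos (e11.mpr h1), if_pos (e11.mpr h1)]
      obtain ⟨a1, a2, a3, a4⟩ := hrecord fun i' hi' v' hv' hP hpos =>
        absurd hpos (h2 i' hi' v' hv' hP)
      exact ⟨a1, a2, a3, a4, by simp only [hrs, steps_store, hcl, cost]; omega⟩
    · have hne : ¬ ν.reg 11 = ν.reg 5 := fun h => by
        rw [e11, h1] at h
        omega
      rw [if_neg hne, if_neg hne]
      have hcmp : (cell 6 5 5).eval ν ≤ (cell 5 5 5).eval ν ↔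
          len (τ.reg 9) (τ.reg 10) ≤ len i v := by
        simp [eval, hνdef, r5, h5]
      by_cases hle : (cell 6 5 5).eval ν ≤ (cell 5 5 5).eval ν
      · rw [if_pos hle, if_pos hle, output_skip r5ν]
        refine ⟨aν, h6, h7, Or.inr ⟨h1, h2, h3, h4, by simpa [hνdef] using h5,
          fun i' hi' v' hv' hP hpos => ?_⟩,
          by simp only [steps_skip, steps_store, hcl, cost]; omega⟩
        rcases hP with hP | ⟨rfl, rfl⟩
        · exact h6' i' hi' v' hv' hP hpos
        · exact hcmp.mp hle
      · rw [if_neg hle, if_neg hle]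
        rw [hcmp, not_le] at hle
        obtain ⟨a1, a2, a3, a4⟩ := hrecord fun i' hi' v' hv' hP hpos =>
          hle.le.trans (h6' i' hi' v' hv' hP hpos)
        exact ⟨a1, a2, a3, a4, by simp only [hrs, steps_store, hcl, cost]; omega⟩

theorem shortestProg_spec (ε : ℚ) {n V : ℕ} {ρ : RamState} (hn : ρ.reg 0 = n) (hV : ρ.reg 3 = V)
    (h5 : ρ.reg 5 = 0) :
    Agrees ρ ((shortestProg ε).output ρ) ∧
      IsShortest n V (ρ.mem 3) (pathLength ε (ρ.mem 3) (ρ.mem 4) n V) (fun _ _ => True)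
        ((shortestProg ε).output ρ) ∧
      (shortestProg ε).steps ρ ≤ n * (V * 52 + 4) + 3 := by
  have := forLoop_spec (σ := ρ.setReg 11 0) (idx := 6) (r := 0) (N := V * (50 + 2) + 2) (n := n)
    (c := forLoop 7 3 (comparePath ε))
    (fun i τ => Agrees ρ τ ∧ IsShortest n V (ρ.mem 3) (pathLength ε (ρ.mem 3) (ρ.mem 4) n V)
      (fun i' _ => i' < i) τ) (by norm_num) (by simpa using hn) ?_ ?_
  · obtain ⟨⟨⟨h1, h2⟩, _⟩, h4⟩ := this
    rw [shortestProg, output_seq, steps_seq, output_zero, steps_zero]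
    refine ⟨h1, h2.congr (fun i hi v hv _ => hi) rfl rfl rfl rfl, ?_⟩
    have e : n * (V * (50 + 2) + 2 + 2) = n * (V * 52 + 4) := rfl
    omega
  · exact ⟨((Agrees.refl ρ).setReg _ (by simp)).setReg _ (by simp),
      Or.inl ⟨by simp, fun i _ v _ h => absurd h (by omega)⟩⟩
  · rintro i hi τ h6 ⟨hτ, hs⟩
    have := forLoop_spec (σ := τ) (idx := 7) (r := 3) (N := 50) (n := V)
      (c := comparePath ε)
      (fun v τ => Agrees ρ τ ∧ τ.reg 6 = i ∧
        IsShortest n V (ρ.mem 3) (pathLength ε (ρ.mem 3) (ρ.mem 4) n V)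
        (fun i' v' => i' < i ∨ (i' = i ∧ v' < v)) τ) (by norm_num)
      ((hτ.reg 3 (by simp)).trans hV) ?_ ?_
    · obtain ⟨⟨⟨h1, h2, h3⟩, _⟩, h4⟩ := this
      refine ⟨h2, ⟨h1.setReg _ (by simp), h3.congr (fun i' hi' v' hv' h => ?_) (by simp) (by simp)
        (by simp) (by simp)⟩, h4⟩
      omega
    · exact ⟨hτ.setReg _ (by simp), by simpa using h6, hs.congr (fun i' hi' v' hv' h => by omega)
        (by simp) (by simp) (by simp) (by simp)⟩
    · rintro v hv υ h7 ⟨hυ, h6, hs⟩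
      obtain ⟨a1, a2, a3, a4, a5⟩ := comparePath_spec ε hn hV h5 hυ hi hv h6 h7 hs
      refine ⟨a3, ⟨a1.setReg _ (by simp), by simpa using a2, a4.congr (fun i' hi' v' hv' h => ?_)
        (by simp) (by simp) (by simp) (by simp)⟩, a5⟩
      omega

theorem pushProg_spec {n V i v : ℕ} {σ : RamState} (hn : σ.reg 0 = n) (hV : σ.reg 3 = V)
    (h5 : σ.reg 5 = 0) (h9 : σ.reg 9 = i) (h10 : σ.reg 10 = v) (hi : i < n) (hv : v < V) :
    (∀ r, (pushProg.output σ).reg r = σ.reg r) ∧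
    (∀ A ∈ ({0, 1, 3} : Finset ℕ), (pushProg.output σ).mem A = σ.mem A) ∧
    (pushProg.output σ).mem 4 = pushFlow (σ.mem 4) n V i v
      (min (σ.mem 3 i v) (min (σ.mem 3 i V) (σ.mem 3 n v))) ∧ pushProg.steps σ ≤ 30 := by
  set γ := min (σ.mem 3 i v) (min (σ.mem 3 i V) (σ.mem 3 n v)) with hγ
  have e1 : (store 6 5 5 (cell 3 9 10)).output σ = σ.setMem 6 0 0 (σ.mem 3 i v) := by
    simp [eval, h5, h9, h10]
  have e2 : (storeMin 6 (cell 3 9 3)).output (σ.setMem 6 0 0 (σ.mem 3 i v)) =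
      σ.setMem 6 0 0 (min (σ.mem 3 i v) (σ.mem 3 i V)) := by
    rw [output_storeMin _ _ (by simpa using h5), RamState.setMem_setMem]
    simp [eval, h9, hV]
  have e3 : (storeMin 6 (cell 3 0 10)).output (σ.setMem 6 0 0 (min (σ.mem 3 i v) (σ.mem 3 i V))) =
      σ.setMem 6 0 0 γ := by
    rw [output_storeMin _ _ (by simpa using h5), RamState.setMem_setMem, hγ, ← min_assoc]
    simp [eval, hn, h10]
  have e4 : (store 4 9 10 (add (cell 4 9 10) (cell 6 5 5))).output (σ.setMem 6 0 0 γ) =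
      (σ.setMem 6 0 0 γ).setMem 4 i v (σ.mem 4 i v + γ) := by
    simp [eval, h5, h9, h10]
  have e5 : (store 4 9 3 (add (cell 4 9 3) (cell 6 5 5))).output
      ((σ.setMem 6 0 0 γ).setMem 4 i v (σ.mem 4 i v + γ)) =
      ((σ.setMem 6 0 0 γ).setMem 4 i v (σ.mem 4 i v + γ)).setMem 4 i V (σ.mem 4 i V + γ) := by
    simp [eval, h5, h9, hV, hv.ne']
  have e6 : (store 4 0 10 (add (cell 4 0 10) (cell 6 5 5))).output
      (((σ.setMem 6 0 0 γ).setMem 4 i v (σ.mem 4 i v + γ)).setMem 4 i V (σ.mem 4 i V + γ)) =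
      (((σ.setMem 6 0 0 γ).setMem 4 i v (σ.mem 4 i v + γ)).setMem 4 i V (σ.mem 4 i V + γ)).setMem
        4 n v (σ.mem 4 n v + γ) := by
    simp [eval, h5, hn, h10, hi.ne']
  have e : pushProg.output σ =
      (((σ.setMem 6 0 0 γ).setMem 4 i v (σ.mem 4 i v + γ)).setMem 4 i V (σ.mem 4 i V + γ)).setMem
        4 n v (σ.mem 4 n v + γ) := by
    rw [pushProg]
    simp only [output_seq]
    rw [e1, e2, e3, e4, e5, e6]
  rw [e]
  refine ⟨fun r => rfl, fun A hA => ?_, ?_, ?_⟩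
  · funext u w
    have h1 : A ≠ 4 := by rintro rfl; simp at hA
    have h2 : A ≠ 6 := by rintro rfl; simp at hA
    simp [h1, h2]
  · funext u w
    simp only [RamState.setMem_mem, true_and, pushFlow]
    by_cases c1 : u = n ∧ w = v
    · rw [if_pos c1, if_pos (Or.inr (Or.inr c1)), c1.1, c1.2]
    · rw [if_neg c1]
      by_cases c2 : u = i ∧ w = V
      · rw [if_pos c2, if_pos (Or.inr (Or.inl c2)), c2.1, c2.2]
      · rw [if_neg c2]
        by_cases c3 : u = i ∧ w = v
        · rw [if_pos c3, if_pos (Or.inl c3), c3.1, c3.2]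
        · rw [if_neg c3, if_neg (by omega), if_neg (by tauto), add_zero]
  · have h1 := steps_storeMin_le 6 (cell 3 9 3) ((store 6 5 5 (cell 3 9 10)).output σ)
    have h2 := steps_storeMin_le 6 (cell 3 0 10)
      ((storeMin 6 (cell 3 9 3)).output ((store 6 5 5 (cell 3 9 10)).output σ))
    simp only [cost] at h1 h2
    simp only [pushProg, steps_seq, steps_store, cost]
    omega

end RamProg

namespace TypeGraph
variable {G : TypeGraph}
open RamProg RamExpr

/-- The network is stored with loads that can occur after `T` rounds. -/
def IsRound (G : TypeGraph) (h ε : ℝ) (K T : ℕ) (σ : RamState) : Prop :=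
  ∃ f, Agrees (G.netState h K f) σ ∧
    FlowInvariant G.n (G.m * K) (G.layerCap h K) ε f T

theorem netState_agrees_regs {h : ℝ} {K : ℕ} {f : ℕ → ℕ → ℝ} {σ : RamState}
    (hσ : Agrees (G.netState h K f) σ) : σ.reg 0 = G.n ∧ σ.reg 1 = G.m ∧ σ.reg 3 = G.m * K ∧
      σ.reg 5 = 0 ∧ σ.reg 12 = (G.n + 1) * (G.m * K + 1) ∧ σ.reg 13 = G.n + 1 ∧
      σ.reg 14 = G.m * K + 1 :=
  ⟨hσ.reg 0 (by simp), hσ.reg 1 (by simp), hσ.reg 3 (by simp), hσ.reg 5 (by simp),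
    hσ.reg 12 (by simp), hσ.reg 13 (by simp), hσ.reg 14 (by simp)⟩

theorem netState_agrees_mem {h : ℝ} {K : ℕ} {f : ℕ → ℕ → ℝ} {σ : RamState}
    (hσ : Agrees (G.netState h K f) σ) : σ.mem 3 = G.layerCap h K ∧ σ.mem 4 = f :=
  ⟨hσ.mem 3 (by simp), hσ.mem 4 (by simp)⟩

theorem roundProg_spec {h ε : ℚ} (h0 : 0 < h) (hε : 0 < ε) (hε1 : ε ≤ 1) {K T : ℕ} {σ : RamState}
    (hσ : G.IsRound h ε K T σ) :
    G.IsRound h ε K (T + 1) ((roundProg ε).output σ) ∧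
      (roundProg ε).steps σ ≤ G.n * (G.m * K * 52 + 4) + 40 := by
  obtain ⟨f, hag, hf⟩ := hσ
  obtain ⟨r0, r1, r3, r5, _⟩ := netState_agrees_regs hag
  obtain ⟨m3, m4⟩ := netState_agrees_mem hag
  obtain ⟨s1, s2, s3⟩ := shortestProg_spec ε r0 r3 r5
  rw [m3, m4] at s2
  rw [roundProg, output_seq, steps_seq, output_ifEq, steps_ifEq]
  set τ := (shortestProg ε).output σ
  have hτ := hag.trans s1
  obtain ⟨t0, t1, t3, t5, _⟩ := netState_agrees_regs hτ
  obtain ⟨n3, n4⟩ := netState_agrees_mem hτ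
  rw [t5]
  rcases s2 with ⟨a1, a2⟩ | ⟨a1, a2, a3, a4, _, a5⟩
  · rw [if_pos a1, if_pos a1, output_skip t5, steps_skip]
    exact ⟨⟨f, hτ, hf.skip fun i hi v hv => a2 i hi v hv trivial⟩, by omega⟩
  · rw [if_neg (by omega), if_neg (by omega)]
    obtain ⟨p1, p2, p3, p4⟩ := pushProg_spec t0 t3 t5 rfl rfl a2 a3
    refine ⟨⟨_, ⟨fun r hr => ?_, fun A hA => ?_⟩,
      hf.push (G.isNetwork_layerCap (by exact_mod_cast h0) K)
      (by exact_mod_cast hε) (by exact_mod_cast hε1) a2 a3 a4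
      fun i hi v hv hpos => a5 i hi v hv trivial hpos⟩, by omega⟩
    · rw [p1]
      exact hτ.reg r hr
    · by_cases hA4 : A = 4
      · subst hA4
        rw [p3, n3, n4]
        simp [netState]
      · rw [p2 A (by simp at hA ⊢; omega), hτ.mem A hA]
        simp [netState, hA4]

theorem roundsProg_spec {h ε : ℚ} (h0 : 0 < h) (hε : 0 < ε) (hε1 : ε ≤ 1) {K N : ℕ} {σ : RamState}
    (hσ : G.IsRound h ε K 0 σ) :
    G.IsRound h ε K (N * ((G.n + 1) * (G.m * K + 1) * ((G.n + 1) * (G.m * K + 1))))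
        ((roundsProg ε N).output σ) ∧
      (roundsProg ε N).steps σ ≤ N * ((G.n + 1) * (G.m * K + 1) * ((G.n + 1) * (G.m * K + 1) *
        (G.n * (G.m * K * 52 + 4) + 40 + 1) + 1 + 1) + 1) + 1 := by
  have hregs : ∀ T τ, G.IsRound h ε K T τ → τ.reg 5 = 0 ∧ τ.reg 12 = (G.n + 1) * (G.m * K + 1) := by
    rintro T τ ⟨f, hf, _⟩
    have := netState_agrees_regs hf
    exact ⟨this.2.2.2.1, this.2.2.2.2.1⟩
  set L := (G.n + 1) * (G.m * K + 1) with hL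
  refine unroll_spec (fun k τ => G.IsRound h ε K (k * (L * L)) τ) (hregs _ _ hσ).1
    (by rwa [zero_mul]) ?_
  intro k _ τ hτ
  have := loop_spec (fun l υ => G.IsRound h ε K (k * (L * L) + l * L) υ)
    (c := loop 12 (roundProg ε)) (hregs _ _ hτ).2 (N := L * (G.n * (G.m * K * 52 + 4) + 40 + 1) + 1)
    (by simpa using hτ) ?_
  · exact ⟨by rw [Nat.succ_mul]; exact this.1, this.2⟩
  · intro l _ υ hυ
    have := loop_spec (fun a ω => G.IsRound h ε K (k * (L * L) + l * L + a) ω) (c := roundProg ε)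
      (hregs _ _ hυ).2 (N := G.n * (G.m * K * 52 + 4) + 40) hυ
      (fun a _ ω hω => roundProg_spec h0 hε hε1 hω)
    exact ⟨by rw [Nat.succ_mul, ← add_assoc]; exact this.1, this.2⟩

end TypeGraph

/-! ### The preprocessing -/

namespace RamProg
open RamExpr

/-- Computes the maximum of `1` and the largest congestion, in the array `7`. The `1` guards against
division by zero in the absence of edges. -/
def congestionProg : RamProg :=
  seq (store 7 5 5 (const 1)) (forLoop 6 13 (forLoop 7 14 (ifLe (cell 3 6 7) (const 0) skip
    (storeMax 7 (div (cell 4 6 7) (cell 3 6 7))))))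

/-- Adds up the layers of the scaled flow, in the array `2`. -/
def collectProg (K : ℕ) : RamProg :=
  forLoop 6 0 (seq (zero 8) (forLoop 7 1 (seq (store 2 6 7 (const 0)) (unroll (fun _ =>
    seq (store 2 6 7 (add (cell 2 6 7) (div (cell 4 6 8) (cell 7 5 5)))) (incr 8)) K))))

/-- Computes a nearly optimal solution of the Natural LP by packing paths in the layered network. -/
def preprocessProg (h ε : ℚ) (K N : ℕ) : RamProg :=
  seq (sizeProg K) (seq (capProg h K) (seq (roundsProg ε N) (seq congestionProg (collectProg K))))

/-- `M` is the maximum of `1` and the congestions of the resources of positive capacity that satisfy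
`P`. -/
structure IsMaxCongestion (c f : ℕ → ℕ → ℝ) (P : ℕ → ℕ → Prop) (M : ℝ) : Prop where
  one_le : 1 ≤ M
  le : ∀ u v, P u v → 0 < c u v → f u v / c u v ≤ M
  attained : M = 1 ∨ ∃ u v, P u v ∧ 0 < c u v ∧ M = f u v / c u v

theorem IsMaxCongestion.congr {c f : ℕ → ℕ → ℝ} {P Q : ℕ → ℕ → Prop} {M : ℝ}
    (h : IsMaxCongestion c f P M) (hPQ : ∀ u v, P u v ↔ Q u v) : IsMaxCongestion c f Q M := by
  obtain rfl : P = Q := by funext u v; exact propext (hPQ u v)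
  exact h

theorem IsMaxCongestion.skip {c f : ℕ → ℕ → ℝ} {P : ℕ → ℕ → Prop} {M : ℝ}
    (h : IsMaxCongestion c f P M) {i v : ℕ} (hc : c i v ≤ 0) :
    IsMaxCongestion c f (fun u w => P u w ∨ (u = i ∧ w = v)) M where
  one_le := h.one_le
  le u w hP hpos := by
    rcases hP with hP | ⟨rfl, rfl⟩
    · exact h.le u w hP hpos
    · exact absurd hpos (not_lt.mpr hc)
  attained := h.attained.imp_right fun ⟨u, w, hP, h⟩ => ⟨u, w, Or.inl hP, h⟩

theorem IsMaxCongestion.max {c f : ℕ → ℕ → ℝ} {P : ℕ → ℕ → Prop} {M : ℝ}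
    (h : IsMaxCongestion c f P M) {i v : ℕ} (hc : 0 < c i v) :
    IsMaxCongestion c f (fun u w => P u w ∨ (u = i ∧ w = v)) (max M (f i v / c i v)) where
  one_le := h.one_le.trans (le_max_left _ _)
  le u w hP hpos := by
    rcases hP with hP | ⟨rfl, rfl⟩
    · exact (h.le u w hP hpos).trans (le_max_left _ _)
    · exact le_max_right _ _
  attained := by
    rcases max_choice M (f i v / c i v) with h1 | h1
    · rw [h1]
      exact h.attained.imp_right fun ⟨u, w, hP, h⟩ => ⟨u, w, Or.inl hP, h⟩
    · exact Or.inr ⟨i, v, Or.inr ⟨rfl, rfl⟩, hc, h1⟩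

end RamProg

namespace TypeGraph
variable {G : TypeGraph}
open RamProg RamExpr

theorem congestionProg_spec {h : ℝ} {K : ℕ} {f : ℕ → ℕ → ℝ} {σ : RamState}
    (hσ : Agrees (G.netState h K f) σ) :
    Agrees (G.netState h K f) (congestionProg.output σ) ∧
      IsMaxCongestion (G.layerCap h K) f (fun u v => u < G.n + 1 ∧ v < G.m * K + 1)
        ((congestionProg.output σ).mem 7 0 0) ∧
      congestionProg.steps σ ≤ (G.n + 1) * ((G.m * K + 1) * 17 + 4) + 4 := by
  obtain ⟨r0, r1, r3, r5, r12, r13, r14⟩ := netState_agrees_regs hσ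
  have hbody : ∀ P : ℕ → ℕ → Prop, ∀ i v : ℕ, ∀ τ : RamState, Agrees (G.netState h K f) τ →
      τ.reg 6 = i → τ.reg 7 = v → IsMaxCongestion (G.layerCap h K) f P (τ.mem 7 0 0) →
      let c := ifLe (cell 3 6 7) (const 0) skip (storeMax 7 (div (cell 4 6 7) (cell 3 6 7)))
      Agrees (G.netState h K f) (c.output τ) ∧ (c.output τ).reg 6 = i ∧ (c.output τ).reg 7 = v ∧
        IsMaxCongestion (G.layerCap h K) f (fun u w => P u w ∨ (u = i ∧ w = v))
          ((c.output τ).mem 7 0 0) ∧ c.steps τ ≤ 15 := by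
    intro P i v τ hτ h6 h7 hM c
    obtain ⟨_, _, _, r5, _⟩ := netState_agrees_regs hτ
    obtain ⟨m3, m4⟩ := netState_agrees_mem hτ
    have hcond : (cell 3 6 7).eval τ ≤ (const 0).eval τ ↔ G.layerCap h K i v ≤ 0 := by
      simp [eval, h6, h7, m3]
    simp only [c]
    rw [output_ifLe, steps_ifLe]
    by_cases hc : (cell 3 6 7).eval τ ≤ (const 0).eval τ
    · rw [if_pos hc, if_pos hc, output_skip r5]
      exact ⟨hτ, h6, h7, hM.skip (hcond.mp hc), by simp [steps_skip, cost]⟩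
    · rw [if_neg hc, if_neg hc, output_storeMax _ _ r5]
      rw [hcond, not_le] at hc
      refine ⟨hτ.setMem _ _ _ (by simp), h6, h7, ?_, ?_⟩
      · rw [RamState.setMem_mem, if_pos ⟨rfl, rfl, rfl⟩]
        simp only [eval, h6, h7, m3, m4]
        exact hM.max hc
      · have := steps_storeMax_le 7 (div (cell 4 6 7) (cell 3 6 7)) τ
        simp only [cost] at this ⊢
        omega
  have e1 : (store 7 5 5 (const 1)).output σ = σ.setMem 7 0 0 1 := by simp [r5, eval]
  have := forLoop_spec (σ := σ.setMem 7 0 0 1) (idx := 6) (r := 13)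
    (N := (G.m * K + 1) * (15 + 2) + 2) (n := G.n + 1)
    (c := forLoop 7 14 (ifLe (cell 3 6 7) (const 0) skip
      (storeMax 7 (div (cell 4 6 7) (cell 3 6 7)))))
    (fun i τ => Agrees (G.netState h K f) τ ∧ IsMaxCongestion (G.layerCap h K) f
      (fun u v => u < i ∧ v < G.m * K + 1) (τ.mem 7 0 0)) (by norm_num) (by simpa using r13) ?_ ?_
  · obtain ⟨⟨⟨h1, h2⟩, _⟩, h4⟩ := this
    rw [congestionProg, output_seq, steps_seq, e1, steps_store]
    refine ⟨h1, h2, ?_⟩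
    have e2 : (G.n + 1) * ((G.m * K + 1) * (15 + 2) + 2 + 2) =
      (G.n + 1) * ((G.m * K + 1) * 17 + 4) := rfl
    simp only [cost]
    omega
  · exact ⟨(hσ.setMem _ _ _ (by simp)).setReg _ (by simp), by simp, by simp, Or.inl (by simp)⟩
  · rintro i hi τ h6 ⟨hτ, hM⟩
    have := forLoop_spec (σ := τ) (idx := 7) (r := 14) (N := 15) (n := G.m * K + 1)
      (c := ifLe (cell 3 6 7) (const 0) skip (storeMax 7 (div (cell 4 6 7) (cell 3 6 7))))
      (fun v τ => Agrees (G.netState h K f) τ ∧ τ.reg 6 = i ∧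
        IsMaxCongestion (G.layerCap h K) f
        (fun u w => (u < i ∧ w < G.m * K + 1) ∨ (u = i ∧ w < v)) (τ.mem 7 0 0)) (by norm_num)
      (netState_agrees_regs hτ).2.2.2.2.2.2 ?_ ?_
    · obtain ⟨⟨⟨h1, h2, h3⟩, _⟩, h4⟩ := this
      refine ⟨h2, ⟨h1.setReg _ (by simp), h3.congr fun u w => ?_⟩, h4⟩
      constructor <;> intro <;> omega
    · refine ⟨hτ.setReg _ (by simp), by simpa using h6, hM.congr fun u w => ?_⟩
      constructor <;> intro <;> omega
    · rintro v hv υ h7 ⟨hυ, h6, hM⟩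
      obtain ⟨a1, a2, a3, a4, a5⟩ := hbody _ i v υ hυ h6 h7 hM
      refine ⟨a3, ⟨a1.setReg _ (by simp), by simpa using a2, a4.congr fun u w => ?_⟩, a5⟩
      constructor <;> intro <;> omega

theorem collectProg_spec {h : ℝ} {K : ℕ} {f : ℕ → ℕ → ℝ} {σ : RamState}
    (hσ : Agrees (G.netState h K f) σ) :
    (∀ i < G.n, ∀ j < G.m, ((collectProg K).output σ).mem 2 i j =
      ∑ k ∈ Finset.range K, f i (j * K + k) / σ.mem 7 0 0) ∧
      (collectProg K).steps σ ≤ G.n * (G.m * (K * 7 + 5) + 5) + 2 := by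
  set M := σ.mem 7 0 0 with hM
  have hrow : ∀ i j : ℕ, ∀ τ : RamState, τ.reg 6 = i → τ.reg 7 = j → τ.reg 8 = j * K →
      Agrees (G.netState h K f) τ → τ.mem 7 0 0 = M →
      let c := seq (store 2 6 7 (const 0)) (unroll (fun _ =>
        seq (store 2 6 7 (add (cell 2 6 7) (div (cell 4 6 8) (cell 7 5 5)))) (incr 8)) K)
      (c.output τ).reg 6 = i ∧ (c.output τ).reg 7 = j ∧ (c.output τ).reg 8 = (j + 1) * K ∧
        Agrees (G.netState h K f) (c.output τ) ∧ (c.output τ).mem 7 0 0 = M ∧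
        (∀ u v, (c.output τ).mem 2 u v = if u = i ∧ v = j then
          ∑ k ∈ Finset.range K, f i (j * K + k) / M else τ.mem 2 u v) ∧ c.steps τ ≤ K * 7 + 3 := by
    intro i j τ h6 h7 h8 hτ hM c
    have e1 : (store 2 6 7 (const 0)).output τ = τ.setMem 2 i j 0 := by simp [h6, h7, eval]
    have := unroll_spec (fun k υ => υ.reg 6 = i ∧ υ.reg 7 = j ∧ υ.reg 8 = j * K + k ∧
      Agrees (G.netState h K f) υ ∧ υ.mem 7 0 0 = M ∧ ∀ u v, υ.mem 2 u v = if u = i ∧ v = j then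
          ∑ k ∈ Finset.range k, f i (j * K + k) / M else τ.mem 2 u v)
      (p := fun _ =>
        seq (store 2 6 7 (add (cell 2 6 7) (div (cell 4 6 8) (cell 7 5 5)))) (incr 8)) (N := 7)
      (K := K) (σ := τ.setMem 2 i j 0) (netState_agrees_regs hτ).2.2.2.1
      ⟨h6, h7, h8, hτ.setMem _ _ _ (by simp), by simpa using hM, fun u v => by simp⟩ ?_
    · obtain ⟨⟨a1, a2, a3, a4, a5, a6⟩, a7⟩ := this
      simp only [c, output_seq, steps_seq, e1]
      refine ⟨a1, a2, by rw [a3, Nat.succ_mul], a4, a5, a6, ?_⟩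
      simp only [steps_store, cost]
      omega
    · rintro k hk υ ⟨h6, h7, h8, hυ, hM, h2⟩
      obtain ⟨_, _, _, r5, _⟩ := netState_agrees_regs hυ
      obtain ⟨_, m4⟩ := netState_agrees_mem hυ
      have e2 : (store 2 6 7 (add (cell 2 6 7) (div (cell 4 6 8) (cell 7 5 5)))).output υ =
          υ.setMem 2 i j (∑ k ∈ Finset.range (k + 1), f i (j * K + k) / M) := by
        rw [output_store]
        simp only [eval, h6, h7, h8, r5, hM, m4]
        rw [h2 i j, if_pos ⟨rfl, rfl⟩, Finset.sum_range_succ]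
      refine ⟨?_, by simp [cost]⟩
      rw [output_seq, e2, output_incr]
      refine ⟨by simpa using h6, by simpa using h7, by simp [h8, add_assoc],
        (hυ.setMem _ _ _ (by simp)).setReg _ (by simp), by simpa using hM, fun u v => ?_⟩
      simp only [RamState.setReg_mem, RamState.setMem_mem, true_and]
      by_cases huv : u = i ∧ v = j
      · rw [if_pos huv, if_pos huv]
      · rw [if_neg huv, if_neg huv, h2 u v, if_neg huv]
  have := forLoop_spec (σ := σ) (idx := 6) (r := 0) (N := G.m * (K * 7 + 3 + 2) + 3) (n := G.n)
    (c := seq (zero 8) (forLoop 7 1 (seq (store 2 6 7 (const 0)) (unroll (fun _ =>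
      seq (store 2 6 7 (add (cell 2 6 7) (div (cell 4 6 8) (cell 7 5 5)))) (incr 8)) K))))
    (fun i τ => Agrees (G.netState h K f) τ ∧ τ.mem 7 0 0 = M ∧ ∀ u < i, ∀ v < G.m,
      τ.mem 2 u v = ∑ k ∈ Finset.range K, f u (v * K + k) / M) (by norm_num)
    (netState_agrees_regs hσ).1 ⟨hσ.setReg _ (by simp), by simp [hM], by simp⟩ ?_
  · obtain ⟨⟨⟨_, _, h1⟩, _⟩, h2⟩ := this
    exact ⟨h1, h2⟩
  · rintro i hi τ h6 ⟨hτ, hM, h2⟩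
    have := forLoop_spec (σ := τ.setReg 8 0) (idx := 7) (r := 1) (N := K * 7 + 3) (n := G.m)
      (c := seq (store 2 6 7 (const 0)) (unroll (fun _ =>
        seq (store 2 6 7 (add (cell 2 6 7) (div (cell 4 6 8) (cell 7 5 5)))) (incr 8)) K))
      (fun j υ => υ.reg 6 = i ∧ υ.reg 8 = j * K ∧ Agrees (G.netState h K f) υ ∧ υ.mem 7 0 0 = M ∧
        ∀ u v, v < G.m → (u < i ∨ (u = i ∧ v < j)) →
          υ.mem 2 u v = ∑ k ∈ Finset.range K, f u (v * K + k) / M) (by norm_num)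
      (by simpa using (netState_agrees_regs hτ).2.1) ?_ ?_
    · obtain ⟨⟨⟨h1, _, h3, h4, h5⟩, _⟩, h6⟩ := this
      rw [output_seq, steps_seq, output_zero, steps_zero]
      exact ⟨h1, ⟨h3.setReg _ (by simp), h4, fun u hu v hv => h5 u v hv (by omega)⟩, by omega⟩
    · exact ⟨by simpa using h6, by simp, (hτ.setReg _ (by simp)).setReg _ (by simp), hM,
        fun u v hv hu => h2 u (by omega) v hv⟩
    · rintro j hj υ h7 ⟨h6, h8, hυ, hM, h2⟩
      obtain ⟨a1, a2, a3, a4, a5, a6, a7⟩ := hrow i j υ h6 h7 h8 hυ hM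
      refine ⟨a2, ⟨by simpa using a1, by simpa using a3, a4.setReg _ (by simp), a5,
        fun u v hv hu => ?_⟩, a7⟩
      rw [RamState.setReg_mem, a6 u v]
      by_cases huv : u = i ∧ v = j
      · rw [if_pos huv, huv.1, huv.2]
      · rw [if_neg huv]
        exact h2 u v hv (by omega)

/-- The preprocessing with step width `h`, number `K` of layers, step size `ε` of the multiplicative
weights and a number of rounds proportional to `N`. The factors of the loss stem from the
interpolation of the offline capacities, its truncation, and the multiplicative weights. -/
theorem preprocessProg_spec (G : TypeGraph) {h ε : ℚ} {K N : ℕ} (h0 : 0 < h) (h1 : h ≤ 1)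
    (hε : 0 < ε) (hε1 : ε ≤ 1) (hK : 0 < K) (hN : 1 ≤ (ε : ℝ) * N) :
    (preprocessProg h ε K N).steps G.encode ≤
      (G.m * (K + 2) + (G.n + 1) * (G.m * K * 2 + 4) + 6) +
      ((G.n * (G.m * (K * 40 + 3) + 10) + G.m * (K * 40 + 3) + 10) +
      ((N * ((G.n + 1) * (G.m * K + 1) * ((G.n + 1) * (G.m * K + 1) *
        (G.n * (G.m * K * 52 + 4) + 40 + 1) + 1 + 1) + 1) + 1) +
      (((G.n + 1) * ((G.m * K + 1) * 17 + 4) + 4) + (G.n * (G.m * (K * 7 + 5) + 5) + 2)))) ∧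
    G.IsLPFeasible (G.readSolution ((preprocessProg h ε K N).output G.encode)) ∧
    ∀ x', G.IsLPFeasible x' →
      ((1 - h) * (1 - Real.exp (-(K * h))) * ((1 - 1 / (ε * N)) / (1 + ε)) : ℝ) * G.lpValue x' ≤
        G.lpValue (G.readSolution ((preprocessProg h ε K N).output G.encode)) := by
  have h0' : (0 : ℝ) < h := by exact_mod_cast h0
  have hε' : (0 : ℝ) < ε := by exact_mod_cast hε
  obtain ⟨a1, a2⟩ := sizeProg_spec K (σ := G.encode) (by simp [encode]) (by simp [encode])
    (by simp [encode])
  have hn : G.encode.reg 0 = G.n := by simp [encode]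
  have hm : G.encode.reg 1 = G.m := by simp [encode]
  rw [hn, hm] at a1 a2
  set σ1 := (sizeProg K).output G.encode with hσ1
  have hpart : IsPartial (G.netState h K 0) 3 (G.layerCap h K) (fun _ _ => False) σ1 := by
    rw [a1]
    refine ⟨fun r hr => ?_, fun B hB hB3 => ?_, fun u v => by simp [encode]⟩
    · simp only [Finset.mem_insert, Finset.mem_singleton] at hr
      rcases hr with rfl | rfl | rfl | rfl | rfl | rfl | rfl <;> simp [netState, encode]
    · simp only [Finset.mem_insert, Finset.mem_singleton] at hB
      rcases hB with rfl | rfl | rfl | rfl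
      · simp [netState]
      · simp [netState]
      · exact absurd rfl hB3
      · simp [netState, encode]
        rfl
  obtain ⟨b1, b2⟩ := capProg_spec hpart
  set σ2 := (capProg h K).output σ1 with hσ2
  have hround : G.IsRound h ε K 0 σ2 := ⟨0, b1, flowInvariant_zero _ _ _ _⟩
  obtain ⟨⟨f, c1, c2⟩, c3⟩ := roundsProg_spec h0 hε hε1 (N := N) hround
  set σ3 := (roundsProg ε N).output σ2 with hσ3
  obtain ⟨d1, d2, d3⟩ := congestionProg_spec c1
  set σ4 := congestionProg.output σ3 with hσ4
  obtain ⟨e1, e2⟩ := collectProg_spec d1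
  set M := σ4.mem 7 0 0 with hM
  have hout : (preprocessProg h ε K N).output G.encode = (collectProg K).output σ4 := rfl
  have hsteps : (preprocessProg h ε K N).steps G.encode = (sizeProg K).steps G.encode +
    ((capProg h K).steps σ1 + ((roundsProg ε N).steps σ2 + (congestionProg.steps σ3 +
      (collectProg K).steps σ4))) := rfl
  rw [hsteps, hout]
  have hMpos : 0 < M := by linarith [d2.one_le]
  have hmax : ∀ e ∈ cells G.n (G.m * K), 0 < G.layerCap h K e.1 e.2 →
      f e.1 e.2 / G.layerCap h K e.1 e.2 ≤ M := fun e he hpos =>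
    d2.le e.1 e.2 (by simpa [cells] using he) hpos
  obtain ⟨f1, f2⟩ := isLPFeasible_of_flow h0' c2 hMpos hmax
    (x := G.readSolution ((collectProg K).output σ4)) (fun i j => e1 i i.2 j j.2)
  refine ⟨?_, f1, fun x' hx' => ?_⟩
  · exact Nat.add_le_add a2 (Nat.add_le_add b2 (Nat.add_le_add c3 (Nat.add_le_add d3 e2)))
  · have hcard : (cells G.n (G.m * K)).card = (G.n + 1) * (G.m * K + 1) := by simp [cells]
    rw [← hcard] at c2
    have := c2.mul_le (G.isNetwork_layerCap h0' K) hε' hN d2.one_le hmax (by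
      rcases d2.attained with h | ⟨u, v, hP, h⟩
      · exact Or.inl h
      · exact Or.inr ⟨(u, v), by simpa [cells] using hP, h⟩)
      (isDualBound_layerCap h0' (by exact_mod_cast h1) hK hx')
    rw [f2]
    refine le_trans (le_of_eq ?_) this
    ring

/-- Functions of the numbers of online and offline vertices that are polynomially bounded. -/
def PolyBounded (F : ℕ → ℕ → ℕ) : Prop := ∃ C d : ℕ, ∀ n m, F n m ≤ C * (n + m + 1) ^ d

end TypeGraph

open TypeGraph

theorem polyBounded_const (a : ℕ) : PolyBounded fun _ _ => a := ⟨a, 0, by simp⟩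

theorem polyBounded_left : PolyBounded fun n _ => n := ⟨1, 1, fun n m => by
  change n ≤ 1 * (n + m + 1) ^ 1
  rw [one_mul, pow_one]
  omega⟩

theorem polyBounded_right : PolyBounded fun _ m => m := ⟨1, 1, fun n m => by
  change m ≤ 1 * (n + m + 1) ^ 1
  rw [one_mul, pow_one]
  omega⟩

theorem PolyBounded.add {F F' : ℕ → ℕ → ℕ} (h : PolyBounded F) (h' : PolyBounded F') :
    PolyBounded fun n m => F n m + F' n m := by
  obtain ⟨C, d, h⟩ := h
  obtain ⟨C', d', h'⟩ := h'
  refine ⟨C + C', d + d', fun n m => (Nat.add_le_add (h n m) (h' n m)).trans ?_⟩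
  rw [add_mul]
  gcongr <;> omega

theorem PolyBounded.mul {F F' : ℕ → ℕ → ℕ} (h : PolyBounded F) (h' : PolyBounded F') :
    PolyBounded fun n m => F n m * F' n m := by
  obtain ⟨C, d, h⟩ := h
  obtain ⟨C', d', h'⟩ := h'
  refine ⟨C * C', d + d', fun n m => (Nat.mul_le_mul (h n m) (h' n m)).trans (le_of_eq ?_)⟩
  ring

/-- Any choice of the parameters whose total loss is at most `q` gives a polynomial preprocessing
with the ratio that `hasRatio_regGreedy` guarantees. -/
theorem polyTimePreprocessing {θ q Γ : ℝ} (h0 : 0 < θ) (h1 : θ ≤ 1 / 2)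
    (hΓ : Γ ≤ q * (alpha θ 0 + beta θ 0)) {h ε : ℚ} {K N : ℕ} (hh0 : 0 < h) (hh1 : h ≤ 1)
    (hε : 0 < ε) (hε1 : ε ≤ 1) (hK : 0 < K) (hN : 1 ≤ (ε : ℝ) * N)
    (hq : q ≤ (1 - h) * (1 - Real.exp (-(K * h))) * ((1 - 1 / (ε * N)) / (1 + ε))) :
    PolyTimePreprocessing θ q Γ := by
  have hpoly : PolyBounded fun n m => (m * (K + 2) + (n + 1) * (m * K * 2 + 4) + 6) +
      ((n * (m * (K * 40 + 3) + 10) + m * (K * 40 + 3) + 10) +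
      ((N * ((n + 1) * (m * K + 1) * ((n + 1) * (m * K + 1) *
        (n * (m * K * 52 + 4) + 40 + 1) + 1 + 1) + 1) + 1) +
      (((n + 1) * ((m * K + 1) * 17 + 4) + 4) + (n * (m * (K * 7 + 5) + 5) + 2)))) := by
    repeat' first
      | exact polyBounded_left
      | exact polyBounded_right
      | exact polyBounded_const _
      | apply PolyBounded.add
      | apply PolyBounded.mul
  obtain ⟨C, d, hCd⟩ := hpoly
  refine ⟨RamProg.preprocessProg h ε K N, C, d, fun G => ?_⟩
  obtain ⟨s1, s2, s3⟩ := G.preprocessProg_spec hh0 hh1 hε hε1 hK hN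
  have hopt : ∀ x', G.IsLPFeasible x' → q * G.lpValue x' ≤
      G.lpValue (G.readSolution ((RamProg.preprocessProg h ε K N).output G.encode)) :=
    fun x' hx' => (mul_le_mul_of_nonneg_right hq (lpValue_nonneg hx')).trans (s3 x' hx')
  exact ⟨s1.trans (hCd G.n G.m), s2, hopt, hasRatio_regGreedy h0 h1 s2 hΓ hopt⟩

/-- With `h = ε = 1/10000`, `K h = 10` and `ε N = 10000`, each of the four losses is at most about
`0.0001`, and so the total loss is less than `0.001`. -/
theorem exists_parameters : ∃ (h ε : ℚ) (K N : ℕ), 0 < h ∧ h ≤ 1 ∧ 0 < ε ∧ ε ≤ 1 ∧ 0 < K ∧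
    1 ≤ (ε : ℝ) * N ∧
    (0.999 : ℝ) ≤ (1 - h) * (1 - Real.exp (-(K * h))) * ((1 - 1 / (ε * N)) / (1 + ε)) := by
  refine ⟨1 / 10000, 1 / 10000, 100000, 100000000, by norm_num, by norm_num, by norm_num,
    by norm_num, by norm_num, by norm_num, ?_⟩
  have h1 : Real.exp (-10) ≤ 1 / 10000 := by
    have h2 : (2.7 : ℝ) ^ 10 ≤ Real.exp 10 := by
      have : Real.exp 10 = Real.exp 1 ^ 10 := by rw [← Real.exp_nat_mul]; norm_num
      rw [this]
      exact pow_le_pow_left₀ (by norm_num) (by linarith [Real.exp_one_gt_d9]) _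
    rw [Real.exp_neg, one_div]
    exact inv_anti₀ (by norm_num) (le_trans (by norm_num) h2)
  have e : -(((100000 : ℕ) : ℝ) * ((1 / 10000 : ℚ) : ℝ)) = -10 := by norm_num
  rw [e]
  push_cast
  norm_num
  nlinarith

end OnlineStochasticMatching

end

theorem mainTheorem3 :
    -- For every parameter the ratio is at least `α(0) + β(0)`.
    (∀ θ : ℝ, 0 < θ → θ ≤ 1 / 2 →
      OnlineStochasticMatching.RegGreedyCompetitive θ
        (OnlineStochasticMatching.alpha θ 0 + OnlineStochasticMatching.beta θ 0)) ∧
    -- For the parameter `θ = 17/40` it is at least `0.707`, which exceeds `1 - 1/e`.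
    OnlineStochasticMatching.RegGreedyCompetitive (17 / 40) 0.707 ∧
    1 - 1 / Real.exp 1 < 0.707 ∧
    -- The algorithm takes polynomial time.
    OnlineStochasticMatching.PolyTimeDecisions (17 / 40) ∧
    OnlineStochasticMatching.PolyTimePreprocessing (17 / 40) 0.999 0.707 := by
  refine ⟨fun θ h0 h1 => OnlineStochasticMatching.regGreedyCompetitive h0 h1 le_rfl,
    OnlineStochasticMatching.regGreedyCompetitive (by norm_num) (by norm_num) ?_,
    OnlineStochasticMatching.one_sub_inv_exp_lt, ?_, ?_⟩
  · have := OnlineStochasticMatching.ratio_le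
    norm_num at this ⊢
    linarith
  · have := OnlineStochasticMatching.polyTimeDecisions (17 / 40)
    push_cast at this
    exact this
  · obtain ⟨h, ε, K, N, h0, h1, hε, hε1, hK, hN, hq⟩ := OnlineStochasticMatching.exists_parameters
    exact OnlineStochasticMatching.polyTimePreprocessing (by norm_num) (by norm_num)
      OnlineStochasticMatching.ratio_le h0 h1 hε hε1 hK hN hq
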